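/- Fix $c\in\mathbb C$. The (extended) $N=1$ Ramond algebra has generators $L_m,G_m$ ($m\in\mathbb Z$), a central element $C$ and the parity operator $(-1)^F$, with $[L_m,L_n]=(m-n)L_{m+n}+\frac{C}{12}(m^3-m)\delta_{m+n,0}$, $[L_m,G_n]=(\frac m2-n)G_{m+n}$, $\{G_m,G_n\}=2L_{m+n}+\frac C3(m^2-\frac14)\delta_{m+n,0}$; $(-1)^F$ commutes with $L_m,C$ and anticommutes with $G_n$. The Verma module $V_\Delta$ ($\Delta\in\mathbb C$) is generated by a vector $|\Delta\rangle$ subject to $L_m|\Delta\rangle=G_m|\Delta\rangle=0$ for $m>0$, $L_0|\Delta\rangle=\Delta|\Delta\rangle$, $C|\Delta\rangle=c|\Delta\rangle$, $(-1)^F|\Delta\rangle=|\Delta\rangle$. The $G$-closed Verma module $V^G_{c/24}$, with highest weight vector $|\frac c{24}\rangle^G$, is obtained for $\Delta=\frac c{24}$ by imposing in addition $G_0|\frac c{24}\rangle^G=0$. A singular vector of level $l\in\mathbb N_0$ and parity $p=\pm$ in such a module is a vector with $L_0$-eigenvalue $\Delta+l$, $(-1)^F$-eigenvalue $p$ and $C$-eigenvalue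 $c$, annihilated by all $L_m,G_m$ with $m>0$, and not proportional to the highest weight vector. It is $G$-closed if $G_0$ annihilates it. Write vectors of $V_\Delta$ in normal form, i.e. as $\theta|\Delta\rangle$ with $\theta$ a linear combination of the monomials $L_{-m_j}\cdots L_{-m_1}G_{-n_k}\cdots G_{-n_1}L_{-1}^nG_{-1}^{r_1}G_0^{r_2}$, $m_j\ge\dots\ge m_1\ge2$, $n_k>\dots>n_1\ge2$, $n\ge 0$, $r_1,r_2\in\{0,1\}$, of level $\sum m_i+\sum n_i+n+r_1=l$ and parity $(-1)^{k+r_1+r_2}=p$ (only those with $r_2=0$ in $V^G_{c/24}$). If $\theta|\Delta\rangle$ is singular and $\theta$ is in normal form, $\theta$ is called a singular vector operator. In $V_\Delta$, $(a,b)^+_l$ denotes a normal form operator in which $L_{-1}^l$ and $L_{-1}^{l-1}G_{-1}G_0$ have coefficients $a$ and $b$, and $(a,b)^-_l$ one in which $L_{-1}^lG_0$ and $L_{-1}^{l-1}G_{-1}$ have coefficients $a$ and $b$ (with $b=0$ if $l=0$). For $G$-closed singular vectors in $V_\Delta$ only the first coefficient is recorded: $(a)^{+G}_l=aL_{-1}^l+\dots$,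 $(a)^{-G}_l=aL_{-1}^lG_0+\dots$. For $V^G_{c/24}$: $(a)^+_l=aL_{-1}^l+\dots$, $(a)^-_l=aL_{-1}^{l-1}G_{-1}+\dots$. An identity such as $\theta_1\theta_2|\Delta_2\rangle=(a,b)^p_l|\Delta_2\rangle$ means that the vector on the left has a normal form of level $l$ and parity $p$, and that the kernel coefficients of its normal form are $a,b$. **Theorem.** (i) Let $\theta_1=(a_1,b_1)^{p_1}_{l_1}$ and $\theta_2=(a_2,b_2)^{p_2}_{l_2}$ be singular vector operators for $V_{\Delta_1}$ and $V_{\Delta_2}$, $\Delta_2+l_2=\Delta_1$. If $l_1+l_2>0$, then $\theta_1\theta_2|\Delta_2\rangle$ is either zero or singular in $V_{\Delta_2}$ at level $l_1+l_2$ with parity $p_1p_2$. In all cases, with $\delta=\Delta_2-\frac c{24}$, \begin{align*} (a_1,b_1)^+_{l_1}(a_2,b_2)^+_{l_2}|\Delta_2\rangle&=(a_1a_2,\;a_1b_2+a_2b_1+2b_1b_2)^+_{l_1+l_2}|\Delta_2\rangle,\\ (a_1,b_1)^+_{l_1}(a_2,b_2)^-_{l_2}|\Delta_2\rangle&=(a_1a_2,\;a_1b_2+a_2b_1\delta+2b_1b_2)^-_{l_1+l_2}|\Delta_2\rangle,\\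 (a_1,b_1)^-_{l_1}(a_2,b_2)^+_{l_2}|\Delta_2\rangle&=(a_1a_2+2a_1b_2,\;\tfrac12l_2a_1a_2+a_2b_1-a_1b_2\delta)^-_{l_1+l_2}|\Delta_2\rangle,\\ (a_1,b_1)^-_{l_1}(a_2,b_2)^-_{l_2}|\Delta_2\rangle&=(a_1a_2\delta+2a_1b_2,\;a_2b_1+\tfrac12l_2a_1a_2-a_1b_2)^+_{l_1+l_2}|\Delta_2\rangle. \end{align*} (ii) Let $\theta_2$ be a singular vector operator of level $l_2$ and parity $p_2$ for $V^G_{c/24}$ and $\theta_1=(a_1,b_1)^{p_1}_{l_1}$ one for $V_{\Delta_1}$, $\Delta_1=\frac c{24}+l_2$. Then $\theta_1\theta_2|\frac c{24}\rangle^G$ is either zero or singular in $V^G_{c/24}$ at level $l_1+l_2$ with parity $p_1p_2$, and on $|\frac c{24}\rangle^G$ \begin{align*} (a_1,b_1)^+_{l_1}(a_2)^+_{l_2}&=(a_1a_2)^+_{l_1+l_2},& (a_1,b_1)^+_{l_1}(b_2)^-_{l_2}&=(a_1b_2+2b_1b_2)^-_{l_1+l_2},\\ (a_1,b_1)^-_{l_1}(a_2)^+_{l_2}&=(\tfrac12l_2a_1a_2+a_2b_1)^-_{l_1+l_2},&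 (a_1,b_1)^-_{l_1}(b_2)^-_{l_2}&=(2a_1b_2)^+_{l_1+l_2}. \end{align*} (iii) Let $\theta_1=(a_1)^{p_1G}_{l_1}$ be the operator of a $G$-closed singular vector of $V_{\frac c{24}-l_1}$ and $\theta_2=(a_2,b_2)^{p_2}_{l_2}$ a singular vector operator for $V_{\Delta_2}$, $\Delta_2+l_1+l_2=\frac c{24}$. Then $\theta_1\theta_2|\Delta_2\rangle$ is either zero or a $G$-closed singular vector of $V_{\Delta_2}$ at level $l_1+l_2$ with parity $p_1p_2$, and on $|\Delta_2\rangle$ \begin{align*} (a_1)^{+G}_{l_1}(a_2,b_2)^+_{l_2}&=(a_1a_2)^{+G}_{l_1+l_2},& (a_1)^{+G}_{l_1}(a_2,b_2)^-_{l_2}&=(a_1a_2)^{-G}_{l_1+l_2},\\ (a_1)^{-G}_{l_1}(a_2,b_2)^+_{l_2}&=(a_1a_2+2a_1b_2)^{-G}_{l_1+l_2},& (a_1)^{-G}_{l_1}(a_2,b_2)^-_{l_2}&=(-a_1a_2(l_1+l_2)+2a_1b_2)^{+G}_{l_1+l_2}. \end{align*} -/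

import Mathlib

noncomputable section

namespace Ramond

/-- Generators of the (extended) `N = 1` Ramond algebra: the Virasoro modes `L_m`, the fermionic
modes `G_n` (`m, n` integers), the central element `C` and the fermion parity operator `(-1)^F`. -/
inductive Gen : Type
  | L (m : ℤ)
  | G (n : ℤ)
  | C
  | F

/-- The free associative algebra on the generators. -/
abbrev FreeGen : Type := FreeAlgebra ℂ Gen

/-- A generator, as an element of the free algebra. -/
abbrev gen (x : Gen) : FreeGen := FreeAlgebra.ι ℂ x

/-- The (anti)commutation relations. That `(-1)^F` squares to one needs no relation of its own: it
acts by `1` on highest weight vectors, hence by `±1` on every monomial applied to one of them. -/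
inductive Rel : FreeGen → FreeGen → Prop
  | LL (m n : ℤ) : Rel
      (gen (.L m) * gen (.L n) - gen (.L n) * gen (.L m))
      (((m : ℂ) - n) • gen (.L (m + n))
        + (if m + n = 0 then ((m : ℂ) ^ 3 - m) / 12 else 0) • gen .C)
  | LG (m n : ℤ) : Rel
      (gen (.L m) * gen (.G n) - gen (.G n) * gen (.L m))
      (((m : ℂ) / 2 - n) • gen (.G (m + n)))
  | GG (m n : ℤ) : Rel
      (gen (.G m) * gen (.G n) + gen (.G n) * gen (.G m))
      ((2 : ℂ) • gen (.L (m + n))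
        + (if m + n = 0 then ((m : ℂ) ^ 2 - 1 / 4) / 3 else 0) • gen .C)
  | LC (m : ℤ) : Rel (gen (.L m) * gen .C) (gen .C * gen (.L m))
  | GC (n : ℤ) : Rel (gen (.G n) * gen .C) (gen .C * gen (.G n))
  | FL (m : ℤ) : Rel (gen .F * gen (.L m)) (gen (.L m) * gen .F)
  | FC : Rel (gen .F * gen .C) (gen .C * gen .F)
  | FG (n : ℤ) : Rel (gen .F * gen (.G n) + gen (.G n) * gen .F) 0

/-- The universal enveloping algebra of the Ramond algebra. -/
abbrev U : Type := RingQuot Rel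

/-- The image of a generator in the enveloping algebra. -/
def ofGen (x : Gen) : U := RingQuot.mkAlgHom ℂ Rel (gen x)

/-- `L_m` in the enveloping algebra. -/
def L (m : ℤ) : U := ofGen (.L m)

/-- `G_n` in the enveloping algebra. -/
def G (n : ℤ) : U := ofGen (.G n)

/-- The central element `C` in the enveloping algebra. -/
def C : U := ofGen .C

/-- The fermion parity operator `(-1)^F` in the enveloping algebra. -/
def F : U := ofGen .F

/-- The left annihilator conditions on the highest weight vector `|Δ⟩`: it is killed by the
positive modes, and `L_0`, `C`, `(-1)^F` act on it by `Δ`, `c`, `1`. -/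
def hwRel (c Δ : ℂ) : Set U :=
  {u | (∃ m : ℤ, 0 < m ∧ (u = L m ∨ u = G m)) ∨
    u = L 0 - algebraMap ℂ U Δ ∨ u = C - algebraMap ℂ U c ∨ u = F - 1}

/-- The Verma module `V_Δ` with central charge `c`: the enveloping algebra modulo the left ideal
generated by the highest weight conditions. -/
abbrev Verma (c Δ : ℂ) : Type := U ⧸ Submodule.span U (hwRel c Δ)

/-- The highest weight vector `|Δ⟩`. -/
def hw (c Δ : ℂ) : Verma c Δ := Submodule.Quotient.mk 1

/-- The `G`-closed Verma module `V^G_{c/24}`: in addition `G_0` kills the highest weight vector. -/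
abbrev VermaG (c : ℂ) : Type := U ⧸ Submodule.span U (hwRel c (c / 24) ∪ {G 0})

/-- The `G`-closed highest weight vector `|c/24⟩^G`. -/
def hwG (c : ℂ) : VermaG c := Submodule.Quotient.mk 1

/-- `Ψ` is a singular vector at level `l` and parity `p` (`1` or `-1`) in the highest weight module
`M` with highest weight vector `v` of conformal weight `Δ` and central charge `c`: a common
eigenvector of `L_0`, `(-1)^F`, `C`, not proportional to `v` (in particular nonzero), which is
annihilated by all positive modes. -/
structure IsSingular {M : Type} [AddCommGroup M] [Module ℂ M] [Module U M]
    (v : M) (c Δ : ℂ) (l : ℕ) (p : ℤˣ) (Ψ : M) : Prop where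
  weight : L 0 • Ψ = (Δ + l) • Ψ
  parity : F • Ψ = (((p : ℤ) : ℂ)) • Ψ
  central : C • Ψ = c • Ψ
  annL : ∀ m : ℤ, 0 < m → L m • Ψ = 0
  annG : ∀ m : ℤ, 0 < m → G m • Ψ = 0
  not_prop : ∀ k : ℂ, Ψ ≠ k • v

/-- A standard monomial
`L_{-m_j} ⋯ L_{-m_1} G_{-n_k} ⋯ G_{-n_1} L_{-1}^n G_{-1}^{r₁} G_0^{r₂}` with
`m_j ≥ ⋯ ≥ m_1 ≥ 2`, `n_k > ⋯ > n_1 ≥ 2` and `r₁, r₂ ∈ {0, 1}`; the lists are `[m_j, …, m_1]`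
and `[n_k, …, n_1]`. -/
structure Mono : Type where
  ls : List ℕ
  gs : List ℕ
  n : ℕ
  r₁ : Fin 2
  r₂ : Fin 2
  ls_sorted : ls.Pairwise (· ≥ ·)
  gs_sorted : gs.Pairwise (· > ·)
  ls_ge : ∀ m ∈ ls, 2 ≤ m
  gs_ge : ∀ m ∈ gs, 2 ≤ m

/-- The element of the enveloping algebra given by a standard monomial. -/
def Mono.toU (X : Mono) : U :=
  (X.ls.map fun m => L (-(m : ℤ))).prod * (X.gs.map fun m => G (-(m : ℤ))).prod
    * L (-1) ^ X.n * G (-1) ^ (X.r₁ : ℕ) * G 0 ^ (X.r₂ : ℕ)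

/-- The level of a standard monomial. -/
def Mono.level (X : Mono) : ℕ := X.ls.sum + X.gs.sum + X.n + X.r₁

/-- The parity of a standard monomial. -/
def Mono.parity (X : Mono) : ℤˣ := (-1) ^ (X.gs.length + (X.r₁ : ℕ) + (X.r₂ : ℕ))

/-- The standard monomials of level `l` and parity `p`. -/
def stdSet (l : ℕ) (p : ℤˣ) : Set Mono := {X | X.level = l ∧ X.parity = p}

/-- The standard monomials of level `l` and parity `p` without `G_0`. -/
def stdSetG (l : ℕ) (p : ℤˣ) : Set Mono := {X | X.level = l ∧ X.parity = p ∧ X.r₂ = 0}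

/-- The monomial `L_{-1}^n G_{-1}^{r₁} G_0^{r₂}`. -/
def lead (n : ℕ) (r₁ r₂ : Fin 2) : Mono where
  ls := []
  gs := []
  n := n
  r₁ := r₁
  r₂ := r₂
  ls_sorted := List.Pairwise.nil
  gs_sorted := List.Pairwise.nil
  ls_ge := by simp
  gs_ge := by simp

/-- An operator in normal form: a finite linear combination of standard monomials. -/
abbrev NormalOp : Type := Mono →₀ ℂ

/-- The element of the enveloping algebra given by an operator in normal form. -/
def NormalOp.toU (θ : NormalOp) : U := θ.sum fun X a => a • X.toU

/-- The first kernel coefficient at level `l`: the coefficient of `L_{-1}^l` for parity `+` and of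
`L_{-1}^l G_0` for parity `-`. -/
def coeffA (l : ℕ) (p : ℤˣ) (θ : NormalOp) : ℂ :=
  if p = 1 then θ (lead l 0 0) else θ (lead l 0 1)

/-- The second kernel coefficient at level `l`: the coefficient of `L_{-1}^{l-1} G_{-1} G_0` for
parity `+` and of `L_{-1}^{l-1} G_{-1}` for parity `-`. At level `0`, where there is no such term,
it is zero. -/
def coeffB (l : ℕ) (p : ℤˣ) (θ : NormalOp) : ℂ :=
  if l = 0 then 0
  else if p = 1 then θ (lead (l - 1) 1 1) else θ (lead (l - 1) 1 0)

/-- The kernel coefficient at level `l` in the `G`-closed Verma module: the coefficient of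
`L_{-1}^l` for parity `+` and of `L_{-1}^{l-1} G_{-1}` for parity `-`. -/
def coeffVG (l : ℕ) (p : ℤˣ) (θ : NormalOp) : ℂ :=
  if p = 1 then coeffA l 1 θ else coeffB l (-1) θ

/-- `θ` is a singular vector operator of level `l` and parity `p` for `V_Δ`, in normal form. -/
def IsSingularOp (c Δ : ℂ) (l : ℕ) (p : ℤˣ) (θ : NormalOp) : Prop :=
  (θ.support : Set Mono) ⊆ stdSet l p ∧ IsSingular (hw c Δ) c Δ l p (θ.toU • hw c Δ)

/-- `θ` is a singular vector operator of level `l` and parity `p` for the `G`-closed Verma module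
`V^G_{c/24}`, in normal form. -/
def IsSingularOpVG (c : ℂ) (l : ℕ) (p : ℤˣ) (θ : NormalOp) : Prop :=
  (θ.support : Set Mono) ⊆ stdSetG l p ∧ IsSingular (hwG c) c (c / 24) l p (θ.toU • hwG c)

/-- `θ` is the normal form of the vector `Ψ` of `V_Δ` of level `l` and parity `p`. -/
def IsNormalForm (c Δ : ℂ) (l : ℕ) (p : ℤˣ) (Ψ : Verma c Δ) (θ : NormalOp) : Prop :=
  (θ.support : Set Mono) ⊆ stdSet l p ∧ θ.toU • hw c Δ = Ψ

/-- `θ` is the normal form of the vector `Ψ` of `V^G_{c/24}` of level `l` and parity `p`. -/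
def IsNormalFormVG (c : ℂ) (l : ℕ) (p : ℤˣ) (Ψ : VermaG c) (θ : NormalOp) : Prop :=
  (θ.support : Set Mono) ⊆ stdSetG l p ∧ θ.toU • hwG c = Ψ

/-- `Ψ = (a, b)^p_l |Δ⟩`: the vector `Ψ` has a normal form of level `l` and parity `p`, and the
kernel coefficients of its normal form are `a` and `b`. -/
def HasCoeffs (c Δ : ℂ) (l : ℕ) (p : ℤˣ) (Ψ : Verma c Δ) (a b : ℂ) : Prop :=
  (∃ θ, IsNormalForm c Δ l p Ψ θ) ∧
    ∀ θ, IsNormalForm c Δ l p Ψ θ → coeffA l p θ = a ∧ coeffB l p θ = b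

/-- `Ψ = (a)^{pG}_l |Δ⟩`: the vector `Ψ` has a normal form of level `l` and parity `p`, and the
first kernel coefficient of its normal form is `a`. -/
def HasCoeffGClosed (c Δ : ℂ) (l : ℕ) (p : ℤˣ) (Ψ : Verma c Δ) (a : ℂ) : Prop :=
  (∃ θ, IsNormalForm c Δ l p Ψ θ) ∧
    ∀ θ, IsNormalForm c Δ l p Ψ θ → coeffA l p θ = a

/-- `Ψ = (a)^p_l |c/24⟩^G`: the vector `Ψ` of the `G`-closed Verma module has a normal form of level
`l` and parity `p`, and the kernel coefficient of its normal form is `a`. -/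
def HasCoeffVG (c : ℂ) (l : ℕ) (p : ℤˣ) (Ψ : VermaG c) (a : ℂ) : Prop :=
  (∃ θ, IsNormalFormVG c l p Ψ θ) ∧
    ∀ θ, IsNormalFormVG c l p Ψ θ → coeffVG l p θ = a

end Ramond

end

set_option linter.unusedSimpArgs false
set_option linter.unusedSectionVars false

noncomputable section

namespace Ramond

/-! ### Relations in the enveloping algebra -/

/-! Singularity. The vector `θ₂|Δ₂⟩` is a highest weight vector of weight `Δ₁` whose
`(-1)^F`-eigenvalue is a sign. The automorphism `rescaleF` absorbs that sign and fixes every normal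
form operator, so whatever annihilates `θ₁|Δ₁⟩` annihilates, after rescaling, `θ₁θ₂|Δ₂⟩`
(`rescaleF_smul_eq_zero`). Every condition on a singular vector except non-proportionality is of
this annihilator type, and a nonzero vector at positive level is not proportional to the generator
because the `L_0`-eigenvalues differ (`isSingular_mul`).

Coefficients. Divide the module by the images of all `L_{-m}`, `G_{-m}` with `m ≥ 2`. This subspace
is stable under `A = L_{-1}`, `B = G_{-1}`, `H = G_0`, which on the quotient satisfy `AB = BA`, `B²
= 0`, `HA = AH + B/2`, `HB + BH = 2A` (`kernelRel`), while `H²` is the scalar `δ` on the generator.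
A normal form operator becomes its two leading terms (`mkQ_even`, `mkQ_odd`), and multiplying two
such expressions gives the four formulas of (i) (`KernelRel.even_even` and its companions). Part
(ii) is the case `Hx = 0`, `δ = 0`; part (iii) is the case `δ = -(l₁ + l₂)`.

It remains to see that the product has a normal form and that its leading coefficients are
determined by the vector. Existence is a straightening argument (`letter_smul_wordSmul`).

Uniqueness of the two coefficients needs only the independence of the leading vectors modulo lower
modes, not a full basis theorem. It follows from one linear functional on the Verma module which
kills the lower modes, is invariant under `L_{-1}`, and takes the values `1`, `0`, `1` on `|Δ⟩`,
`G_0|Δ⟩`, `G_{-1}G_0|Δ⟩` (`exists_functional`).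

The functional comes from a free field realisation. On a Fock space with two boson-fermion families,
a supercurrent is defined by bilinear sums. It acts linearly on the modes, so its anticommutators
satisfy the Ramond relations up to scalars by Schur's lemma, and the Jacobi identity leaves a single
constant. The parameters of the second family are tuned to the given `c` and `δ`. The functional
evaluates two bosonic coordinates of the first family at `1`, the other bosons and all fermions at
`0`. -/

theorem mkAlgHom_gen (x : Gen) : RingQuot.mkAlgHom ℂ Rel (gen x) = ofGen x := rfl

theorem L_mul_L (m n : ℤ) : L m * L n = L n * L m + (((m : ℂ) - n) • L (m + n)
    + (if m + n = 0 then ((m : ℂ) ^ 3 - m) / 12 else 0) • C) := by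
  have h := RingQuot.mkAlgHom_rel ℂ (Rel.LL m n)
  simp only [map_sub, map_add, map_mul, map_smul, mkAlgHom_gen] at h
  rw [sub_eq_iff_eq_add'] at h
  exact h

theorem L_mul_G (m n : ℤ) : L m * G n = G n * L m + ((m : ℂ) / 2 - n) • G (m + n) := by
  have h := RingQuot.mkAlgHom_rel ℂ (Rel.LG m n)
  simp only [map_sub, map_mul, map_smul, mkAlgHom_gen] at h
  rw [sub_eq_iff_eq_add'] at h
  exact h

theorem G_mul_G (m n : ℤ) : G m * G n = -(G n * G m) + ((2 : ℂ) • L (m + n)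
    + (if m + n = 0 then ((m : ℂ) ^ 2 - 1 / 4) / 3 else 0) • C) := by
  have h := RingQuot.mkAlgHom_rel ℂ (Rel.GG m n)
  simp only [map_add, map_mul, map_smul, mkAlgHom_gen] at h
  rw [neg_add_eq_sub, eq_sub_iff_add_eq]
  exact h

theorem L_mul_C (m : ℤ) : L m * C = C * L m := by
  have h := RingQuot.mkAlgHom_rel ℂ (Rel.LC m)
  simp only [map_mul, mkAlgHom_gen] at h
  exact h

theorem G_mul_C (m : ℤ) : G m * C = C * G m := by
  have h := RingQuot.mkAlgHom_rel ℂ (Rel.GC m)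
  simp only [map_mul, mkAlgHom_gen] at h
  exact h

theorem F_mul_L (m : ℤ) : F * L m = L m * F := by
  have h := RingQuot.mkAlgHom_rel ℂ (Rel.FL m)
  simp only [map_mul, mkAlgHom_gen] at h
  exact h

theorem F_mul_C : F * C = C * F := by
  have h := RingQuot.mkAlgHom_rel ℂ Rel.FC
  simp only [map_mul, mkAlgHom_gen] at h
  exact h

theorem F_mul_G (m : ℤ) : F * G m = -(G m * F) := by
  have h := RingQuot.mkAlgHom_rel ℂ (Rel.FG m)
  simp only [map_mul, map_add, map_zero, mkAlgHom_gen] at h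
  exact eq_neg_of_add_eq_zero_left h

/-- An algebra homomorphism out of the enveloping algebra, from operators which satisfy the
relations. -/
def liftU {A : Type*} [Ring A] [Algebra ℂ A] (l g : ℤ → A) (z f : A)
    (hLL : ∀ m n, l m * l n - l n * l m = ((m : ℂ) - n) • l (m + n)
      + (if m + n = 0 then ((m : ℂ) ^ 3 - m) / 12 else 0) • z)
    (hLG : ∀ m n, l m * g n - g n * l m = ((m : ℂ) / 2 - n) • g (m + n))
    (hGG : ∀ m n, g m * g n + g n * g m = (2 : ℂ) • l (m + n)
      + (if m + n = 0 then ((m : ℂ) ^ 2 - 1 / 4) / 3 else 0) • z)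
    (hLC : ∀ m, l m * z = z * l m) (hGC : ∀ m, g m * z = z * g m)
    (hFL : ∀ m, f * l m = l m * f) (hFC : f * z = z * f)
    (hFG : ∀ m, f * g m + g m * f = 0) : U →ₐ[ℂ] A :=
  RingQuot.liftAlgHom ℂ ⟨FreeAlgebra.lift ℂ fun x => match x with
    | .L m => l m
    | .G m => g m
    | .C => z
    | .F => f, by
    intro x y h
    cases h <;> simp only [map_sub, map_add, map_mul, map_smul, map_zero, FreeAlgebra.lift_ι_apply]
    exacts [hLL _ _, hLG _ _, hGG _ _, hLC _, hGC _, hFL _, hFC, hFG _]⟩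

section liftU

variable {A : Type*} [Ring A] [Algebra ℂ A] {l g : ℤ → A} {z f : A} {hLL hLG hGG hLC hGC hFL hFC hFG}

theorem liftU_L (m : ℤ) : liftU l g z f hLL hLG hGG hLC hGC hFL hFC hFG (L m) = l m := by
  simp [liftU, L, ofGen]

theorem liftU_G (m : ℤ) : liftU l g z f hLL hLG hGG hLC hGC hFL hFC hFG (G m) = g m := by
  simp [liftU, G, ofGen]

theorem liftU_C : liftU l g z f hLL hLG hGG hLC hGC hFL hFC hFG C = z := by
  simp [liftU, C, ofGen]

theorem liftU_F : liftU l g z f hLL hLG hGG hLC hGC hFL hFC hFG F = f := by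
  simp [liftU, F, ofGen]

end liftU

/-- The automorphism of the enveloping algebra which rescales the parity operator by `ε`. -/
def rescaleF (ε : ℂ) : U →ₐ[ℂ] U :=
  liftU L G C (ε • F)
    (fun m n => by rw [L_mul_L m n, add_sub_cancel_left])
    (fun m n => by rw [L_mul_G m n, add_sub_cancel_left])
    (fun m n => by rw [G_mul_G m n]; abel)
    L_mul_C G_mul_C
    (fun m => by rw [smul_mul_assoc, mul_smul_comm, F_mul_L])
    (by rw [smul_mul_assoc, mul_smul_comm, F_mul_C])
    (fun m => by rw [smul_mul_assoc, mul_smul_comm, F_mul_G, smul_neg, neg_add_cancel])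

theorem rescaleF_L (ε : ℂ) (m : ℤ) : rescaleF ε (L m) = L m := liftU_L m

theorem rescaleF_G (ε : ℂ) (m : ℤ) : rescaleF ε (G m) = G m := liftU_G m

theorem rescaleF_C (ε : ℂ) : rescaleF ε C = C := liftU_C

theorem rescaleF_F (ε : ℂ) : rescaleF ε F = ε • F := liftU_F

theorem rescaleF_Mono (ε : ℂ) (X : Mono) : rescaleF ε X.toU = X.toU := by
  simp only [Mono.toU, map_mul, map_pow, map_list_prod, List.map_map, Function.comp_def,
    rescaleF_L, rescaleF_G]

theorem rescaleF_toU (ε : ℂ) (θ : NormalOp) : rescaleF ε θ.toU = θ.toU := by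
  simp only [NormalOp.toU, Finsupp.sum, map_sum, map_smul, rescaleF_Mono]

/-! ### Actions on modules -/

variable {M : Type*} [AddCommGroup M] [Module ℂ M] [Module U M]

section action

variable [IsScalarTower ℂ U M]

theorem L_L_smul (m n : ℤ) (w : M) : L m • L n • w = L n • L m • w + (((m : ℂ) - n) • L (m + n) • w
    + (if m + n = 0 then ((m : ℂ) ^ 3 - m) / 12 else 0) • C • w) := by
  rw [← mul_smul, L_mul_L]; simp only [add_smul, mul_smul, smul_assoc]

theorem L_G_smul (m n : ℤ) (w : M) : L m • G n • w = G n • L m • w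
    + ((m : ℂ) / 2 - n) • G (m + n) • w := by
  rw [← mul_smul, L_mul_G]; simp only [add_smul, mul_smul, smul_assoc]

theorem G_G_smul (m n : ℤ) (w : M) : G m • G n • w = -(G n • G m • w) + ((2 : ℂ) • L (m + n) • w
    + (if m + n = 0 then ((m : ℂ) ^ 2 - 1 / 4) / 3 else 0) • C • w) := by
  rw [← mul_smul, G_mul_G]; simp only [add_smul, neg_smul, mul_smul, smul_assoc]

theorem G_L_smul (n m : ℤ) (w : M) : G n • L m • w = L m • G n • w
    - ((m : ℂ) / 2 - n) • G (m + n) • w := by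
  rw [L_G_smul, add_sub_cancel_right]

theorem U_algebraMap_smul (a : ℂ) (w : M) : algebraMap ℂ U a • w = a • w :=
  algebraMap_smul U a w

end action

/-! ### Highest weight vectors and their annihilators. -/

/-- `v` is a highest weight vector of weight `Δ`, central charge `c` and `(-1)^F`-eigenvalue `ε`. -/
structure IsHW (c Δ ε : ℂ) (v : M) : Prop where
  annL : ∀ m : ℤ, 0 < m → L m • v = 0
  annG : ∀ m : ℤ, 0 < m → G m • v = 0
  weight : L 0 • v = Δ • v
  central : C • v = c • v
  parity : F • v = ε • v

theorem mk_smul_mk_one (S : Submodule U U) (u : U) :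
    u • (Submodule.Quotient.mk 1 : U ⧸ S) = Submodule.Quotient.mk u := by
  rw [← Submodule.Quotient.mk_smul, smul_eq_mul, mul_one]

theorem smul_hw_eq_zero_iff (c Δ : ℂ) (u : U) :
    u • hw c Δ = 0 ↔ u ∈ Submodule.span U (hwRel c Δ) := by
  rw [hw, mk_smul_mk_one, Submodule.Quotient.mk_eq_zero]

theorem isHW_of_hwRel_subset {c Δ : ℂ} {S : Submodule U U} (h : hwRel c Δ ⊆ S) :
    IsHW c Δ 1 (Submodule.Quotient.mk 1 : U ⧸ S) := by
  have key : ∀ u ∈ hwRel c Δ, u • (Submodule.Quotient.mk 1 : U ⧸ S) = 0 := fun u hu => by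
    rw [mk_smul_mk_one, Submodule.Quotient.mk_eq_zero]; exact h hu
  refine ⟨fun m hm => key _ (.inl ⟨m, hm, .inl rfl⟩), fun m hm => key _ (.inl ⟨m, hm, .inr rfl⟩),
    ?_, ?_, ?_⟩
  · have := key _ (.inr (.inl rfl))
    rwa [sub_smul, U_algebraMap_smul, sub_eq_zero] at this
  · have := key _ (.inr (.inr (.inl rfl)))
    rwa [sub_smul, U_algebraMap_smul, sub_eq_zero] at this
  · have := key _ (.inr (.inr (.inr rfl)))
    rw [one_smul]
    rwa [sub_smul, one_smul, sub_eq_zero] at this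

theorem isHW_hw (c Δ : ℂ) : IsHW c Δ 1 (hw c Δ) := isHW_of_hwRel_subset Submodule.subset_span

theorem isHW_hwG (c : ℂ) : IsHW c (c / 24) 1 (hwG c) :=
  isHW_of_hwRel_subset (Set.subset_union_left.trans Submodule.subset_span)

theorem G_zero_hwG (c : ℂ) : G 0 • hwG c = 0 := by
  rw [hwG, mk_smul_mk_one, Submodule.Quotient.mk_eq_zero]
  exact Submodule.subset_span (.inr rfl)

/-- The left annihilator of a highest weight vector `v` contains that of the highest weight vector
of the Verma module, up to the sign of the parity operator. -/
theorem rescaleF_smul_eq_zero [IsScalarTower ℂ U M] {c Δ ε : ℂ} {v : M} (hε : ε * ε = 1)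
    (hv : IsHW c Δ ε v) {u : U} (hu : u • hw c Δ = 0) : rescaleF ε u • v = 0 := by
  rw [smul_hw_eq_zero_iff] at hu
  induction hu using Submodule.span_induction with
  | zero => simp
  | add x y _ _ hx hy => rw [map_add, add_smul, hx, hy, add_zero]
  | smul a x _ hx => rw [smul_eq_mul, map_mul, mul_smul, hx, smul_zero]
  | mem x hx =>
    rcases hx with ⟨m, hm, rfl | rfl⟩ | rfl | rfl | rfl
    · rw [rescaleF_L, hv.annL m hm]
    · rw [rescaleF_G, hv.annG m hm]
    · rw [map_sub, rescaleF_L, AlgHom.commutes, sub_smul, U_algebraMap_smul, hv.weight, sub_self]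
    · rw [map_sub, rescaleF_C, AlgHom.commutes, sub_smul, U_algebraMap_smul, hv.central, sub_self]
    · rw [map_sub, rescaleF_F, map_one, sub_smul, one_smul, smul_assoc, hv.parity, smul_smul, hε,
        one_smul, sub_self]

/-- The relation `{G_0, G_0} = 2L_0 - C/12`, halved. This is where the shift `c/24` enters. -/
theorem IsHW.G_zero_G_zero [IsScalarTower ℂ U M] {c Δ ε : ℂ} {v : M} (hv : IsHW c Δ ε v) :
    G 0 • G 0 • v = (Δ - c / 24) • v := by
  have h := G_G_smul 0 0 v
  rw [eq_neg_add_iff_add_eq, ← two_smul ℂ, add_zero, if_pos rfl, hv.weight, hv.central] at h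
  generalize G 0 • G 0 • v = w at h ⊢
  simp only [Int.cast_zero] at h
  linear_combination (norm := module) (1 / 2 : ℂ) • h

end Ramond

end

noncomputable section


namespace Ramond

/-! ### The kernel calculus

Modulo the image of the modes `L_{-m}`, `G_{-m}` with `m ≥ 2`, only the action of `L_{-1}`, `G_{-1}`
and `G_0` remains. -/

section kernel

variable {V : Type*} [AddCommGroup V] [Module ℂ V] {A B H : Module.End ℂ V}

/-- The even kernel vector `a A^l x + b A^{l-1} B H x`. -/
def kerEven (A B H : Module.End ℂ V) (l : ℕ) (a b : ℂ) (x : V) : V :=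
  a • (A ^ l) x + b • (A ^ (l - 1)) (B (H x))

/-- The odd kernel vector `a A^l H x + b A^{l-1} B x`. -/
def kerOdd (A B H : Module.End ℂ V) (l : ℕ) (a b : ℂ) (x : V) : V :=
  a • (A ^ l) (H x) + b • (A ^ (l - 1)) (B x)

/-- The commutation relations of `L_{-1}`, `G_{-1}`, `G_0` modulo the lower modes. -/
structure KernelRel (A B H : Module.End ℂ V) : Prop where
  BA : ∀ y, B (A y) = A (B y)
  BB : ∀ y, B (B y) = 0
  HA : ∀ y, H (A y) = A (H y) + (1 / 2 : ℂ) • B y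
  HB : ∀ y, H (B y) = (2 : ℂ) • A y - B (H y)

theorem pow_apply_self (A : Module.End ℂ V) (n : ℕ) (y : V) : A ((A ^ n) y) = (A ^ n) (A y) := by
  rw [← Module.End.mul_apply, ← Module.End.mul_apply, ← pow_succ', pow_succ]

theorem pow_succ_apply (A : Module.End ℂ V) (n : ℕ) (y : V) :
    (A ^ (n + 1)) y = (A ^ n) (A y) := by
  rw [pow_succ, Module.End.mul_apply]

theorem pow_add_apply (A : Module.End ℂ V) (m n : ℕ) (y : V) :
    (A ^ (m + n)) y = (A ^ m) ((A ^ n) y) := by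
  rw [pow_add, Module.End.mul_apply]

namespace KernelRel

variable (h : KernelRel A B H)

include h

theorem BA_pow (n : ℕ) (y : V) : B ((A ^ n) y) = (A ^ n) (B y) := by
  induction n generalizing y with
  | zero => simp
  | succ n ih => rw [pow_succ_apply, ih, h.BA, pow_succ_apply]

/-- Commuting `H` past one `A` costs `B/2`, and `B` commutes with `A`, so the corrections add up.
The exponent is a successor to keep `A^(n-1)` free of truncated subtraction. -/
theorem HA_pow_succ (n : ℕ) (y : V) : H ((A ^ (n + 1)) y)
    = (A ^ n) (A (H y)) + (((n : ℂ) + 1) / 2) • (A ^ n) (B y) := by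
  induction n generalizing y with
  | zero => simp [h.HA]
  | succ n ih =>
    rw [pow_succ_apply, ih, h.HA, h.BA]
    simp only [pow_succ_apply, map_add, map_smul]
    push_cast
    module

/-- The correction from moving `H` through the powers of `A` vanishes because `B² = 0`; only `HB =
2A - BH` contributes. -/
theorem HA_pow_B (n : ℕ) (y : V) :
    H ((A ^ n) (B y)) = (2 : ℂ) • (A ^ n) (A y) - (A ^ n) (B (H y)) := by
  cases n with
  | zero => simp [h.HB]
  | succ n =>
    rw [h.HA_pow_succ, h.BB, h.HB, map_zero, smul_zero, add_zero]
    simp only [pow_succ_apply, map_sub, map_smul]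

variable {l₁ l₂ : ℕ} {a₁ b₁ a₂ b₂ δ : ℂ} {x : V}

/-- All `A`, `B`, `H` are moved into the order `A^n B H` and coefficients compared. At level zero
the exponent `l - 1` is truncated, so the second term would be meaningless; the hypotheses remove
it. -/
theorem even_even (h₁ : l₁ = 0 → b₁ = 0) (h₂ : l₂ = 0 → b₂ = 0) :
    kerEven A B H l₁ a₁ b₁ (kerEven A B H l₂ a₂ b₂ x) =
      kerEven A B H (l₁ + l₂) (a₁ * a₂) (a₁ * b₂ + a₂ * b₁ + 2 * b₁ * b₂) x := by
  rcases l₁ with _ | k₁ <;> rcases l₂ with _ | k₂ <;> try rw [h₁ rfl]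
  all_goals try rw [h₂ rfl]
  all_goals simp only [kerEven, map_add, map_smul, h.HA_pow_succ, h.HA_pow_B, Nat.add_sub_cancel,
    pow_zero, Module.End.one_apply, map_sub, ← add_assoc, h.BA_pow, zero_add, add_zero]
  all_goals try rw [show k₁ + 1 + k₂ = k₁ + k₂ + 1 by omega]
  all_goals simp only [map_add, map_smul, h.BA_pow, h.BA, h.BB, map_zero, pow_succ_apply,
    pow_add_apply, pow_apply_self]
  all_goals module

theorem even_odd (hx : H (H x) = δ • x) (h₁ : l₁ = 0 → b₁ = 0) (h₂ : l₂ = 0 → b₂ = 0) :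
    kerEven A B H l₁ a₁ b₁ (kerOdd A B H l₂ a₂ b₂ x) =
      kerOdd A B H (l₁ + l₂) (a₁ * a₂) (a₁ * b₂ + a₂ * b₁ * δ + 2 * b₁ * b₂) x := by
  rcases l₁ with _ | k₁ <;> rcases l₂ with _ | k₂ <;> try rw [h₁ rfl]
  all_goals try rw [h₂ rfl]
  all_goals simp only [kerEven, kerOdd, map_add, map_smul, h.HA_pow_succ, h.HA_pow_B,
    Nat.add_sub_cancel, pow_zero, Module.End.one_apply, map_sub, ← add_assoc, h.BA_pow, zero_add, add_zero, hx]
  all_goals try rw [show k₁ + 1 + k₂ = k₁ + k₂ + 1 by omega]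
  all_goals simp only [map_add, map_smul, h.BA_pow, h.BA, h.BB, map_zero, pow_succ_apply,
    pow_add_apply, pow_apply_self]
  all_goals module

theorem odd_even (hx : H (H x) = δ • x) (h₁ : l₁ = 0 → b₁ = 0) (h₂ : l₂ = 0 → b₂ = 0) :
    kerOdd A B H l₁ a₁ b₁ (kerEven A B H l₂ a₂ b₂ x) =
      kerOdd A B H (l₁ + l₂) (a₁ * a₂ + 2 * a₁ * b₂)
        (1 / 2 * l₂ * a₁ * a₂ + a₂ * b₁ - a₁ * b₂ * δ) x := by
  rcases l₁ with _ | k₁ <;> rcases l₂ with _ | k₂ <;> try rw [h₁ rfl]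
  all_goals try rw [h₂ rfl]
  all_goals simp only [kerEven, kerOdd, map_add, map_smul, h.HA_pow_succ, h.HA_pow_B,
    Nat.add_sub_cancel, pow_zero, Module.End.one_apply, map_sub, ← add_assoc, h.BA_pow, zero_add, add_zero, hx]
  all_goals try rw [show k₁ + 1 + k₂ = k₁ + k₂ + 1 by omega]
  all_goals simp only [map_add, map_smul, h.BA_pow, h.BA, h.BB, map_zero, pow_succ_apply,
    pow_add_apply, pow_apply_self]
  all_goals push_cast
  all_goals module

theorem odd_odd (hx : H (H x) = δ • x) (h₁ : l₁ = 0 → b₁ = 0) (h₂ : l₂ = 0 → b₂ = 0) :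
    kerOdd A B H l₁ a₁ b₁ (kerOdd A B H l₂ a₂ b₂ x) =
      kerEven A B H (l₁ + l₂) (a₁ * a₂ * δ + 2 * a₁ * b₂)
        (a₂ * b₁ + 1 / 2 * l₂ * a₁ * a₂ - a₁ * b₂) x := by
  rcases l₁ with _ | k₁ <;> rcases l₂ with _ | k₂ <;> try rw [h₁ rfl]
  all_goals try rw [h₂ rfl]
  all_goals simp only [kerEven, kerOdd, map_add, map_smul, h.HA_pow_succ, h.HA_pow_B,
    Nat.add_sub_cancel, pow_zero, Module.End.one_apply, map_sub, ← add_assoc, h.BA_pow, zero_add, add_zero, hx]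
  all_goals try rw [show k₁ + 1 + k₂ = k₁ + k₂ + 1 by omega]
  all_goals simp only [map_add, map_smul, h.BA_pow, h.BA, h.BB, map_zero, pow_succ_apply,
    pow_add_apply, pow_apply_self]
  all_goals push_cast
  all_goals module

end KernelRel

end kernel

/-! ### The quotient by the image of the lower modes. -/

variable (M : Type*) [AddCommGroup M] [Module ℂ M] [Module U M]

/-- The span of the images of the modes `L_{-m}`, `G_{-m}` with `m ≥ 2`. -/
def lowSpan : Submodule ℂ M :=
  Submodule.span ℂ {w | ∃ m : ℤ, m ≤ -2 ∧ ∃ w' : M, w = L m • w' ∨ w = G m • w'}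

variable {M}

theorem L_smul_mem_lowSpan {m : ℤ} (hm : m ≤ -2) (w : M) : L m • w ∈ lowSpan M :=
  Submodule.subset_span ⟨m, hm, w, .inl rfl⟩

theorem G_smul_mem_lowSpan {m : ℤ} (hm : m ≤ -2) (w : M) : G m • w ∈ lowSpan M :=
  Submodule.subset_span ⟨m, hm, w, .inr rfl⟩

variable [IsScalarTower ℂ U M]

theorem smul_mem_lowSpan {u : U}
    (hL : ∀ m ≤ (-2 : ℤ), ∀ w : M, u • L m • w ∈ lowSpan M)
    (hG : ∀ m ≤ (-2 : ℤ), ∀ w : M, u • G m • w ∈ lowSpan M) :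
    lowSpan M ≤ (lowSpan M).comap (Algebra.lsmul ℂ ℂ M u) := by
  refine Submodule.span_le.2 ?_
  rintro _ ⟨m, hm, w, rfl | rfl⟩
  exacts [hL m hm w, hG m hm w]

/-- Commuting `L_{-1}` past a mode of index at most `-2` produces a mode of still lower index, and
no central term since the indices do not cancel. -/
theorem L_neg_one_mem_lowSpan :
    lowSpan M ≤ (lowSpan M).comap (Algebra.lsmul ℂ ℂ M (L (-1))) := by
  refine smul_mem_lowSpan (fun m hm w => ?_) fun m hm w => ?_
  · rw [L_L_smul, if_neg (by omega), zero_smul, add_zero]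
    exact add_mem (L_smul_mem_lowSpan hm _)
      (Submodule.smul_mem _ _ (L_smul_mem_lowSpan (by omega) _))
  · rw [L_G_smul]
    exact add_mem (G_smul_mem_lowSpan hm _)
      (Submodule.smul_mem _ _ (G_smul_mem_lowSpan (by omega) _))

theorem G_nonpos_mem_lowSpan {n : ℤ} (hn : n ≤ 0) :
    lowSpan M ≤ (lowSpan M).comap (Algebra.lsmul ℂ ℂ M (G n)) := by
  refine smul_mem_lowSpan (fun m hm w => ?_) fun m hm w => ?_
  · rw [G_L_smul]
    exact sub_mem (L_smul_mem_lowSpan hm _)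
      (Submodule.smul_mem _ _ (G_smul_mem_lowSpan (by omega) _))
  · rw [G_G_smul, if_neg (by omega), zero_smul, add_zero]
    exact add_mem (neg_mem (G_smul_mem_lowSpan hm _))
      (Submodule.smul_mem _ _ (L_smul_mem_lowSpan (by omega) _))

variable (M) in
/-- The quotient by the image of the lower modes. -/
abbrev LowQuot : Type _ := M ⧸ lowSpan M

variable (M) in
/-- `L_{-1}` modulo the lower modes. -/
def lowL : Module.End ℂ (LowQuot M) := (lowSpan M).mapQ _ _ L_neg_one_mem_lowSpan

variable (M) in
/-- `G_{-1}` modulo the lower modes. -/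
def lowG : Module.End ℂ (LowQuot M) := (lowSpan M).mapQ _ _ (G_nonpos_mem_lowSpan (n := -1) (by simp))

variable (M) in
/-- `G_0` modulo the lower modes. -/
def lowG₀ : Module.End ℂ (LowQuot M) := (lowSpan M).mapQ _ _ (G_nonpos_mem_lowSpan le_rfl)

theorem mkQ_L_neg_one (w : M) : (lowSpan M).mkQ (L (-1) • w) = lowL M ((lowSpan M).mkQ w) := rfl

theorem mkQ_G_neg_one (w : M) : (lowSpan M).mkQ (G (-1) • w) = lowG M ((lowSpan M).mkQ w) := rfl

theorem mkQ_G_zero (w : M) : (lowSpan M).mkQ (G 0 • w) = lowG₀ M ((lowSpan M).mkQ w) := rfl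

theorem mkQ_eq_zero {w : M} (h : w ∈ lowSpan M) : (lowSpan M).mkQ w = 0 :=
  (Submodule.Quotient.mk_eq_zero _).2 h

theorem mkQ_L_neg_one_pow (n : ℕ) (w : M) :
    (lowSpan M).mkQ (L (-1) ^ n • w) = (lowL M ^ n) ((lowSpan M).mkQ w) := by
  induction n generalizing w with
  | zero => simp
  | succ n ih => rw [pow_succ, mul_smul, ih, mkQ_L_neg_one, pow_succ_apply]

-- The terms dropped from the Ramond relations are the multiple of `G_{-2}` in `[G_{-1}, L_{-1}]`
-- and `G_{-1}² = L_{-2}`. The remaining two relations hold before passing to the quotient.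
variable (M) in
theorem kernelRel : KernelRel (lowL M) (lowG M) (lowG₀ M) where
  BA y := by
    obtain ⟨w, rfl⟩ := (lowSpan M).mkQ_surjective y
    rw [← mkQ_L_neg_one, ← mkQ_G_neg_one, ← mkQ_G_neg_one, ← mkQ_L_neg_one, G_L_smul, map_sub,
      LinearMap.map_smul, mkQ_eq_zero (G_smul_mem_lowSpan (by norm_num) w), smul_zero, sub_zero]
  BB y := by
    obtain ⟨w, rfl⟩ := (lowSpan M).mkQ_surjective y
    have h := G_G_smul (-1) (-1) w
    rw [if_neg (by norm_num), zero_smul, add_zero, eq_neg_add_iff_add_eq, ← two_smul ℂ] at h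
    have h2 := congrArg (lowSpan M).mkQ (smul_right_injective M (two_ne_zero (α := ℂ)) h)
    rwa [mkQ_eq_zero (L_smul_mem_lowSpan (by norm_num) w)] at h2
  HA y := by
    obtain ⟨w, rfl⟩ := (lowSpan M).mkQ_surjective y
    rw [← mkQ_L_neg_one, ← mkQ_G_zero, ← mkQ_G_zero, ← mkQ_L_neg_one, G_L_smul, map_sub,
      LinearMap.map_smul, add_zero, mkQ_G_neg_one]
    push_cast
    module
  HB y := by
    obtain ⟨w, rfl⟩ := (lowSpan M).mkQ_surjective y
    rw [← mkQ_L_neg_one, ← mkQ_G_zero, ← mkQ_G_neg_one, ← mkQ_G_zero, ← mkQ_G_neg_one, G_G_smul,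
      if_neg (by norm_num), zero_smul, add_zero, map_add, map_neg, LinearMap.map_smul, zero_add,
      neg_add_eq_sub]

/-! ### Normal form operators modulo the lower modes. -/

/-- In `Mono.toU` the lists of naturals are first coerced, monadically, to lists of integers. Here
the cast is moved into the mapped function, the form in which the lists simplify. -/
theorem Mono.toU_eq (X : Mono) : X.toU = (X.ls.map fun m : ℕ => L (-(m : ℤ))).prod
    * (X.gs.map fun m : ℕ => G (-(m : ℤ))).prod
    * L (-1) ^ X.n * G (-1) ^ (X.r₁ : ℕ) * G 0 ^ (X.r₂ : ℕ) := by
  have h : ∀ l : List ℕ, (do let a ← l; pure (a : ℤ)) = l.map fun a : ℕ => (a : ℤ) := fun l => by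
    induction l with
    | nil => rfl
    | cons a t ih => exact congrArg (List.cons (a : ℤ)) ih
  simp only [Mono.toU, h, List.map_map, Function.comp_def]

theorem fin_two_cases (r : Fin 2) : r = 0 ∨ r = 1 := by omega

theorem mkQ_lead (n : ℕ) (r₁ r₂ : Fin 2) (v : M) :
    (lowSpan M).mkQ ((lead n r₁ r₂).toU • v) =
      (lowL M ^ n) ((lowG M ^ (r₁ : ℕ)) ((lowG₀ M ^ (r₂ : ℕ)) ((lowSpan M).mkQ v))) := by
  simp only [Mono.toU_eq, lead, List.map_nil, List.prod_nil, one_mul, mul_smul, mkQ_L_neg_one_pow]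
  rcases fin_two_cases r₁ with rfl | rfl <;> rcases fin_two_cases r₂ with rfl | rfl <;>
    simp only [Fin.val_zero, Fin.val_one, pow_zero, pow_one, one_smul, Module.End.one_apply,
      mkQ_G_neg_one, mkQ_G_zero]

theorem Mono.eq_lead {X : Mono} (h₁ : X.ls = []) (h₂ : X.gs = []) : X = lead X.n X.r₁ X.r₂ := by
  cases X; simp only at h₁ h₂; subst h₁ h₂; rfl

theorem Mono.eq_lead_or_mem (X : Mono) (v : M) :
    X = lead X.n X.r₁ X.r₂ ∨ X.toU • v ∈ lowSpan M := by
  rcases hl : X.ls with _ | ⟨m, t⟩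
  · rcases hg : X.gs with _ | ⟨m, t⟩
    · exact .inl (Mono.eq_lead hl hg)
    · right
      have := X.gs_ge m (by simp [hg])
      simp only [Mono.toU_eq, hl, hg, List.map_nil, List.prod_nil, one_mul, List.map_cons,
        List.prod_cons, mul_smul]
      exact G_smul_mem_lowSpan (m := -m) (by omega) _
  · right
    have := X.ls_ge m (by simp [hl])
    simp only [Mono.toU_eq, hl, List.map_cons, List.prod_cons, mul_smul]
    exact L_smul_mem_lowSpan (m := -m) (by omega) _

theorem NormalOp.toU_smul (θ : NormalOp) (v : M) : θ.toU • v = θ.sum fun X a => a • X.toU • v := by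
  simp only [NormalOp.toU, Finsupp.sum, Finset.sum_smul, smul_assoc]

-- Only two monomials can survive in the quotient. The proposition `P` says whether `X₂` really has
-- the required level and parity: at level zero it does not, its exponent `l - 1` being truncated,
-- and its coefficient must be dropped, in agreement with the default value of `coeffB`.
open Classical in
theorem mkQ_toU_smul {θ : NormalOp} {v : M} {X₁ X₂ : Mono} {P : Prop} (hne : X₁ ≠ X₂)
    (h : ∀ X ∈ θ.support, (lowSpan M).mkQ (X.toU • v) ≠ 0 → X = X₁ ∨ (X = X₂ ∧ P)) :
    (lowSpan M).mkQ (θ.toU • v) = θ X₁ • (lowSpan M).mkQ (X₁.toU • v)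
      + (if P then θ X₂ else 0) • (lowSpan M).mkQ (X₂.toU • v) := by
  have h1 : (lowSpan M).mkQ (θ.toU • v) = ∑ X ∈ θ.support,
      ((if X = X₁ then θ X₁ • (lowSpan M).mkQ (X₁.toU • v) else 0) +
      if X = X₂ then (if P then θ X₂ else 0) • (lowSpan M).mkQ (X₂.toU • v) else 0) := by
    rw [NormalOp.toU_smul, Finsupp.sum, map_sum]
    refine Finset.sum_congr rfl fun X hX => ?_
    rw [map_smul]
    by_cases h0 : (lowSpan M).mkQ (X.toU • v) = 0
    · rw [h0, smul_zero]
      split_ifs with e1 e2 e3 e3 <;> (try subst e1) <;> (try subst e2) <;> (try subst e3) <;>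
        simp only [h0, smul_zero, add_zero]
    · rcases h X hX h0 with rfl | ⟨rfl, hP⟩
      · simp [hne]
      · simp [hne.symm, hP]
  rw [h1, Finset.sum_add_distrib, Finset.sum_ite_eq', Finset.sum_ite_eq']
  congr 1
  · split_ifs with e <;> simp_all
  · split_ifs with e <;> simp_all

theorem mkQ_even {l : ℕ} {θ : NormalOp} (hθ : (θ.support : Set Mono) ⊆ stdSet l 1) (v : M) :
    (lowSpan M).mkQ (θ.toU • v) = kerEven (lowL M) (lowG M) (lowG₀ M) l (coeffA l 1 θ)
      (coeffB l 1 θ) ((lowSpan M).mkQ v) := by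
  rw [mkQ_toU_smul (X₁ := lead l 0 0) (X₂ := lead (l - 1) 1 1) (P := ¬ l = 0) (by simp [lead])]
  · rw [mkQ_lead, mkQ_lead, kerEven, coeffA, coeffB]
    simp
  · intro X hX h0
    obtain ⟨hl, hp⟩ := hθ hX
    have hX' := (X.eq_lead_or_mem v).resolve_right fun h => h0 (mkQ_eq_zero h)
    rw [hX'] at hl hp ⊢
    rcases fin_two_cases X.r₁ with h1 | h1 <;> rcases fin_two_cases X.r₂ with h2 | h2 <;>
      -- Level and parity exclude all choices of `r₁`, `r₂` but two, and fix the exponent of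
      -- `L_{-1}`.
      rw [h1, h2] at hl hp ⊢ <;> simp [lead, Mono.level, Mono.parity] at hl hp ⊢ <;> omega

theorem mkQ_odd {l : ℕ} {θ : NormalOp} (hθ : (θ.support : Set Mono) ⊆ stdSet l (-1)) (v : M) :
    (lowSpan M).mkQ (θ.toU • v) = kerOdd (lowL M) (lowG M) (lowG₀ M) l (coeffA l (-1) θ)
      (coeffB l (-1) θ) ((lowSpan M).mkQ v) := by
  rw [mkQ_toU_smul (X₁ := lead l 0 1) (X₂ := lead (l - 1) 1 0) (P := ¬ l = 0) (by simp [lead])]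
  · rw [mkQ_lead, mkQ_lead, kerOdd, coeffA, coeffB]
    simp
  · intro X hX h0
    obtain ⟨hl, hp⟩ := hθ hX
    have hX' := (X.eq_lead_or_mem v).resolve_right fun h => h0 (mkQ_eq_zero h)
    rw [hX'] at hl hp ⊢
    rcases fin_two_cases X.r₁ with h1 | h1 <;> rcases fin_two_cases X.r₂ with h2 | h2 <;>
      rw [h1, h2] at hl hp ⊢ <;> simp [lead, Mono.level, Mono.parity] at hl hp ⊢ <;> omega

end Ramond

end

noncomputable section


namespace Ramond

/-! ### Straightening

A letter `(d, b)` stands for `L_{-d}` or, if `b` is true, for `G_{-d}`. -/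

/-- The element of the enveloping algebra given by a letter. -/
def letterU (x : ℕ × Bool) : U := if x.2 then G (-(x.1 : ℤ)) else L (-(x.1 : ℤ))

/-- The parity of a letter. -/
def letterParity (x : ℕ × Bool) : ℤˣ := if x.2 then -1 else 1

/-- The letters used in normal forms: all but `L_0`. -/
def GoodLetter (x : ℕ × Bool) : Prop := x.2 = false → 1 ≤ x.1

/-- The blocks of a standard monomial. -/
def letterClass (x : ℕ × Bool) : ℕ :=
  if 2 ≤ x.1 then (if x.2 then 1 else 0) else if x.2 then (if x.1 = 1 then 3 else 4) else 2

/-- `Precedes x y` if `x` may stand to the left of `y` in a standard monomial. -/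
def Precedes (x y : ℕ × Bool) : Prop :=
  letterClass x < letterClass y ∨
    letterClass x = letterClass y ∧ (y.1 < x.1 ∨ y.1 = x.1 ∧ x.2 = false)

theorem Precedes.trans {x y z : ℕ × Bool} (h : Precedes x y) (h' : Precedes y z) :
    Precedes x z := by
  simp only [Precedes] at h h' ⊢
  grind

/-- Bosonic letters may be repeated, so they precede themselves; the only obstruction to an order is
a repeated fermionic letter. -/
theorem precedes_trichotomy {x y : ℕ × Bool} (hx : GoodLetter x) (hy : GoodLetter y) :
    Precedes x y ∨ Precedes y x ∨ x = y ∧ x.2 = true := by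
  obtain ⟨d, _ | _⟩ := x <;> obtain ⟨e, _ | _⟩ := y <;>
    simp [Precedes, letterClass, GoodLetter] at hx hy ⊢ <;> split_ifs <;> omega

theorem not_precedes_zero {x : ℕ × Bool} (hx : GoodLetter x) : ¬ Precedes (0, true) x := by
  obtain ⟨d, _ | _⟩ := x <;> simp [Precedes, letterClass, GoodLetter] at hx ⊢ <;> split_ifs <;> omega

/-- Among good letters only `G_0` has level zero, and it may not be repeated. Hence a swap during
sorting never creates `L_0` or a central term. -/
theorem precedes_irrefl_zero {x y : ℕ × Bool} (h : Precedes y x) (hy : GoodLetter y)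
    (hx : GoodLetter x) : ¬ (x.1 = 0 ∧ y.1 = 0) := by
  obtain ⟨d, _ | _⟩ := x <;> obtain ⟨e, _ | _⟩ := y <;>
    simp [Precedes, letterClass, GoodLetter] at hx hy h ⊢ <;> split_ifs at h <;> omega

variable {M : Type*} [AddCommGroup M] [Module ℂ M] [Module U M]

/-- A word of letters applied to `v`. -/
def wordSmul (w : List (ℕ × Bool)) (v : M) : M := (w.map letterU).prod • v

theorem wordSmul_nil (v : M) : wordSmul [] v = v := by simp [wordSmul]

theorem wordSmul_cons (x : ℕ × Bool) (w : List (ℕ × Bool)) (v : M) :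
    wordSmul (x :: w) v = letterU x • wordSmul w v := by simp [wordSmul, mul_smul]

/-- The level of a word. -/
def wordLevel (w : List (ℕ × Bool)) : ℕ := (w.map Prod.fst).sum

/-- The parity of a word. -/
def wordParity (w : List (ℕ × Bool)) : ℤˣ := (w.map letterParity).prod

/-- The sorted words. -/
def SortedWord (w : List (ℕ × Bool)) : Prop := (∀ x ∈ w, GoodLetter x) ∧ w.Pairwise Precedes

theorem sortedWord_nil : SortedWord [] := ⟨by simp, List.Pairwise.nil⟩

theorem sortedWord_cons {x : ℕ × Bool} {w : List (ℕ × Bool)} :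
    SortedWord (x :: w) ↔ GoodLetter x ∧ (∀ y ∈ w, Precedes x y) ∧ SortedWord w := by
  simp only [SortedWord, List.mem_cons, forall_eq_or_imp, List.pairwise_cons]
  tauto

/-- The vectors given by the sorted words of level `l` and parity `p` which satisfy `P`. -/
def wordSpan (v : M) (l : ℕ) (p : ℤˣ) (P : List (ℕ × Bool) → Prop) : Submodule ℂ M :=
  Submodule.span ℂ {u | ∃ w, SortedWord w ∧ wordLevel w = l ∧ wordParity w = p ∧ P w ∧
    u = wordSmul w v}

theorem wordSmul_mem_wordSpan {v : M} {w : List (ℕ × Bool)} {l : ℕ} {p : ℤˣ}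
    {P : List (ℕ × Bool) → Prop} (hw : SortedWord w) (hl : wordLevel w = l)
    (hp : wordParity w = p) (hP : P w) : wordSmul w v ∈ wordSpan v l p P :=
  Submodule.subset_span ⟨w, hw, hl, hp, hP, rfl⟩

theorem wordSpan_mono {v : M} {l : ℕ} {p : ℤˣ} {P Q : List (ℕ × Bool) → Prop}
    (h : ∀ w, P w → Q w) : wordSpan v l p P ≤ wordSpan v l p Q :=
  Submodule.span_mono fun _ ⟨w, h1, h2, h3, h4, h5⟩ => ⟨w, h1, h2, h3, h w h4, h5⟩

variable [IsScalarTower ℂ U M]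

theorem smul_mem_of_wordSpan {v : M} {l : ℕ} {p : ℤˣ} {P : List (ℕ × Bool) → Prop} (u : U)
    (N : Submodule ℂ M)
    (h : ∀ w, SortedWord w → wordLevel w = l → wordParity w = p → P w → u • wordSmul w v ∈ N)
    {y : M} (hy : y ∈ wordSpan v l p P) : u • y ∈ N := by
  have : wordSpan v l p P ≤ N.comap (Algebra.lsmul ℂ ℂ M u) := by
    refine Submodule.span_le.2 ?_
    rintro _ ⟨w, h1, h2, h3, h4, rfl⟩
    exact h w h1 h2 h3 h4
  exact this hy

/-- The commutator of two letters is a multiple of one letter whose level is the sum, with parity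
the product. The levels not both being zero, no central term occurs. -/
theorem letter_swap (x y : ℕ × Bool) (h : ¬ (x.1 = 0 ∧ y.1 = 0)) : ∃ ε a : ℂ, ∀ w : M,
    letterU x • letterU y • w = ε • letterU y • letterU x • w
      + a • letterU (x.1 + y.1, xor x.2 y.2) • w := by
  obtain ⟨d, b⟩ := x
  obtain ⟨e, b'⟩ := y
  have hne : -(d : ℤ) + -(e : ℤ) ≠ 0 := by simp only at h; omega
  have hs : -((d + e : ℕ) : ℤ) = -(d : ℤ) + -(e : ℤ) := by push_cast; ring
  cases b <;> cases b' <;> simp only [letterU, Bool.false_eq_true, if_true, if_false, Bool.xor_false,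
    Bool.xor_true, Bool.not_true, Bool.not_false, hs]
  · refine ⟨1, ((-(d : ℤ) : ℤ) : ℂ) - ((-(e : ℤ) : ℤ) : ℂ), fun w => ?_⟩
    rw [L_L_smul, if_neg hne, zero_smul, add_zero, one_smul]
  · refine ⟨1, ((-(d : ℤ) : ℤ) : ℂ) / 2 - ((-(e : ℤ) : ℤ) : ℂ), fun w => ?_⟩
    rw [L_G_smul, one_smul]
  · refine ⟨1, -(((-(e : ℤ) : ℤ) : ℂ) / 2 - ((-(d : ℤ) : ℤ) : ℂ)), fun w => ?_⟩
    rw [G_L_smul, one_smul, neg_smul, sub_eq_add_neg, add_comm (-(e : ℤ))]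
  · refine ⟨-1, 2, fun w => ?_⟩
    rw [G_G_smul, if_neg hne, zero_smul, add_zero, neg_one_smul]

theorem letter_sq {d : ℕ} (h : d ≠ 0) (w : M) :
    letterU (d, true) • letterU (d, true) • w = letterU (d + d, false) • w := by
  have h1 := G_G_smul (-(d : ℤ)) (-(d : ℤ)) w
  rw [if_neg (by omega), zero_smul, add_zero, eq_neg_add_iff_add_eq, ← two_smul ℂ] at h1
  have h2 := smul_right_injective M (two_ne_zero (α := ℂ)) h1
  simpa [letterU] using h2

theorem wordLevel_cons (x : ℕ × Bool) (w : List (ℕ × Bool)) :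
    wordLevel (x :: w) = x.1 + wordLevel w := by simp [wordLevel]

theorem wordParity_cons (x : ℕ × Bool) (w : List (ℕ × Bool)) :
    wordParity (x :: w) = letterParity x * wordParity w := by simp [wordParity]

theorem letterParity_xor (d : ℕ) (x y : ℕ × Bool) :
    letterParity (d, xor x.2 y.2) = letterParity x * letterParity y := by
  obtain ⟨d, _ | _⟩ := x <;> obtain ⟨e, _ | _⟩ := y <;> simp [letterParity]

/-- Straightening: a letter times a sorted word of length `k` is a combination of sorted words of
length at most `k + 1`, those of length `k + 1` having no new letters. -/
theorem letter_smul_wordSmul {c Δ ε : ℂ} {v : M} (hv : IsHW c Δ ε v) :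
    ∀ (k : ℕ) (w : List (ℕ × Bool)), w.length = k → SortedWord w → ∀ x, GoodLetter x →
      letterU x • wordSmul w v ∈ wordSpan v (x.1 + wordLevel w) (letterParity x * wordParity w)
        fun u => u.length ≤ k + 1 ∧ (u.length = k + 1 → ∀ y ∈ u, y = x ∨ y ∈ w) := by
  intro k
  induction k using Nat.strong_induction_on with
  -- Strong induction on the length: commutators and squares shorten the word, while the reordered
  -- term keeps its letters. The claim about the letters of the longest words is what allows a
  -- smaller letter to be put back in front.
  | _ k ih =>
  have sorted : ∀ w : List (ℕ × Bool), w.length = k → ∀ x, SortedWord (x :: w) →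
      letterU x • wordSmul w v ∈ wordSpan v (x.1 + wordLevel w) (letterParity x * wordParity w)
        fun u => u.length ≤ k + 1 ∧ (u.length = k + 1 → ∀ y ∈ u, y = x ∨ y ∈ w) := by
    intro w hk x hxw
    rw [← wordSmul_cons]
    exact wordSmul_mem_wordSpan hxw (wordLevel_cons _ _) (wordParity_cons _ _)
      ⟨by simp [hk], fun _ y hy => by simpa using hy⟩
  intro w hk hw x hx
  rcases w with _ | ⟨y, w⟩
  · exact sorted [] hk x (sortedWord_cons.2 ⟨hx, by simp, sortedWord_nil⟩)
  obtain ⟨hy, hyw, hw'⟩ := sortedWord_cons.1 hw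
  have hlen : w.length + 1 = k := by simpa using hk
  rcases precedes_trichotomy hx hy with hxy | hyx | ⟨rfl, hb⟩
  · refine sorted _ hk x (sortedWord_cons.2 ⟨hx, ?_, hw⟩)
    simp only [List.mem_cons, forall_eq_or_imp]
    exact ⟨hxy, fun z hz => hxy.trans (hyw z hz)⟩
  · have hne := precedes_irrefl_zero hyx hy hx
    obtain ⟨e, a, hswap⟩ := letter_swap (M := M) x y hne
    rw [wordSmul_cons, hswap]
    refine add_mem (Submodule.smul_mem _ _ ?_) (Submodule.smul_mem _ _ ?_)
    · refine smul_mem_of_wordSpan (letterU y) _ ?_ (ih w.length (by omega) w rfl hw' x hx)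
      rintro u hu hul hup ⟨hu1, hu2⟩
      have hl : x.1 + wordLevel (y :: w) = y.1 + wordLevel u := by
        rw [wordLevel_cons, hul]; omega
      have hp : letterParity x * wordParity (y :: w) = letterParity y * wordParity u := by
        rw [wordParity_cons, hup, mul_left_comm]
      rw [hl, hp]
      -- A word `u` of full length consists of letters of `x :: w`, all preceded by `y`, so `y :: u`
      -- is sorted. A shorter `u` falls under the induction hypothesis.
      rcases hu1.eq_or_lt with heq | hlt
      · have hsub := hu2 heq
        rw [← wordSmul_cons]
        refine wordSmul_mem_wordSpan (sortedWord_cons.2 ⟨hy, fun z hz => ?_, hu⟩)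
          (wordLevel_cons _ _) (wordParity_cons _ _) ⟨by simp [heq, hlen], fun _ z hz => ?_⟩
        · rcases hsub z hz with rfl | hz
          exacts [hyx, hyw z hz]
        · rcases List.mem_cons.1 hz with rfl | hz
          · simp
          · rcases hsub z hz with rfl | hz <;> simp [*]
      · refine wordSpan_mono ?_ (ih u.length (by omega) u rfl hu y hy)
        exact fun t ht => ⟨by omega, fun h => absurd h (by omega)⟩
    · have := ih w.length (by omega) w rfl hw' (x.1 + y.1, xor x.2 y.2)
        (fun _ => by simp only; omega)
      rw [letterParity_xor] at this
      rw [wordLevel_cons, wordParity_cons, ← add_assoc, ← mul_assoc]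
      refine wordSpan_mono ?_ this
      exact fun t ht => ⟨by omega, fun h => absurd h (by omega)⟩
  · obtain ⟨d, b⟩ := x
    obtain rfl : b = true := hb
    rw [wordSmul_cons, wordLevel_cons, wordParity_cons, ← add_assoc, ← mul_assoc]
    have hp : letterParity (d, true) * letterParity (d, true) = 1 := by simp [letterParity]
    rw [hp]
    rcases Nat.eq_zero_or_pos d with rfl | hd
    -- The letter `G_0` can only stand last, so its square acts directly on `v` and is a scalar
    -- there.
    · have hnil : w = [] := by
        rcases w with _ | ⟨z, w⟩
        · rfl
        · exact absurd (hyw z (by simp)) (not_precedes_zero ((sortedWord_cons.1 hw').1))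
      subst hnil
      have : letterU (0, true) = G 0 := by simp [letterU]
      rw [this, wordSmul_nil, hv.G_zero_G_zero]
      refine Submodule.smul_mem _ _ ?_
      nth_rewrite 2 [← wordSmul_nil v]
      exact wordSmul_mem_wordSpan sortedWord_nil (by simp [wordLevel]) (by simp [wordParity])
        ⟨by simp, fun h => absurd h (by simp)⟩
    · rw [letter_sq hd.ne']
      have := ih w.length (by omega) w rfl hw' (d + d, false) (fun _ => by simp only; omega)
      have hp' : letterParity (d + d, false) = 1 := by simp [letterParity]
      rw [hp'] at this
      refine wordSpan_mono ?_ this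
      exact fun t ht => ⟨by omega, fun h => absurd h (by omega)⟩

end Ramond

end

noncomputable section

namespace Ramond


/-! ### Normal forms exist -/

variable {M : Type*} [AddCommGroup M] [Module ℂ M] [Module U M]

/-- The vectors of level `l` and parity `p` generated from `v`. -/
def levelSpan (v : M) (l : ℕ) (p : ℤˣ) : Submodule ℂ M := wordSpan v l p fun _ => True

/-- The word of a standard monomial. -/
def Mono.word (X : Mono) : List (ℕ × Bool) :=
  X.ls.map (fun m => (m, false)) ++ X.gs.map (fun m => (m, true)) ++
    List.replicate X.n (1, false) ++ List.replicate (X.r₁ : ℕ) (1, true) ++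
    List.replicate (X.r₂ : ℕ) (0, true)

theorem Mono.prod_word (X : Mono) : (X.word.map letterU).prod = X.toU := by
  simp [Mono.word, Mono.toU_eq, letterU, Function.comp_def, mul_assoc]

theorem Mono.wordLevel_word (X : Mono) : wordLevel X.word = X.level := by
  simp [Mono.word, wordLevel, Mono.level, Function.comp_def, add_assoc]

theorem Mono.wordParity_word (X : Mono) : wordParity X.word = X.parity := by
  simp [Mono.word, wordParity, Mono.parity, letterParity, Function.comp_def, pow_add, mul_assoc]

theorem Mono.goodLetter_of_mem_word (X : Mono) : ∀ x ∈ X.word, GoodLetter x := by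
  intro x hx
  simp only [Mono.word, List.mem_append, List.mem_map, List.mem_replicate] at hx
  rcases hx with (((⟨m, hm, rfl⟩ | ⟨m, hm, rfl⟩) | ⟨_, rfl⟩) | ⟨_, rfl⟩) | ⟨_, rfl⟩ <;>
    simp [GoodLetter]
  have := X.ls_ge m hm
  omega

/-- Every sorted word is the word of a standard monomial. -/
theorem exists_mono_of_sortedWord (w : List (ℕ × Bool)) (hw : SortedWord w) :
    ∃ X : Mono, X.word = w := by
  induction w with
  | nil => exact ⟨lead 0 0 0, rfl⟩
  | cons x w ih =>
    obtain ⟨hx, hxw, hw'⟩ := sortedWord_cons.1 hw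
    obtain ⟨⟨ls, gs, n, r₁, r₂, h1, h2, h3, h4⟩, rfl⟩ := ih hw'
    simp only [Mono.word, List.mem_append, List.mem_map, List.mem_replicate] at hxw
    have A1 : ∀ m ∈ ls, Precedes x (m, false) := fun m hm => hxw _ (by simp [hm])
    have A2 : ∀ m ∈ gs, Precedes x (m, true) := fun m hm => hxw _ (by simp [hm])
    have A3 : n ≠ 0 → Precedes x (1, false) := fun hn => hxw _ (by simp [hn])
    have A4 : r₁ ≠ 0 → Precedes x (1, true) := fun hn => hxw _ (by simp; omega)
    have A5 : r₂ ≠ 0 → Precedes x (0, true) := fun hn => hxw _ (by simp; omega)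
    obtain ⟨d, b⟩ := x
    -- Nothing may precede a letter of a strictly smaller class, so the class of the new letter
    -- forces the earlier blocks to be empty; the letter then extends the block of its own class.
    have B1 : letterClass (d, b) ≠ 0 → ls = [] := fun h => by
      refine List.eq_nil_iff_forall_not_mem.2 fun m hm => ?_
      have := A1 m hm
      simp [Precedes, letterClass, h3 m hm] at this h
      omega
    have B2 : 2 ≤ letterClass (d, b) → gs = [] := fun h => by
      refine List.eq_nil_iff_forall_not_mem.2 fun m hm => ?_
      have := A2 m hm
      simp only [Precedes, show letterClass (m, true) = 1 by simp [letterClass, h4 m hm]] at this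
      omega
    have B3 : 3 ≤ letterClass (d, b) → n = 0 := fun h => by
      by_contra hn
      have := A3 hn
      simp only [Precedes, show letterClass (1, false) = 2 by simp [letterClass]] at this
      omega
    have B4 : 3 ≤ letterClass (d, b) → b = true → r₁ = 0 := fun h hb => by
      by_contra hn
      have := A4 hn
      simp only [Precedes, show letterClass (1, true) = 3 by simp [letterClass]] at this
      subst hb
      simp [letterClass] at this h
      split_ifs at * <;> omega
    have B5 : 4 ≤ letterClass (d, b) → r₂ = 0 := fun h => by
      by_contra hn
      have := A5 hn
      simp only [Precedes, show letterClass (0, true) = 4 by simp [letterClass]] at this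
      cases b <;> simp [letterClass] at this h <;> split_ifs at * <;> omega
    cases b with
    | false =>
      have hd : 1 ≤ d := hx rfl
      by_cases hd2 : 2 ≤ d
      · refine ⟨⟨d :: ls, gs, n, r₁, r₂, List.pairwise_cons.2 ⟨fun m hm => ?_, h1⟩, h2, ?_, h4⟩, ?_⟩
        · have := A1 m hm
          simp [Precedes, letterClass, h3 m hm, hd2] at this
          omega
        · simpa [hd2] using h3
        · simp [Mono.word]
      · obtain rfl : d = 1 := by omega
        obtain rfl := B1 (by simp [letterClass])
        obtain rfl := B2 (by simp [letterClass])
        exact ⟨⟨[], [], n + 1, r₁, r₂, h1, h2, h3, h4⟩, by simp [Mono.word, List.replicate_succ]⟩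
    | true =>
      by_cases hd2 : 2 ≤ d
      · obtain rfl := B1 (by simp [letterClass, hd2])
        refine ⟨⟨[], d :: gs, n, r₁, r₂, h1, List.pairwise_cons.2 ⟨fun m hm => ?_, h2⟩, h3, ?_⟩, ?_⟩
        · have := A2 m hm
          simp [Precedes, letterClass, h4 m hm, hd2] at this
          omega
        · simpa [hd2] using h4
        · simp [Mono.word]
      · have hc : 3 ≤ letterClass (d, true) := by simp [letterClass, hd2]; split_ifs <;> omega
        obtain rfl := B1 (by omega)
        obtain rfl := B2 (by omega)
        obtain rfl := B3 hc
        obtain rfl := B4 hc rfl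
        rcases Nat.eq_zero_or_pos d with rfl | hd
        · obtain rfl := B5 (by simp [letterClass])
          exact ⟨⟨[], [], 0, 0, 1, h1, h2, h3, h4⟩, by simp [Mono.word]⟩
        · obtain rfl : d = 1 := by omega
          exact ⟨⟨[], [], 0, 1, r₂, h1, h2, h3, h4⟩, by simp [Mono.word]⟩

theorem levelSpan_le (v : M) (l : ℕ) (p : ℤˣ) :
    levelSpan v l p ≤ Submodule.span ℂ ((fun X : Mono => X.toU • v) '' stdSet l p) := by
  refine Submodule.span_le.2 ?_
  rintro _ ⟨w, hw, rfl, rfl, -, rfl⟩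
  obtain ⟨X, rfl⟩ := exists_mono_of_sortedWord w hw
  exact Submodule.subset_span ⟨X, ⟨X.wordLevel_word.symm, X.wordParity_word.symm⟩,
    by simp only [wordSmul, X.prod_word]⟩

variable [IsScalarTower ℂ U M]

theorem exists_normalOp {v y : M} {S : Set Mono}
    (hy : y ∈ Submodule.span ℂ ((fun X : Mono => X.toU • v) '' S)) :
    ∃ θ : NormalOp, (θ.support : Set Mono) ⊆ S ∧ θ.toU • v = y := by
  obtain ⟨θ, hθ, rfl⟩ := (Finsupp.mem_span_image_iff_linearCombination ℂ).1 hy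
  exact ⟨θ, (Finsupp.mem_supported ℂ θ).1 hθ, by
    rw [NormalOp.toU_smul, Finsupp.linearCombination_apply]⟩

section IsHW

variable {c Δ ε : ℂ} {v : M} (hv : IsHW c Δ ε v)

theorem mem_levelSpan_self (v : M) : v ∈ levelSpan v 0 1 := by
  have h : wordSmul [] v ∈ levelSpan v 0 1 :=
    wordSmul_mem_wordSpan sortedWord_nil (by simp [wordLevel]) (by simp [wordParity]) trivial
  rwa [wordSmul_nil] at h

include hv

theorem letter_smul_mem_levelSpan {x : ℕ × Bool} (hx : GoodLetter x) {l : ℕ} {p : ℤˣ} {y : M}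
    (hy : y ∈ levelSpan v l p) : letterU x • y ∈ levelSpan v (x.1 + l) (letterParity x * p) := by
  refine smul_mem_of_wordSpan _ _ (fun w hw hl hp _ => ?_) hy
  subst hl hp
  exact wordSpan_mono (fun _ _ => trivial) (letter_smul_wordSmul hv _ w rfl hw x hx)

theorem word_smul_mem_levelSpan (w : List (ℕ × Bool)) (hw : ∀ x ∈ w, GoodLetter x) {l : ℕ} {p : ℤˣ}
    {y : M} (hy : y ∈ levelSpan v l p) :
    wordSmul w y ∈ levelSpan v (wordLevel w + l) (wordParity w * p) := by
  induction w with
  | nil => simpa [wordSmul, wordLevel, wordParity] using hy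
  | cons x w ih =>
    simp only [List.mem_cons, forall_eq_or_imp] at hw
    rw [wordSmul_cons, wordLevel_cons, wordParity_cons, add_assoc, mul_assoc]
    exact letter_smul_mem_levelSpan hv hw.1 (ih hw.2)

theorem toU_smul_mem_levelSpan {θ : NormalOp} {l l' : ℕ} {p p' : ℤˣ}
    (hθ : (θ.support : Set Mono) ⊆ stdSet l p) {y : M} (hy : y ∈ levelSpan v l' p') :
    θ.toU • y ∈ levelSpan v (l + l') (p * p') := by
  rw [NormalOp.toU_smul]
  refine Submodule.sum_mem _ fun X hX => Submodule.smul_mem _ _ ?_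
  obtain ⟨rfl, rfl⟩ := hθ hX
  have := word_smul_mem_levelSpan hv X.word X.goodLetter_of_mem_word hy
  rwa [wordSmul, X.prod_word, X.wordLevel_word, X.wordParity_word] at this

theorem exists_normalForm_mul {θ₁ θ₂ : NormalOp} {l₁ l₂ : ℕ} {p₁ p₂ : ℤˣ}
    (h₁ : (θ₁.support : Set Mono) ⊆ stdSet l₁ p₁) (h₂ : (θ₂.support : Set Mono) ⊆ stdSet l₂ p₂) :
    ∃ θ : NormalOp, (θ.support : Set Mono) ⊆ stdSet (l₁ + l₂) (p₁ * p₂) ∧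
      θ.toU • v = (θ₁.toU * θ₂.toU) • v := by
  refine exists_normalOp (levelSpan_le v _ _ ?_)
  rw [mul_smul]
  have h := toU_smul_mem_levelSpan hv h₂ (mem_levelSpan_self v)
  rw [add_zero, mul_one] at h
  exact toU_smul_mem_levelSpan hv h₁ h

/-- Monomials ending in `G_0` kill `v`, so they can be discarded from the normal form. -/
theorem exists_normalForm_mul_of_G_zero (h0 : G 0 • v = 0)
    {θ₁ θ₂ : NormalOp} {l₁ l₂ : ℕ} {p₁ p₂ : ℤˣ}
    (h₁ : (θ₁.support : Set Mono) ⊆ stdSet l₁ p₁) (h₂ : (θ₂.support : Set Mono) ⊆ stdSet l₂ p₂) :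
    ∃ θ : NormalOp, (θ.support : Set Mono) ⊆ stdSetG (l₁ + l₂) (p₁ * p₂) ∧
      θ.toU • v = (θ₁.toU * θ₂.toU) • v := by
  obtain ⟨θ, hθ, h⟩ := exists_normalForm_mul hv h₁ h₂
  refine exists_normalOp ?_
  rw [← h, NormalOp.toU_smul]
  refine Submodule.sum_mem _ fun X hX => Submodule.smul_mem _ _ ?_
  rcases fin_two_cases X.r₂ with hr | hr
  · exact Submodule.subset_span ⟨X, ⟨(hθ hX).1, (hθ hX).2, hr⟩, rfl⟩
  · have : X.toU • v = 0 := by simp [Mono.toU_eq, hr, mul_smul, h0]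
    rw [this]
    exact zero_mem _

end IsHW

/-! ### The submodule generated by a highest weight vector. -/

/-- The vectors generated from `v` by sorted words. -/
def totalSpan (v : M) : Submodule ℂ M :=
  Submodule.span ℂ {u | ∃ w, SortedWord w ∧ u = wordSmul w v}

theorem smul_mem_of_totalSpan {v : M} (u : U) (N : Submodule ℂ M)
    (h : ∀ w, SortedWord w → u • wordSmul w v ∈ N) {y : M} (hy : y ∈ totalSpan v) : u • y ∈ N := by
  have : totalSpan v ≤ N.comap (Algebra.lsmul ℂ ℂ M u) := by
    refine Submodule.span_le.2 ?_
    rintro _ ⟨w, h1, rfl⟩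
    exact h w h1
  exact this hy

theorem C_smul_letter (x : ℕ × Bool) (w : M) : C • letterU x • w = letterU x • C • w := by
  simp only [← mul_smul, letterU]
  split_ifs
  · rw [G_mul_C]
  · rw [L_mul_C]

theorem F_smul_letter (x : ℕ × Bool) (w : M) :
    F • letterU x • w = ((letterParity x : ℤ) : ℂ) • letterU x • F • w := by
  simp only [← mul_smul, letterU, letterParity]
  split_ifs
  · rw [F_mul_G]; simp
  · rw [F_mul_L]; simp

section IsHW

variable {c Δ ε : ℂ} {v : M} (hv : IsHW c Δ ε v)

include hv

theorem letter_smul_mem_totalSpan {x : ℕ × Bool} (hx : GoodLetter x) {y : M}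
    (hy : y ∈ totalSpan v) : letterU x • y ∈ totalSpan v := by
  refine smul_mem_of_totalSpan _ _ (fun w hw => ?_) hy
  have h := letter_smul_wordSmul hv _ w rfl hw x hx
  refine Submodule.span_mono ?_ h
  rintro _ ⟨w, h1, _, _, _, h5⟩
  exact ⟨w, h1, h5⟩

theorem C_smul_word (w : List (ℕ × Bool)) : C • wordSmul w v = c • wordSmul w v := by
  induction w with
  | nil => rw [wordSmul_nil, hv.central]
  | cons x w ih => rw [wordSmul_cons, C_smul_letter, ih, smul_comm]

theorem F_smul_word (w : List (ℕ × Bool)) :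
    F • wordSmul w v = (ε * ((wordParity w : ℤ) : ℂ)) • wordSmul w v := by
  induction w with
  | nil => simp [wordSmul_nil, hv.parity, wordParity]
  | cons x w ih =>
    rw [wordSmul_cons, F_smul_letter, ih, wordParity_cons, smul_comm (letterU x), smul_smul]
    push_cast
    ring_nf

/-- Negative modes and `G_0` are covered by straightening. A general mode is moved through the word
towards `v`: each commutator is again a mode or central, acting on a shorter word, so the induction
must treat all modes `L_m`, `G_m` at once. -/
theorem mode_smul_word_mem (w : List (ℕ × Bool)) (hw : SortedWord w) :
    ∀ m : ℤ, L m • wordSmul w v ∈ totalSpan v ∧ G m • wordSmul w v ∈ totalSpan v := by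
  have hself : v ∈ totalSpan v := Submodule.subset_span ⟨[], sortedWord_nil, (wordSmul_nil v).symm⟩
  have hG : ∀ m : ℤ, m ≤ 0 → ∀ y ∈ totalSpan v, G m • y ∈ totalSpan v := fun m hm y hy => by
    have := letter_smul_mem_totalSpan hv (x := (m.natAbs, true)) (by simp [GoodLetter]) hy
    simpa [letterU, abs_of_nonpos hm] using this
  have hL : ∀ m : ℤ, m < 0 → ∀ y ∈ totalSpan v, L m • y ∈ totalSpan v := fun m hm y hy => by
    have := letter_smul_mem_totalSpan hv (x := (m.natAbs, false)) (fun _ => by simp only; omega) hy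
    simpa [letterU, abs_of_neg hm] using this
  induction w with
  | nil =>
    intro m
    rw [wordSmul_nil]
    rcases lt_trichotomy m 0 with hm | rfl | hm
    · exact ⟨hL m hm v hself, hG m hm.le v hself⟩
    · refine ⟨?_, hG 0 le_rfl v hself⟩
      rw [hv.weight]
      exact Submodule.smul_mem _ _ hself
    · rw [hv.annL m hm, hv.annG m hm]
      exact ⟨zero_mem _, zero_mem _⟩
  | cons x w ih =>
    obtain ⟨hx, -, hw'⟩ := sortedWord_cons.1 hw
    have hwT : wordSmul w v ∈ totalSpan v := Submodule.subset_span ⟨w, hw', rfl⟩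
    have ih := ih hw'
    intro m
    obtain ⟨d, b⟩ := x
    have hx' := fun y hy => letter_smul_mem_totalSpan hv hx (y := y) hy
    rw [wordSmul_cons]
    cases b <;> simp only [letterU, Bool.false_eq_true, if_true, if_false] at hx' ⊢
    · rw [L_L_smul, G_L_smul, C_smul_word hv]
      exact ⟨add_mem (hx' _ (ih m).1) (add_mem (Submodule.smul_mem _ _ (ih _).1)
        (Submodule.smul_mem _ _ (Submodule.smul_mem _ _ hwT))),
        sub_mem (hx' _ (ih m).2) (Submodule.smul_mem _ _ (ih _).2)⟩
    · rw [L_G_smul, G_G_smul, C_smul_word hv]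
      exact ⟨add_mem (hx' _ (ih m).1) (Submodule.smul_mem _ _ (ih _).2),
        add_mem (neg_mem (hx' _ (ih m).2)) (add_mem (Submodule.smul_mem _ _ (ih _).1)
        (Submodule.smul_mem _ _ (Submodule.smul_mem _ _ hwT)))⟩

/-- The sorted words span the submodule generated by a highest weight vector. -/
theorem smul_mem_totalSpan (u : U) {y : M} (hy : y ∈ totalSpan v) : u • y ∈ totalSpan v := by
  obtain ⟨a, rfl⟩ := RingQuot.mkAlgHom_surjective ℂ Rel u
  induction a using FreeAlgebra.induction generalizing y with
  | grade0 r =>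
    rw [AlgHom.commutes, U_algebraMap_smul]
    exact Submodule.smul_mem _ _ hy
  | grade1 x =>
    refine smul_mem_of_totalSpan _ _ (fun w hw => ?_) hy
    have hwT : wordSmul w v ∈ totalSpan v := Submodule.subset_span ⟨w, hw, rfl⟩
    cases x with
    | L m => exact (mode_smul_word_mem hv w hw m).1
    | G m => exact (mode_smul_word_mem hv w hw m).2
    | C =>
      have := C_smul_word hv w
      exact this ▸ Submodule.smul_mem _ _ hwT
    | F =>
      have := F_smul_word hv w
      exact this ▸ Submodule.smul_mem _ _ hwT
  | mul a b iha ihb => rw [map_mul, mul_smul]; exact iha (ihb hy)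
  | add a b iha ihb => rw [map_add, add_smul]; exact add_mem (iha hy) (ihb hy)

/-- Used for `G_0|c/24⟩`, to check that a functional vanishes on the submodule which it generates.
-/
theorem smul_mem_span_mono (u : U) :
    u • v ∈ Submodule.span ℂ (Set.range fun X : Mono => X.toU • v) := by
  have h := smul_mem_totalSpan hv u
    (Submodule.subset_span ⟨[], sortedWord_nil, (wordSmul_nil v).symm⟩)
  refine Submodule.span_mono ?_ h
  rintro _ ⟨w, hw, rfl⟩
  obtain ⟨X, rfl⟩ := exists_mono_of_sortedWord w hw
  exact ⟨X, by simp only [wordSmul, X.prod_word]⟩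

end IsHW

end Ramond

end

noncomputable section

namespace Ramond


/-! ### A Fock space with bosonic and fermionic oscillators -/

/-- Bosonic oscillators. -/
abbrev BoseFock : Type := MvPolynomial (Bool × ℤ) ℂ

/-- Fermionic oscillators. -/
abbrev FermiFock : Type := ExteriorAlgebra ℂ ((Bool × ℤ) →₀ ℂ)

/-- The Fock space of two families of bosonic and two families of fermionic oscillators. -/
abbrev Fock : Type := TensorProduct ℂ BoseFock FermiFock

namespace Fock

/-- The generators of the exterior algebra. -/
def θ (i : Bool × ℤ) : FermiFock := ExteriorAlgebra.ι ℂ (Finsupp.single i 1)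

/-- The derivatives of the exterior algebra. -/
def dθ (i : Bool × ℤ) : Module.End ℂ FermiFock := CliffordAlgebra.contractLeft (Finsupp.lapply i)

/-- Bosonic creation. -/
def x (i : Bool × ℤ) : Module.End ℂ Fock :=
  LinearMap.rTensor FermiFock (LinearMap.mulLeft ℂ (MvPolynomial.X i : BoseFock))

/-- Bosonic annihilation. -/
def d (i : Bool × ℤ) : Module.End ℂ Fock :=
  LinearMap.rTensor FermiFock (MvPolynomial.pderiv i : Derivation ℂ BoseFock BoseFock).toLinearMap

/-- Fermionic creation. -/
def y (i : Bool × ℤ) : Module.End ℂ Fock :=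
  LinearMap.lTensor BoseFock (LinearMap.mulLeft ℂ (θ i))

/-- Fermionic annihilation. -/
def g (i : Bool × ℤ) : Module.End ℂ Fock := LinearMap.lTensor BoseFock (dθ i)

/-- Fermion parity. -/
def parity : Module.End ℂ Fock :=
  LinearMap.lTensor BoseFock (CliffordAlgebra.involute (Q := 0)).toLinearMap

/-- The vacuum. -/
def vac : Fock := 1 ⊗ₜ 1

open TensorProduct

theorem x_mul_x (i j : Bool × ℤ) : x i * x j = x j * x i := by
  rw [x, x, ← LinearMap.rTensor_mul, ← LinearMap.rTensor_mul]
  congr 1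
  refine LinearMap.ext fun p => ?_
  simp [mul_left_comm]

theorem d_mul_d (i j : Bool × ℤ) : d i * d j = d j * d i := by
  rw [d, d, ← LinearMap.rTensor_mul, ← LinearMap.rTensor_mul]
  refine congrArg (LinearMap.rTensor FermiFock) ?_
  refine LinearMap.ext fun p => ?_
  -- The commutator of two derivations is a derivation, so it suffices that it vanishes on the
  -- variables.
  have h : ⁅(MvPolynomial.pderiv i : Derivation ℂ BoseFock BoseFock),
      (MvPolynomial.pderiv j : Derivation ℂ BoseFock BoseFock)⁆ = 0 := by
    refine MvPolynomial.derivation_ext fun k => ?_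
    simp only [Derivation.commutator_apply, MvPolynomial.pderiv_X, Pi.single_apply, Derivation.coe_zero,
      Pi.zero_apply]
    split_ifs <;> simp
  have h' := DFunLike.congr_fun h p
  rw [Derivation.commutator_apply, Derivation.coe_zero, Pi.zero_apply, sub_eq_zero] at h'
  exact h'

theorem d_mul_x (i j : Bool × ℤ) : d i * x j = x j * d i + if i = j then 1 else 0 := by
  have h1 : (1 : Module.End ℂ Fock) = LinearMap.rTensor FermiFock (1 : Module.End ℂ BoseFock) :=
    (LinearMap.rTensor_id _ _).symm
  have h0 : (0 : Module.End ℂ Fock) = LinearMap.rTensor FermiFock (0 : Module.End ℂ BoseFock) :=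
    (LinearMap.rTensor_zero _).symm
  rw [d, x, ← LinearMap.rTensor_mul, ← LinearMap.rTensor_mul, h1, h0, ← apply_ite, ← LinearMap.rTensor_add]
  congr 1
  refine LinearMap.ext fun p => ?_
  by_cases h : i = j
  · subst h
    simp [Derivation.leibniz]
    try ring
  · simp [Derivation.leibniz, h, MvPolynomial.pderiv_X, Ne.symm h]

theorem y_mul_y (i j : Bool × ℤ) : y i * y j = -(y j * y i) := by
  rw [y, y, ← LinearMap.lTensor_mul, ← LinearMap.lTensor_mul, ← LinearMap.lTensor_neg]
  congr 1
  refine LinearMap.ext fun p => ?_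
  have := ExteriorAlgebra.ι_add_mul_swap (R := ℂ) (Finsupp.single i (1 : ℂ)) (Finsupp.single j (1 : ℂ))
  rw [add_eq_zero_iff_eq_neg] at this
  simp only [Module.End.mul_apply, LinearMap.mulLeft_apply, LinearMap.neg_apply, θ, ← mul_assoc, this,
    neg_mul]

theorem g_mul_g (i j : Bool × ℤ) : g i * g j = -(g j * g i) := by
  rw [g, g, ← LinearMap.lTensor_mul, ← LinearMap.lTensor_mul, ← LinearMap.lTensor_neg]
  congr 1
  refine LinearMap.ext fun p => ?_
  exact CliffordAlgebra.contractLeft_comm _ _ p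

theorem g_mul_y (i j : Bool × ℤ) : g i * y j = -(y j * g i) + if i = j then 1 else 0 := by
  have h1 : (1 : Module.End ℂ Fock) = LinearMap.lTensor BoseFock (1 : Module.End ℂ FermiFock) :=
    (LinearMap.lTensor_id _ _).symm
  have h0 : (0 : Module.End ℂ Fock) = LinearMap.lTensor BoseFock (0 : Module.End ℂ FermiFock) :=
    (LinearMap.lTensor_zero _).symm
  rw [g, y, ← LinearMap.lTensor_mul, ← LinearMap.lTensor_mul, h1, h0, ← LinearMap.lTensor_neg,
    ← apply_ite, ← LinearMap.lTensor_add]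
  congr 1
  refine LinearMap.ext fun p => ?_
  have := CliffordAlgebra.contractLeft_ι_mul (Q := (0 : QuadraticForm ℂ ((Bool × ℤ) →₀ ℂ)))
    (Finsupp.lapply i) (Finsupp.single j 1) p
  refine this.trans ?_
  rw [neg_add_eq_sub]
  congr 1
  by_cases h : i = j
  · simp [h]
  · simp [h]

theorem rTensor_mul_lTensor (S : Module.End ℂ BoseFock) (T : Module.End ℂ FermiFock) :
    (LinearMap.rTensor FermiFock S * LinearMap.lTensor BoseFock T : Module.End ℂ Fock)
      = LinearMap.lTensor BoseFock T * LinearMap.rTensor FermiFock S :=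
  (LinearMap.rTensor_comp_lTensor _ _ _).trans (LinearMap.lTensor_comp_rTensor _ _ _).symm

theorem x_mul_y (i j : Bool × ℤ) : x i * y j = y j * x i := rTensor_mul_lTensor _ _
theorem x_mul_g (i j : Bool × ℤ) : x i * g j = g j * x i := rTensor_mul_lTensor _ _
theorem d_mul_y (i j : Bool × ℤ) : d i * y j = y j * d i := rTensor_mul_lTensor _ _
theorem d_mul_g (i j : Bool × ℤ) : d i * g j = g j * d i := rTensor_mul_lTensor _ _

theorem parity_mul_x (i : Bool × ℤ) : parity * x i = x i * parity := (rTensor_mul_lTensor _ _).symm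
theorem parity_mul_d (i : Bool × ℤ) : parity * d i = d i * parity := (rTensor_mul_lTensor _ _).symm

theorem parity_mul_y (i : Bool × ℤ) : parity * y i = -(y i * parity) := by
  rw [parity, y, ← LinearMap.lTensor_mul, ← LinearMap.lTensor_mul, ← LinearMap.lTensor_neg]
  congr 1
  refine LinearMap.ext fun p => ?_
  have := CliffordAlgebra.involute_ι (Q := (0 : QuadraticForm ℂ ((Bool × ℤ) →₀ ℂ)))
    (Finsupp.single i (1 : ℂ))
  simp only [Module.End.mul_apply, AlgHom.toLinearMap_apply, LinearMap.mulLeft_apply, map_mul,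
    LinearMap.neg_apply]
  rw [θ, ExteriorAlgebra.ι, this, neg_mul]

theorem parity_mul_g (i : Bool × ℤ) : parity * g i = -(g i * parity) := by
  rw [parity, g, ← LinearMap.lTensor_mul, ← LinearMap.lTensor_mul, ← LinearMap.lTensor_neg]
  congr 1
  refine LinearMap.ext fun p => ?_
  simp only [Module.End.mul_apply, AlgHom.toLinearMap_apply, LinearMap.neg_apply, dθ]
  induction p using CliffordAlgebra.left_induction with
  | algebraMap r => simp [CliffordAlgebra.contractLeft_algebraMap]
  | add p q hp hq => simp only [map_add, hp, hq, neg_add]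
  | ι_mul p m hp =>
    simp only [map_mul, CliffordAlgebra.contractLeft_ι_mul, CliffordAlgebra.involute_ι, map_sub,
      map_smul, hp, neg_mul, map_neg, mul_neg]
    abel

theorem d_vac (i : Bool × ℤ) : d i vac = 0 := by
  simp [d, vac]

theorem g_vac (i : Bool × ℤ) : g i vac = 0 := by
  simp [g, vac, dθ, CliffordAlgebra.contractLeft_one]

theorem parity_vac : parity vac = vac := by
  simp [parity, vac]

/-- The vacuum is cyclic for the creation operators. -/
theorem induction {N : Submodule ℂ Fock} (hv : vac ∈ N) (hx : ∀ i, ∀ w ∈ N, x i w ∈ N)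
    (hy : ∀ i, ∀ w ∈ N, y i w ∈ N) (w : Fock) : w ∈ N := by
  have h1 : ∀ q : FermiFock, (1 : BoseFock) ⊗ₜ[ℂ] q ∈ N := by
    intro q
    induction q using CliffordAlgebra.left_induction with
    | algebraMap r =>
      rw [Algebra.algebraMap_eq_smul_one, TensorProduct.tmul_smul]
      exact N.smul_mem _ hv
    | add p q hp hq => rw [TensorProduct.tmul_add]; exact N.add_mem hp hq
    | ι_mul p m hp =>
      induction m using Finsupp.induction_linear with
      | zero => simp
      | add a b ha hb => rw [map_add, add_mul, TensorProduct.tmul_add]; exact N.add_mem ha hb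
      | single i r =>
        have : Finsupp.single i r = r • Finsupp.single i (1 : ℂ) := by simp
        rw [this, map_smul, smul_mul_assoc, TensorProduct.tmul_smul]
        exact N.smul_mem _ (hy i _ hp)
  induction w using TensorProduct.induction_on with
  | zero => exact N.zero_mem
  | add a b ha hb => exact N.add_mem ha hb
  | tmul p q =>
    induction p using MvPolynomial.induction_on with
    | C r =>
      rw [MvPolynomial.C_eq_smul_one, ← TensorProduct.smul_tmul']
      exact N.smul_mem _ (h1 q)
    | add a b ha hb => rw [TensorProduct.add_tmul]; exact N.add_mem ha hb
    | mul_X p i hp =>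
      rw [mul_comm]
      exact hx i _ hp

/-- The functional which evaluates the bosons at `pt` and the fermions at zero. -/
def coherent (pt : Bool × ℤ → ℂ) : Fock →ₗ[ℂ] ℂ :=
  LinearMap.mul' ℂ ℂ ∘ₗ TensorProduct.map (MvPolynomial.aeval pt).toLinearMap
    (ExteriorAlgebra.algebraMapInv (R := ℂ) (M := (Bool × ℤ) →₀ ℂ)).toLinearMap

theorem coherent_vac (pt : Bool × ℤ → ℂ) : coherent pt vac = 1 := by
  simp [coherent, vac]

theorem coherent_x (pt : Bool × ℤ → ℂ) (i : Bool × ℤ) (w : Fock) :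
    coherent pt (x i w) = pt i * coherent pt w := by
  induction w using TensorProduct.induction_on with
  | zero => simp
  | add a b ha hb => simp only [map_add, ha, hb, mul_add]
  | tmul p q => simp [coherent, x, mul_assoc]

theorem coherent_y (pt : Bool × ℤ → ℂ) (i : Bool × ℤ) (w : Fock) : coherent pt (y i w) = 0 := by
  induction w using TensorProduct.induction_on with
  | zero => simp
  | add a b ha hb => simp only [map_add, ha, hb, add_zero]
  | tmul p q => simp [coherent, y, θ, ExteriorAlgebra.algebraMapInv]

end Fock

/-! ### Abstract oscillators: the relations used from here on. -/

/-- Bosonic creation and annihilation operators `x`, `d` and fermionic ones `y`, `g`, with a cyclic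
vacuum, the fermion parity and coherent functionals. -/
structure Oscillators (V : Type*) [AddCommGroup V] [Module ℂ V] where
  x : Bool × ℤ → Module.End ℂ V
  d : Bool × ℤ → Module.End ℂ V
  y : Bool × ℤ → Module.End ℂ V
  g : Bool × ℤ → Module.End ℂ V
  parity : Module.End ℂ V
  vac : V
  coherent : (Bool × ℤ → ℂ) → V →ₗ[ℂ] ℂ
  x_mul_x : ∀ i j, x i * x j = x j * x i
  d_mul_d : ∀ i j, d i * d j = d j * d i
  d_mul_x : ∀ i j, d i * x j = x j * d i + if i = j then 1 else 0
  y_mul_y : ∀ i j, y i * y j = -(y j * y i)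
  g_mul_g : ∀ i j, g i * g j = -(g j * g i)
  g_mul_y : ∀ i j, g i * y j = -(y j * g i) + if i = j then 1 else 0
  x_mul_y : ∀ i j, x i * y j = y j * x i
  x_mul_g : ∀ i j, x i * g j = g j * x i
  d_mul_y : ∀ i j, d i * y j = y j * d i
  d_mul_g : ∀ i j, d i * g j = g j * d i
  parity_mul_x : ∀ i, parity * x i = x i * parity
  parity_mul_d : ∀ i, parity * d i = d i * parity
  parity_mul_y : ∀ i, parity * y i = -(y i * parity)
  parity_mul_g : ∀ i, parity * g i = -(g i * parity)
  d_vac : ∀ i, d i vac = 0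
  g_vac : ∀ i, g i vac = 0
  parity_vac : parity vac = vac
  induction : ∀ {N : Submodule ℂ V}, vac ∈ N → (∀ i, ∀ w ∈ N, x i w ∈ N) →
    (∀ i, ∀ w ∈ N, y i w ∈ N) → ∀ w, w ∈ N
  coherent_vac : ∀ pt, coherent pt vac = 1
  coherent_x : ∀ pt i w, coherent pt (x i w) = pt i * coherent pt w
  coherent_y : ∀ pt i w, coherent pt (y i w) = 0

/-- The Fock space is a realisation of the oscillators. -/
def Fock.oscillators : Oscillators Fock :=
  { x := x, d := d, y := y, g := g, parity := parity, vac := vac, coherent := coherent,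
    x_mul_x := x_mul_x, d_mul_d := d_mul_d, d_mul_x := d_mul_x, y_mul_y := y_mul_y,
    g_mul_g := g_mul_g, g_mul_y := g_mul_y, x_mul_y := x_mul_y, x_mul_g := x_mul_g,
    d_mul_y := d_mul_y, d_mul_g := d_mul_g, parity_mul_x := parity_mul_x,
    parity_mul_d := parity_mul_d, parity_mul_y := parity_mul_y, parity_mul_g := parity_mul_g,
    d_vac := d_vac, g_vac := g_vac, parity_vac := parity_vac, induction := induction,
    coherent_vac := coherent_vac, coherent_x := coherent_x, coherent_y := coherent_y }

end Ramond

end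

noncomputable section

namespace Ramond


/-! ### Locally finite sums of operators -/

section sumEnd

variable {I V : Type*} [AddCommGroup V] [Module ℂ V]

/-- The sum of a locally finite family of operators. -/
def sumEnd (A : I → Module.End ℂ V) (hA : ∀ w, Function.HasFiniteSupport fun i => A i w) :
    Module.End ℂ V where
  toFun w := ∑ᶠ i, A i w
  map_add' w w' := by
    simp only [map_add]
    exact finsum_add_distrib (hA w) (hA w')
  map_smul' a w := by
    simp only [map_smul, RingHom.id_apply]
    exact (smul_finsum' a (hA w)).symm

variable {A : I → Module.End ℂ V} {hA : ∀ w, Function.HasFiniteSupport fun i => A i w}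

theorem sumEnd_apply (w : V) : sumEnd A hA w = ∑ᶠ i, A i w := rfl

/-- A bilinear current meets a single mode `T` in one contraction only: every summand commutes with
`T` up to the sign `ε`, except one, which contributes `R`. -/
theorem sumEnd_mul {T R : Module.End ℂ V} (ε : ℂ) (i₀ : I)
    (h₀ : A i₀ * T = ε • (T * A i₀) + R) (h : ∀ i, i ≠ i₀ → A i * T = ε • (T * A i)) :
    sumEnd A hA * T = ε • (T * sumEnd A hA) + R := by
  classical
  ext w
  have h' : ∀ i, A i (T w) = ε • T (A i w) + if i = i₀ then R w else 0 := by
    intro i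
    split_ifs with hi
    · subst hi
      exact LinearMap.congr_fun h₀ w
    · rw [add_zero]
      exact LinearMap.congr_fun (h i hi) w
  have hf : Function.HasFiniteSupport fun i => ε • T (A i w) :=
    (hA w).subset fun i hi => by
      simp only [Function.mem_support, ne_eq] at hi ⊢
      exact fun h0 => hi (by rw [h0, map_zero, smul_zero])
  have hf' : Function.HasFiniteSupport fun i => T (A i w) :=
    (hA w).subset fun i hi => by
      simp only [Function.mem_support, ne_eq] at hi ⊢
      exact fun h0 => hi (by rw [h0, map_zero])
  simp only [Module.End.mul_apply, LinearMap.add_apply, LinearMap.smul_apply, sumEnd_apply, h']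
  rw [finsum_add_distrib hf, ← smul_finsum' ε hf', ← map_finsum T (hA w)]
  · congr 1
    rw [finsum_eq_single _ i₀ (fun i hi => if_neg hi), if_pos rfl]
  · refine (Set.finite_singleton i₀).subset fun i hi => ?_
    by_contra hne
    exact hi (if_neg hne)

end sumEnd

/-! ### The number operator and the uniqueness of the vacuum. -/

namespace Oscillators

variable {V : Type*} [AddCommGroup V] [Module ℂ V] (O : Oscillators V)

/-- All oscillators: `inl` for bosons, `inr` for fermions. -/
abbrev Osc : Type := (Bool × ℤ) ⊕ (Bool × ℤ)

/-- Each vector is annihilated by almost all annihilation operators. -/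
theorem finite_d_g (w : V) : {i | O.d i w ≠ 0}.Finite ∧ {i | O.g i w ≠ 0}.Finite := by
  let N : Submodule ℂ V :=
    { carrier := {w | {i | O.d i w ≠ 0}.Finite ∧ {i | O.g i w ≠ 0}.Finite}
      zero_mem' := by simp
      add_mem' := fun {a b} ha hb => by
        refine ⟨(ha.1.union hb.1).subset fun i hi => ?_, (ha.2.union hb.2).subset fun i hi => ?_⟩ <;>
        · simp only [Set.mem_union, Set.mem_ofPred_eq, map_add] at hi ⊢
          by_contra! hc
          exact hi (by rw [hc.1, hc.2, add_zero])
      smul_mem' := fun c a ha => by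
        refine ⟨ha.1.subset fun i hi => ?_, ha.2.subset fun i hi => ?_⟩ <;>
        · simp only [Set.mem_ofPred_eq, map_smul] at hi ⊢
          exact fun h0 => hi (by rw [h0, smul_zero]) }
  refine O.induction (N := N) ?_ ?_ ?_ w
  · constructor <;> simp [O.d_vac, O.g_vac]
  · rintro j w ⟨h1, h2⟩
    refine ⟨(h1.union (Set.finite_singleton j)).subset fun i hi => ?_, h2.subset fun i hi => ?_⟩
    · by_contra hc
      simp only [Set.mem_union, Set.mem_ofPred_eq, Set.mem_singleton_iff, not_or, not_not] at hc
      apply hi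
      rw [← Module.End.mul_apply, O.d_mul_x, if_neg hc.2, add_zero, Module.End.mul_apply, hc.1, map_zero]
    · intro h0
      apply hi
      rw [← Module.End.mul_apply, ← O.x_mul_g, Module.End.mul_apply, h0, map_zero]
  · rintro j w ⟨h1, h2⟩
    refine ⟨h1.subset fun i hi => ?_, (h2.union (Set.finite_singleton j)).subset fun i hi => ?_⟩
    · intro h0
      apply hi
      rw [← Module.End.mul_apply, O.d_mul_y, Module.End.mul_apply, h0, map_zero]
    · by_contra hc
      simp only [Set.mem_union, Set.mem_ofPred_eq, Set.mem_singleton_iff, not_or, not_not] at hc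
      apply hi
      rw [← Module.End.mul_apply, O.g_mul_y, if_neg hc.2, add_zero, LinearMap.neg_apply,
        Module.End.mul_apply, hc.1, map_zero, neg_zero]

/-- The summands of the number operator. -/
def numberTerm : Osc → Module.End ℂ V
  | .inl i => O.x i * O.d i
  | .inr i => O.y i * O.g i

theorem finite_numberTerm (w : V) : Function.HasFiniteSupport fun i => O.numberTerm i w := by
  refine (((O.finite_d_g w).1.image Sum.inl).union ((O.finite_d_g w).2.image Sum.inr)).subset ?_
  rintro (i | i) hi
  · refine .inl ⟨i, fun h0 => hi ?_, rfl⟩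
    simp only [numberTerm, Module.End.mul_apply, h0, map_zero]
  · refine .inr ⟨i, fun h0 => hi ?_, rfl⟩
    simp only [numberTerm, Module.End.mul_apply, h0, map_zero]

/-- The number operator. -/
def number : Module.End ℂ V := sumEnd O.numberTerm O.finite_numberTerm

theorem number_mul_x (j : Bool × ℤ) : O.number * O.x j = O.x j * O.number + O.x j := by
  rw [← one_smul ℂ (O.x j * O.number)]
  refine sumEnd_mul 1 (Sum.inl j) ?_ ?_
  · rw [numberTerm, mul_assoc, O.d_mul_x, if_pos rfl, mul_add, mul_one, ← mul_assoc, one_smul, mul_assoc]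
  · rintro (i | i) hi
    · rw [numberTerm, mul_assoc, O.d_mul_x, if_neg (by rintro rfl; exact hi rfl), add_zero, ← mul_assoc,
        O.x_mul_x, mul_assoc, one_smul]
    · rw [numberTerm, mul_assoc, ← O.x_mul_g, ← mul_assoc, ← O.x_mul_y, mul_assoc, one_smul]

theorem number_mul_y (j : Bool × ℤ) : O.number * O.y j = O.y j * O.number + O.y j := by
  rw [← one_smul ℂ (O.y j * O.number)]
  refine sumEnd_mul 1 (Sum.inr j) ?_ ?_
  · have h : O.y j * (O.y j * O.g j) = -(O.y j * (O.y j * O.g j)) := by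
      conv_lhs => rw [← mul_assoc, O.y_mul_y, neg_mul, mul_assoc]
    rw [numberTerm, one_smul, mul_assoc, O.g_mul_y, if_pos rfl, mul_add, mul_one, mul_neg, ← h]
  · rintro (i | i) hi
    · rw [numberTerm, mul_assoc, O.d_mul_y, ← mul_assoc, O.x_mul_y, mul_assoc, one_smul]
    · rw [numberTerm, mul_assoc, O.g_mul_y, if_neg (by rintro rfl; exact hi rfl), add_zero, mul_neg,
        ← mul_assoc, O.y_mul_y, neg_mul, neg_neg, mul_assoc, one_smul]

/-- A vector killed by all annihilation operators is a multiple of the vacuum. -/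
theorem eq_smul_vac {w : V} (hd : ∀ i, O.d i w = 0) (hg : ∀ i, O.g i w = 0) :
    ∃ a : ℂ, w = a • O.vac := by
  have h0 : O.number w = 0 := by
    rw [number, sumEnd_apply]
    refine (finsum_congr fun i => ?_).trans finsum_zero
    rcases i with i | i <;> simp only [numberTerm, Module.End.mul_apply, hd, hg, map_zero]
  have hvac : O.number O.vac = 0 := by
    rw [number, sumEnd_apply]
    refine (finsum_congr fun i => ?_).trans finsum_zero
    rcases i with i | i <;> simp only [numberTerm, Module.End.mul_apply, O.d_vac, O.g_vac, map_zero]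
  -- The vacuum together with the positive eigenspaces of the number operator is stable under
  -- creation, hence is everything. A vector of number zero then has no component in `P`, as
  -- eigenspaces are independent.
  let P : Submodule ℂ V := ⨆ n : ℕ, Module.End.eigenspace O.number ((n : ℂ) + 1)
  have step : ∀ T : Module.End ℂ V, O.number * T = T * O.number + T →
      ∀ w ∈ Submodule.span ℂ {O.vac} ⊔ P, T w ∈ Submodule.span ℂ {O.vac} ⊔ P := by
    intro T hT w hw
    have hT' : ∀ (u : V) (b : ℂ), O.number u = b • u → O.number (T u) = (b + 1) • T u := by
      intro u b hu
      have := LinearMap.congr_fun hT u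
      simp only [Module.End.mul_apply, LinearMap.add_apply, hu, map_smul] at this
      rw [this, add_smul, one_smul]
    refine Submodule.mem_sup_right ?_
    have : Submodule.span ℂ {O.vac} ⊔ P ≤ P.comap T := by
      refine sup_le (Submodule.span_le.2 ?_) (iSup_le fun n u hu => ?_)
      · rintro _ rfl
        refine Submodule.mem_iSup_of_mem 0 (Module.End.mem_eigenspace_iff.2 ?_)
        simpa using hT' O.vac 0 (by simpa using hvac)
      · refine Submodule.mem_iSup_of_mem (n + 1) (Module.End.mem_eigenspace_iff.2 ?_)
        simpa using hT' u _ (Module.End.mem_eigenspace_iff.1 hu)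
    exact this hw
  have hw : w ∈ Submodule.span ℂ {O.vac} ⊔ P :=
    O.induction (Submodule.mem_sup_left (Submodule.mem_span_singleton_self _))
      (fun i => step _ (O.number_mul_x i)) (fun i => step _ (O.number_mul_y i)) w
  obtain ⟨u, hu, p, hp, rfl⟩ := Submodule.mem_sup.1 hw
  obtain ⟨a, rfl⟩ := Submodule.mem_span_singleton.1 hu
  refine ⟨a, ?_⟩
  rw [map_add, map_smul, hvac, smul_zero, zero_add] at h0
  have hle : P ≤ ⨆ (b : ℂ) (_ : b ≠ 0), Module.End.eigenspace O.number b :=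
    iSup_le fun n => le_iSup₂_of_le ((n : ℂ) + 1) (by exact_mod_cast Nat.succ_ne_zero n) le_rfl
  have := (Module.End.eigenspaces_iSupIndep O.number 0).le_bot
    ⟨Module.End.mem_eigenspace_iff.2 (by simpa using h0), hle hp⟩
  rw [(Submodule.mem_bot ℂ).1 this, add_zero]

end Oscillators

end Ramond

end

noncomputable section

namespace Ramond


/-! ### The Ramond algebra acting on the Fock space -/

namespace Oscillators

variable {V : Type*} [AddCommGroup V] [Module ℂ V] (O : Oscillators V)

/-- The bosonic modes. -/
def e (i : Bool × ℤ) : Module.End ℂ V := if 0 ≤ i.2 then O.x i else O.d i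

/-- The conjugate bosonic modes. -/
def ed (i : Bool × ℤ) : Module.End ℂ V := if 0 ≤ i.2 then -O.d i else O.x i

/-- The fermionic modes. -/
def f (i : Bool × ℤ) : Module.End ℂ V := if 1 ≤ i.2 then O.y i else O.g i

/-- The conjugate fermionic modes. -/
def fd (i : Bool × ℤ) : Module.End ℂ V := if 1 ≤ i.2 then O.g i else O.y i

theorem y_mul_g (i j : Bool × ℤ) : O.y i * O.g j = -(O.g j * O.y i) + if j = i then 1 else 0 := by
  rw [O.g_mul_y, neg_add, neg_neg, neg_add_cancel_right]

theorem e_mul_e (i j : Bool × ℤ) : O.e i * O.e j = O.e j * O.e i := by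
  simp only [e]
  split_ifs with h1 h2 h2
  · exact O.x_mul_x i j
  · rw [O.d_mul_x, if_neg (by rintro rfl; exact h2 h1), add_zero]
  · rw [O.d_mul_x, if_neg (by rintro rfl; exact h1 h2), add_zero]
  · exact O.d_mul_d i j

theorem ed_mul_ed (i j : Bool × ℤ) : O.ed i * O.ed j = O.ed j * O.ed i := by
  simp only [ed]
  split_ifs with h1 h2 h2
  · rw [neg_mul_neg, neg_mul_neg, O.d_mul_d i j]
  · rw [neg_mul, mul_neg, O.d_mul_x, if_neg (by rintro rfl; exact h2 h1), add_zero]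
  · rw [neg_mul, mul_neg, O.d_mul_x, if_neg (by rintro rfl; exact h1 h2), add_zero]
  · exact O.x_mul_x i j

/-- The sign in `ed` makes the pairs `(x, -d)` and `(d, x)` satisfy one and the same commutation
relation, so the vacuum can be chosen differently for negative and nonnegative modes. -/
theorem e_mul_ed (i j : Bool × ℤ) : O.e i * O.ed j = O.ed j * O.e i + if i = j then 1 else 0 := by
  simp only [e, ed]
  by_cases hij : i = j
  · subst hij
    rw [if_pos (rfl : i = i)]
    split_ifs with h1
    · rw [mul_neg, neg_mul, O.d_mul_x, if_pos rfl, neg_add, neg_add_cancel_right]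
    · rw [O.d_mul_x, if_pos rfl]
  · rw [if_neg hij, add_zero]
    split_ifs with h1 h2 h2
    · rw [mul_neg, neg_mul, O.d_mul_x, if_neg (Ne.symm hij), add_zero]
    · exact O.x_mul_x i j
    · rw [mul_neg, neg_mul, O.d_mul_d]
    · rw [O.d_mul_x, if_neg hij, add_zero]

theorem f_mul_f (i j : Bool × ℤ) : O.f i * O.f j = -(O.f j * O.f i) := by
  simp only [f]
  split_ifs with h1 h2 h2
  · exact O.y_mul_y i j
  · rw [O.g_mul_y, if_neg (by rintro rfl; exact h2 h1), add_zero, neg_neg]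
  · rw [O.g_mul_y, if_neg (by rintro rfl; exact h1 h2), add_zero]
  · exact O.g_mul_g i j

theorem fd_mul_fd (i j : Bool × ℤ) : O.fd i * O.fd j = -(O.fd j * O.fd i) := by
  simp only [fd]
  split_ifs with h1 h2 h2
  · exact O.g_mul_g i j
  · rw [O.g_mul_y, if_neg (by rintro rfl; exact h2 h1), add_zero]
  · rw [O.g_mul_y, if_neg (by rintro rfl; exact h1 h2), add_zero, neg_neg]
  · exact O.y_mul_y i j

theorem f_mul_fd (i j : Bool × ℤ) : O.f i * O.fd j = -(O.fd j * O.f i) + if i = j then 1 else 0 := by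
  simp only [f, fd]
  by_cases hij : i = j
  · subst hij
    rw [if_pos (rfl : i = i)]
    split_ifs with h1
    · rw [O.y_mul_g, if_pos rfl]
    · rw [O.g_mul_y, if_pos rfl]
  · rw [if_neg hij, add_zero]
    split_ifs with h1 h2 h2
    · rw [O.y_mul_g, if_neg (Ne.symm hij), add_zero]
    · exact O.y_mul_y i j
    · exact O.g_mul_g i j
    · rw [O.g_mul_y, if_neg hij, add_zero]

theorem fd_mul_f (i j : Bool × ℤ) : O.fd i * O.f j = -(O.f j * O.fd i) + if i = j then 1 else 0 := by
  rw [O.f_mul_fd, neg_add, neg_neg, ← ite_not]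
  by_cases h : i = j
  · simp [h]
  · simp [h, Ne.symm h]

theorem e_mul_f (i j : Bool × ℤ) : O.e i * O.f j = O.f j * O.e i := by
  simp only [e, f]
  split_ifs
  exacts [O.x_mul_y i j, O.x_mul_g i j, O.d_mul_y i j, O.d_mul_g i j]

theorem e_mul_fd (i j : Bool × ℤ) : O.e i * O.fd j = O.fd j * O.e i := by
  simp only [e, fd]
  split_ifs
  exacts [O.x_mul_g i j, O.x_mul_y i j, O.d_mul_g i j, O.d_mul_y i j]

theorem ed_mul_f (i j : Bool × ℤ) : O.ed i * O.f j = O.f j * O.ed i := by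
  simp only [ed, f]
  split_ifs
  · rw [neg_mul, mul_neg, O.d_mul_y]
  · rw [neg_mul, mul_neg, O.d_mul_g]
  · exact O.x_mul_y i j
  · exact O.x_mul_g i j

theorem ed_mul_fd (i j : Bool × ℤ) : O.ed i * O.fd j = O.fd j * O.ed i := by
  simp only [ed, fd]
  split_ifs
  · rw [neg_mul, mul_neg, O.d_mul_g]
  · rw [neg_mul, mul_neg, O.d_mul_y]
  · exact O.x_mul_g i j
  · exact O.x_mul_y i j

theorem parity_mul_e (i : Bool × ℤ) : O.parity * O.e i = O.e i * O.parity := by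
  simp only [e]
  split_ifs
  exacts [O.parity_mul_x i, O.parity_mul_d i]

theorem parity_mul_ed (i : Bool × ℤ) : O.parity * O.ed i = O.ed i * O.parity := by
  simp only [ed]
  split_ifs
  · rw [mul_neg, neg_mul, O.parity_mul_d]
  · exact O.parity_mul_x i

theorem parity_mul_f (i : Bool × ℤ) : O.parity * O.f i = -(O.f i * O.parity) := by
  simp only [f]
  split_ifs
  exacts [O.parity_mul_y i, O.parity_mul_g i]

theorem parity_mul_fd (i : Bool × ℤ) : O.parity * O.fd i = -(O.fd i * O.parity) := by
  simp only [fd]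
  split_ifs
  exacts [O.parity_mul_g i, O.parity_mul_y i]

theorem e_vac {i : Bool × ℤ} (h : i.2 < 0) : O.e i O.vac = 0 := by
  rw [e, if_neg (by omega), O.d_vac]

theorem ed_vac {i : Bool × ℤ} (h : 0 ≤ i.2) : O.ed i O.vac = 0 := by
  rw [ed, if_pos h, LinearMap.neg_apply, O.d_vac, neg_zero]

theorem f_vac {i : Bool × ℤ} (h : i.2 ≤ 0) : O.f i O.vac = 0 := by
  rw [f, if_neg (by omega), O.g_vac]

theorem fd_vac {i : Bool × ℤ} (h : 1 ≤ i.2) : O.fd i O.vac = 0 := by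
  rw [fd, if_pos h, O.g_vac]

end Oscillators

/-! ### The supercurrent and its commutators with the modes. -/

/-- Shifting the mode number. -/
def shift (n : ℤ) (i : Bool × ℤ) : Bool × ℤ := (i.1, i.2 + n)

theorem shift_shift (m n : ℤ) (i : Bool × ℤ) : shift m (shift n i) = shift (m + n) i := by
  simp only [shift, Prod.mk.injEq, true_and]; ring

theorem shift_zero (i : Bool × ℤ) : shift 0 i = i := by simp [shift]

theorem shift_eq_iff {n : ℤ} {i k : Bool × ℤ} : shift n i = k ↔ i = shift (-n) k := by
  constructor <;> rintro rfl <;> rw [shift_shift] <;> simp [shift_zero]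

theorem shift_injective (n : ℤ) : Function.Injective (shift n) := fun i j h => by
  rw [shift_eq_iff, shift_shift, neg_add_cancel, shift_zero] at h
  exact h

/-- The structure constants of the density modules. -/
def gam (B μ : Bool → ℂ) (n : ℤ) (i : Bool × ℤ) : ℂ := -(i.2 : ℂ) + B i.1 * n + μ i.1

namespace Oscillators

variable {V : Type*} [AddCommGroup V] [Module ℂ V] (O : Oscillators V) (B μ : Bool → ℂ)

/-- The summands of the supercurrent. -/
def term (n : ℤ) (i : Bool × ℤ) : Module.End ℂ V :=
  O.fd (shift n i) * O.e i + gam B μ n i • (O.ed (shift n i) * O.f i)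

theorem finite_term (n : ℤ) (w : V) : Function.HasFiniteSupport fun i => O.term B μ n i w := by
  obtain ⟨h1, h2⟩ := O.finite_d_g w
  -- Each summand contains an annihilation operator, at index `i` or `i + n`, unless `0 ≤ i ≤ -n`.
  -- Almost all annihilation operators kill `w`, and the exceptional strip is finite.
  have h3 : (Set.univ ×ˢ Set.Icc 0 (-n) : Set (Bool × ℤ)).Finite :=
    Set.finite_univ.prod (Set.finite_Icc _ _)
  have hs : ∀ {s : Set (Bool × ℤ)}, s.Finite → (shift n ⁻¹' s).Finite := fun h =>
    h.preimage (shift_injective n).injOn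
  refine ((((h1.union h2).union (hs h1)).union (hs h2)).union h3).subset fun i hi => ?_
  by_contra hc
  simp only [Set.mem_union, Set.mem_ofPred_eq, Set.mem_preimage, Set.mem_prod, Set.mem_univ, true_and,
    Set.mem_Icc, not_or, not_not] at hc
  obtain ⟨⟨⟨⟨c1, c2⟩, c3⟩, c4⟩, c5⟩ := hc
  apply hi
  have t1 : (O.fd (shift n i) * O.e i) w = 0 := by
    by_cases hi0 : 0 ≤ i.2
    · have : 1 ≤ (shift n i).2 := by simp only [shift]; omega
      rw [← O.e_mul_fd, fd, if_pos this, Module.End.mul_apply, c4, map_zero]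
    · rw [e, if_neg hi0, Module.End.mul_apply, c1, map_zero]
  have t2 : (O.ed (shift n i) * O.f i) w = 0 := by
    by_cases hi0 : 1 ≤ i.2
    · have : 0 ≤ (shift n i).2 := by simp only [shift]; omega
      rw [O.ed_mul_f, ed, if_pos this, Module.End.mul_apply, LinearMap.neg_apply, c3, neg_zero, map_zero]
    · rw [f, if_neg hi0, Module.End.mul_apply, c2, map_zero]
  simp only [term, LinearMap.add_apply, LinearMap.smul_apply, t1, t2, smul_zero, add_zero]

/-- The modes of the supercurrent. -/
def Gm (n : ℤ) : Module.End ℂ V := sumEnd (O.term B μ n) (O.finite_term B μ n)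

/-- Both bilinears of a summand are moved past `t` together; `r` and `s` are the contractions of `t`
with the bosonic factor of each. -/
theorem term_mul {a b p q t r s : Module.End ℂ V} {ε₁ ε₂ γ : ℂ} (hb : b * t = ε₁ • (t * b) + r)
    (ha : a * t = ε₂ • (t * a)) (hq : q * t = ε₂ • (t * q)) (hp : p * t = ε₁ • (t * p) + s) :
    (a * b + γ • (p * q)) * t = (ε₁ * ε₂) • (t * (a * b + γ • (p * q)))
      + (a * r + (γ * ε₂) • (s * q)) := by
  rw [add_mul, mul_assoc, hb, smul_mul_assoc, mul_assoc, hq, mul_add, mul_smul_comm, ← mul_assoc, ha,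
    mul_smul_comm, ← mul_assoc, hp, mul_add, mul_smul_comm, add_mul]
  simp only [smul_mul_assoc, mul_assoc, smul_add, smul_smul]
  module

/-- This lemma and the next three say that the supercurrent sends each mode to a multiple of one
mode of the opposite statistics. From here on the infinite sums matter only for the action on the
vacuum and for the functional. -/
theorem Gm_mul_ed (n : ℤ) (k : Bool × ℤ) :
    O.Gm B μ n * O.ed k = O.ed k * O.Gm B μ n + O.fd (shift n k) := by
  have key : ∀ i, O.term B μ n i * O.ed k = (1 : ℂ) • (O.ed k * O.term B μ n i) +
      if i = k then O.fd (shift n i) else 0 := fun i => by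
    have := term_mul (γ := gam B μ n i) (ε₁ := 1) (ε₂ := 1) (s := 0)
      (by rw [O.e_mul_ed i k, one_smul]) (by rw [← O.ed_mul_fd k (shift n i), one_smul]) (by rw [← O.ed_mul_f k i, one_smul])
      (by rw [O.ed_mul_ed (shift n i), one_smul, add_zero])
    rw [term, this]
    simp
  rw [← one_smul ℂ (O.ed k * O.Gm B μ n)]
  exact sumEnd_mul 1 k (by rw [key, if_pos rfl]) fun i hi => by rw [key, if_neg hi, add_zero]

theorem Gm_mul_e (n : ℤ) (k : Bool × ℤ) : O.Gm B μ n * O.e k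
    = O.e k * O.Gm B μ n + (-gam B μ n (shift (-n) k)) • O.f (shift (-n) k) := by
  have key : ∀ i, O.term B μ n i * O.e k = (1 : ℂ) • (O.e k * O.term B μ n i) +
      if i = shift (-n) k then (-gam B μ n i) • O.f i else 0 := fun i => by
    have h : O.ed (shift n i) * O.e k = (1 : ℂ) • (O.e k * O.ed (shift n i)) +
        if i = shift (-n) k then -1 else 0 := by
      rw [O.e_mul_ed, one_smul, add_assoc]
      by_cases h : i = shift (-n) k
      · rw [if_pos h, if_pos (shift_eq_iff.2 h).symm, add_neg_cancel, add_zero]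
      · rw [if_neg h, if_neg fun h' => h (shift_eq_iff.1 h'.symm), add_zero, add_zero]
    have := term_mul (γ := gam B μ n i) (ε₁ := 1) (ε₂ := 1) (r := 0)
      (by rw [O.e_mul_e i k, one_smul, add_zero])
      (by rw [← O.e_mul_fd k (shift n i), one_smul]) (by rw [← O.e_mul_f k i, one_smul]) h
    rw [term, this]
    by_cases h : i = shift (-n) k <;> simp [h]
  rw [← one_smul ℂ (O.e k * O.Gm B μ n)]
  exact sumEnd_mul 1 (shift (-n) k) (by rw [key, if_pos rfl]) fun i hi => by
    rw [key, if_neg hi, add_zero]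

theorem Gm_mul_fd (n : ℤ) (k : Bool × ℤ) : O.Gm B μ n * O.fd k
    = (-1 : ℂ) • (O.fd k * O.Gm B μ n) + gam B μ n k • O.ed (shift n k) := by
  have key : ∀ i, O.term B μ n i * O.fd k = (-1 : ℂ) • (O.fd k * O.term B μ n i) +
      if i = k then gam B μ n i • O.ed (shift n i) else 0 := fun i => by
    rw [term, add_mul, mul_assoc, O.e_mul_fd, ← mul_assoc, O.fd_mul_fd, smul_mul_assoc, mul_assoc,
      O.f_mul_fd, mul_add, mul_neg, ← mul_assoc, O.ed_mul_fd, neg_mul, mul_assoc, mul_assoc, mul_add,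
      mul_smul_comm]
    by_cases h : i = k
    · simp only [h, if_true, mul_one]; module
    · simp only [h, if_false, mul_zero]; module
  exact sumEnd_mul (-1) k (by rw [key, if_pos rfl]) fun i hi => by rw [key, if_neg hi, add_zero]

theorem Gm_mul_f (n : ℤ) (k : Bool × ℤ) : O.Gm B μ n * O.f k
    = (-1 : ℂ) • (O.f k * O.Gm B μ n) + O.e (shift (-n) k) := by
  have key : ∀ i, O.term B μ n i * O.f k = (-1 : ℂ) • (O.f k * O.term B μ n i) +
      if i = shift (-n) k then O.e i else 0 := fun i => by
    have hi : (if shift n i = k then 1 else 0 : Module.End ℂ V)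
        = if i = shift (-n) k then 1 else 0 := if_congr shift_eq_iff rfl rfl
    rw [term, add_mul, mul_assoc, O.e_mul_f, ← mul_assoc, O.fd_mul_f, hi, add_mul, neg_mul,
      smul_mul_assoc, mul_assoc, mul_assoc, O.f_mul_f i k, mul_neg, ← mul_assoc (O.ed _), O.ed_mul_f (shift n i) k, mul_assoc (O.f k),
      mul_add, mul_smul_comm]
    by_cases h : i = shift (-n) k
    · simp only [h, if_true, one_mul]; module
    · simp only [h, if_false, zero_mul]; module
  exact sumEnd_mul (-1) (shift (-n) k) (by rw [key, if_pos rfl]) fun i hi => by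
    rw [key, if_neg hi, add_zero]

theorem Gm_mul_parity (n : ℤ) : O.Gm B μ n * O.parity = (-1 : ℂ) • (O.parity * O.Gm B μ n) := by
  have key : ∀ i, O.term B μ n i * O.parity = (-1 : ℂ) • (O.parity * O.term B μ n i) := fun i => by
    have h1 : O.parity * (O.fd (shift n i) * O.e i) = -(O.fd (shift n i) * O.e i * O.parity) := by
      rw [← mul_assoc, O.parity_mul_fd, neg_mul, mul_assoc, O.parity_mul_e, mul_assoc]
    have h2 : O.parity * (O.ed (shift n i) * O.f i) = -(O.ed (shift n i) * O.f i * O.parity) := by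
      rw [← mul_assoc, O.parity_mul_ed, mul_assoc, O.parity_mul_f, mul_neg, mul_assoc]
    rw [term, mul_add, mul_smul_comm, h1, h2, add_mul, smul_mul_assoc]
    module
  rw [← add_zero ((-1 : ℂ) • _)]
  exact sumEnd_mul (-1) (false, 0) (by rw [key, add_zero]) fun i _ => key i

end Oscillators

end Ramond

end

noncomputable section

namespace Ramond


namespace Oscillators

variable {V : Type*} [AddCommGroup V] [Module ℂ V] (O : Oscillators V) (B μ : Bool → ℂ)

/-! ### Action on the vacuum -/

/-- Each hypothesis provides an annihilation operator in one of the two products; the factors of a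
product commute, so it can be applied to the vacuum first. -/
theorem term_vac {n : ℤ} {i : Bool × ℤ} (h₁ : i.2 < 0 ∨ 1 ≤ i.2 + n) (h₂ : i.2 ≤ 0 ∨ 0 ≤ i.2 + n) :
    O.term B μ n i O.vac = 0 := by
  have t1 : (O.fd (shift n i) * O.e i) O.vac = 0 := by
    rcases h₁ with h | h
    · rw [Module.End.mul_apply, O.e_vac h, map_zero]
    · rw [← O.e_mul_fd, Module.End.mul_apply, O.fd_vac (by simpa [shift] using h), map_zero]
  have t2 : (O.ed (shift n i) * O.f i) O.vac = 0 := by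
    rcases h₂ with h | h
    · rw [Module.End.mul_apply, O.f_vac h, map_zero]
    · rw [O.ed_mul_f, Module.End.mul_apply, O.ed_vac (by simpa [shift] using h), map_zero]
  simp only [term, LinearMap.add_apply, LinearMap.smul_apply, t1, t2, smul_zero, add_zero]

theorem Gm_vac_pos {n : ℤ} (hn : 0 < n) : O.Gm B μ n O.vac = 0 := by
  rw [Gm, sumEnd_apply]
  refine (finsum_congr fun i => O.term_vac B μ ?_ ?_).trans finsum_zero <;> omega

theorem Gm_vac_zero : O.Gm B μ 0 O.vac = ∑ j : Bool, O.fd (j, 0) (O.e (j, 0) O.vac) := by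
  rw [Gm, sumEnd_apply, finsum_eq_sum_of_support_subset (s := {(false, 0), (true, 0)})]
  · simp [term, shift, O.f_vac]
    rw [add_comm]
  · intro i hi
    by_contra hc
    have h0 : i.2 ≠ 0 := by
      obtain ⟨_ | _, m⟩ := i <;> simp at hc <;> simpa using hc
    exact hi (O.term_vac B μ (by omega) (by omega))

theorem Gm_vac_neg_one : O.Gm B μ (-1) O.vac =
    ∑ j : Bool, (O.fd (j, -1) (O.e (j, 0) O.vac) + O.fd (j, 0) (O.e (j, 1) O.vac)) := by
  rw [Gm, sumEnd_apply,
    finsum_eq_sum_of_support_subset (s := {(false, 0), (true, 0), (false, 1), (true, 1)})]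
  · have h : ∀ j, O.ed (j, 0) (O.f (j, 1) O.vac) = 0 := fun j => by
      rw [← Module.End.mul_apply, O.ed_mul_f, Module.End.mul_apply, O.ed_vac le_rfl, map_zero]
    simp [term, shift, O.f_vac, h]
    abel
  · intro i hi
    by_contra hc
    have h0 : i.2 ≠ 0 ∧ i.2 ≠ 1 := by
      obtain ⟨_ | _, m⟩ := i <;> simp at hc <;> simpa using hc
    exact hi (O.term_vac B μ (by omega) (by omega))

theorem ed_e_vac (i j : Bool × ℤ) (h : 0 ≤ i.2) :
    O.ed i (O.e j O.vac) = -(if j = i then 1 else 0 : ℂ) • O.vac := by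
  have h1 := LinearMap.congr_fun (O.e_mul_ed j i) O.vac
  simp only [Module.End.mul_apply, O.ed_vac h, map_zero, LinearMap.add_apply] at h1
  rw [eq_neg_of_add_eq_zero_left h1.symm]
  split_ifs <;> simp

theorem Gm_e_vac (n : ℤ) (k : Bool × ℤ) (h : k.2 ≤ n) :
    O.Gm B μ n (O.e k O.vac) = O.e k (O.Gm B μ n O.vac) := by
  have h1 := LinearMap.congr_fun (O.Gm_mul_e B μ n k) O.vac
  simp only [Module.End.mul_apply, LinearMap.add_apply, LinearMap.smul_apply] at h1
  rw [h1, O.f_vac (by simp only [shift]; omega), smul_zero, add_zero]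

/-- For these indices `G_n` commutes past `e_k` on the vacuum, and the correction from `fd_{k'}`
contracts with `e_k` to a scalar. -/
theorem Gm_fd_e_vac (n : ℤ) (k k' : Bool × ℤ) (h : k.2 ≤ n) (h' : 0 ≤ k'.2 + n) :
    O.Gm B μ n (O.fd k' (O.e k O.vac)) = -(O.fd k' (O.e k (O.Gm B μ n O.vac)))
      - (if k = shift n k' then gam B μ n k' else 0) • O.vac := by
  have h1 := LinearMap.congr_fun (O.Gm_mul_fd B μ n k') (O.e k O.vac)
  simp only [Module.End.mul_apply, LinearMap.add_apply, LinearMap.smul_apply] at h1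
  rw [h1, O.Gm_e_vac B μ n k h, O.ed_e_vac _ _ (by simpa [shift] using h')]
  split_ifs <;> simp [sub_eq_add_neg]

theorem Gm_Gm_zero_vac {n : ℤ} (hn : 0 < n) : O.Gm B μ n (O.Gm B μ 0 O.vac) = 0 := by
  rw [O.Gm_vac_zero, map_sum]
  refine Finset.sum_eq_zero fun j _ => ?_
  rw [O.Gm_fd_e_vac B μ n _ _ hn.le (by simpa using hn.le), O.Gm_vac_pos B μ hn,
    if_neg (by simp [shift]; omega)]
  simp

/-- The contribution of a family of zero modes. -/
theorem zeroMode_mul (i j : Bool × ℤ) :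
    O.fd i * O.e i * (O.fd j * O.e j) = -(O.fd j * O.e j * (O.fd i * O.e i)) := by
  have h : ∀ i j, O.fd i * O.e i * (O.fd j * O.e j) = O.fd i * O.fd j * (O.e i * O.e j) :=
    fun i j => by
    rw [mul_assoc, ← mul_assoc (O.e i), O.e_mul_fd]
    simp only [mul_assoc]
  rw [h, h, O.fd_mul_fd, O.e_mul_e, neg_mul]

theorem Gm_zero_Gm_zero_vac : O.Gm B μ 0 (O.Gm B μ 0 O.vac) = (-∑ j : Bool, μ j) • O.vac := by
  have h1 : O.Gm B μ 0 (O.Gm B μ 0 O.vac) =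
      -(∑ j : Bool, (O.fd (j, 0) * O.e (j, 0)) (O.Gm B μ 0 O.vac)) - (∑ j, μ j) • O.vac := by
    nth_rewrite 1 [O.Gm_vac_zero]
    rw [map_sum, Finset.sum_smul, ← Finset.sum_neg_distrib, ← Finset.sum_sub_distrib]
    refine Finset.sum_congr rfl fun j _ => ?_
    rw [O.Gm_fd_e_vac B μ 0 _ _ le_rfl le_rfl, if_pos (shift_zero _).symm]
    simp [gam]
  -- The zero-mode products anticommute, including each with itself, so the quadratic part of `G_0²`
  -- vanishes and only the contractions `-μ j` are left.
  have h2 : ∑ j : Bool, (O.fd (j, 0) * O.e (j, 0)) (O.Gm B μ 0 O.vac) = 0 := by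
    have hz := fun i j => LinearMap.congr_fun (O.zeroMode_mul i j) O.vac
    have hs : ∀ i, (O.fd i * O.e i * (O.fd i * O.e i)) O.vac = 0 := fun i => by
      have := hz i i
      rw [LinearMap.neg_apply, eq_neg_iff_add_eq_zero, ← two_smul ℂ] at this
      simpa using this
    rw [O.Gm_vac_zero]
    simp only [Fintype.sum_bool, map_add, ← Module.End.mul_apply, hs]
    rw [hz (true, 0) (false, 0), LinearMap.neg_apply]
    abel
  rw [h1, h2, neg_zero, zero_sub, neg_smul]

theorem Gm_one_Gm_neg_one_vac : O.Gm B μ 1 (O.Gm B μ (-1) O.vac) =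
    (-∑ j : Bool, (1 + 2 * B j + 2 * μ j)) • O.vac := by
  rw [O.Gm_vac_neg_one, map_sum, neg_smul, Finset.sum_smul, ← Finset.sum_neg_distrib]
  refine Finset.sum_congr rfl fun j _ => ?_
  rw [map_add, O.Gm_fd_e_vac B μ 1 _ _ (by simp) (by simp), O.Gm_fd_e_vac B μ 1 _ _ (by simp) (by simp),
    O.Gm_vac_pos B μ one_pos, if_pos (by simp [shift]), if_pos (by simp [shift])]
  simp only [map_zero, neg_zero, zero_sub, gam]
  push_cast
  module

/-! ### Schur's lemma -/

/-- The vacuum is cyclic, so an operator commuting with creation is determined by its value there.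
-/
theorem ext_of_commute {T : Module.End ℂ V} {a : ℂ} (hvac : T O.vac = a • O.vac)
    (hx : ∀ i, T * O.x i = O.x i * T) (hy : ∀ i, T * O.y i = O.y i * T) : T = a • 1 := by
  refine LinearMap.ext fun w => ?_
  have := O.induction (N := LinearMap.eqLocus T (a • (1 : Module.End ℂ V))) (by simpa using hvac)
    (fun i w hw => ?_) (fun i w hw => ?_) w
  · simpa using this
  · have h := LinearMap.congr_fun (hx i) w
    simp only [LinearMap.mem_eqLocus, Module.End.mul_apply, LinearMap.smul_apply,
      Module.End.one_apply] at hw h ⊢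
    rw [h, hw, map_smul]
  · have h := LinearMap.congr_fun (hy i) w
    simp only [LinearMap.mem_eqLocus, Module.End.mul_apply, LinearMap.smul_apply,
      Module.End.one_apply] at hw h ⊢
    rw [h, hw, map_smul]

theorem eq_zero_of_commute {T : Module.End ℂ V} {ε : ℂ} (hvac : T O.vac = 0)
    (hx : ∀ i, T * O.x i = O.x i * T) (hy : ∀ i, T * O.y i = ε • (O.y i * T)) : T = 0 := by
  refine LinearMap.ext fun w => ?_
  have := O.induction (N := LinearMap.ker T) (by simpa using hvac)
    (fun i w hw => ?_) (fun i w hw => ?_) w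
  · simpa using this
  · have h := LinearMap.congr_fun (hx i) w
    simp only [LinearMap.mem_ker, Module.End.mul_apply] at hw h ⊢
    rw [h, hw, map_zero]
  · have h := LinearMap.congr_fun (hy i) w
    simp only [LinearMap.mem_ker, Module.End.mul_apply, LinearMap.smul_apply] at hw h ⊢
    rw [h, hw, map_zero, smul_zero]

/-- `T` commutes with the bosonic modes, and commutes up to the factor `ε` with the fermionic
ones. -/
structure SuperCommutes (ε : ℂ) (T : Module.End ℂ V) : Prop where
  e : ∀ k, T * O.e k = O.e k * T
  ed : ∀ k, T * O.ed k = O.ed k * T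
  f : ∀ k, T * O.f k = ε • (O.f k * T)
  fd : ∀ k, T * O.fd k = ε • (O.fd k * T)

variable {O} {T : Module.End ℂ V} {ε : ℂ}

theorem SuperCommutes.x (h : O.SuperCommutes ε T) (i : Bool × ℤ) : T * O.x i = O.x i * T := by
  by_cases hi : 0 ≤ i.2
  · have := h.e i
    rwa [Oscillators.e, if_pos hi] at this
  · have := h.ed i
    rwa [Oscillators.ed, if_neg hi] at this

theorem SuperCommutes.d (h : O.SuperCommutes ε T) (i : Bool × ℤ) : T * O.d i = O.d i * T := by
  by_cases hi : 0 ≤ i.2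
  · have := h.ed i
    rwa [Oscillators.ed, if_pos hi, mul_neg, neg_mul, neg_inj] at this
  · have := h.e i
    rwa [Oscillators.e, if_neg hi] at this

theorem SuperCommutes.y (h : O.SuperCommutes ε T) (i : Bool × ℤ) : T * O.y i = ε • (O.y i * T) := by
  by_cases hi : 1 ≤ i.2
  · have := h.f i
    rwa [Oscillators.f, if_pos hi] at this
  · have := h.fd i
    rwa [Oscillators.fd, if_neg hi] at this

theorem SuperCommutes.g (h : O.SuperCommutes ε T) (i : Bool × ℤ) : T * O.g i = ε • (O.g i * T) := by
  by_cases hi : 1 ≤ i.2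
  · have := h.fd i
    rwa [Oscillators.fd, if_pos hi] at this
  · have := h.f i
    rwa [Oscillators.f, if_neg hi] at this

/-- The image of the vacuum is still killed by every annihilation operator, hence is a multiple of
the vacuum. -/
theorem SuperCommutes.apply_vac (hε : ε ≠ 0) (h : O.SuperCommutes ε T) :
    ∃ a : ℂ, T O.vac = a • O.vac := by
  refine O.eq_smul_vac (fun i => ?_) fun i => ?_
  · have := LinearMap.congr_fun (h.d i) O.vac
    simpa [O.d_vac] using this.symm
  · have := LinearMap.congr_fun (h.g i) O.vac
    simp only [Module.End.mul_apply, O.g_vac, map_zero, LinearMap.smul_apply] at this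
    exact (smul_eq_zero.1 this.symm).resolve_left hε

variable (O)

/-! ### The anticommutators of the supercurrent -/

/-- The anticommutator of two modes of the supercurrent. -/
def acomm (m n : ℤ) : Module.End ℂ V := O.Gm B μ m * O.Gm B μ n + O.Gm B μ n * O.Gm B μ m

theorem acomm_comm (m n : ℤ) : O.acomm B μ m n = O.acomm B μ n m := add_comm _ _

theorem anticomm_mul {a b t r s : Module.End ℂ V} {ε : ℂ} (hε : ε * ε = 1)
    (ha : a * t = ε • (t * a) + r) (hb : b * t = ε • (t * b) + s) :
    (a * b + b * a) * t = t * (a * b + b * a) + ((a * s + ε • (s * a)) + (b * r + ε • (r * b))) := by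
  rw [add_mul, mul_assoc, hb, mul_assoc, ha, mul_add, mul_add, mul_smul_comm, mul_smul_comm,
    ← mul_assoc, ha, ← mul_assoc, hb, add_mul, add_mul, smul_mul_assoc, smul_mul_assoc, smul_add,
    smul_add, smul_smul, smul_smul, hε, mul_add, mul_assoc, mul_assoc]
  module

theorem acomm_mul_ed (m n : ℤ) (k : Bool × ℤ) : O.acomm B μ m n * O.ed k = O.ed k * O.acomm B μ m n
    + (-2 * (k.2 : ℂ) + (B k.1 - 1) * (m + n) + 2 * μ k.1) • O.ed (shift (m + n) k) := by
  have h := fun n => (O.Gm_mul_ed B μ n k).trans (by rw [one_smul ℂ (O.ed k * _)] :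
    _ = (1 : ℂ) • (O.ed k * O.Gm B μ n) + O.fd (shift n k))
  rw [acomm, anticomm_mul (one_mul 1) (h m) (h n), O.Gm_mul_fd, O.Gm_mul_fd, shift_shift, shift_shift,
    add_comm n m]
  simp only [gam, shift]
  push_cast
  module

theorem acomm_mul_fd (m n : ℤ) (k : Bool × ℤ) : O.acomm B μ m n * O.fd k = O.fd k * O.acomm B μ m n
    + (-2 * (k.2 : ℂ) + B k.1 * (m + n) + 2 * μ k.1) • O.fd (shift (m + n) k) := by
  rw [acomm, anticomm_mul (by norm_num) (O.Gm_mul_fd B μ m k) (O.Gm_mul_fd B μ n k)]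
  simp only [mul_smul_comm, smul_mul_assoc, O.Gm_mul_ed, shift_shift, add_comm n m]
  simp only [gam, shift]
  module

theorem acomm_mul_e (m n : ℤ) (k : Bool × ℤ) : O.acomm B μ m n * O.e k = O.e k * O.acomm B μ m n
    - (-2 * (k.2 : ℂ) + (2 + B k.1 - 1) * (m + n) + 2 * μ k.1) • O.e (shift (-(m + n)) k) := by
  have h := fun n => (O.Gm_mul_e B μ n k).trans (by rw [one_smul ℂ (O.e k * _)] :
    _ = (1 : ℂ) • (O.e k * O.Gm B μ n) + (-gam B μ n (shift (-n) k)) • O.f (shift (-n) k))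
  rw [acomm, anticomm_mul (one_mul 1) (h m) (h n)]
  simp only [mul_smul_comm, smul_mul_assoc, O.Gm_mul_f, shift_shift]
  rw [show -m + -n = -(m + n) by ring, show -n + -m = -(m + n) by ring]
  simp only [gam, shift]
  push_cast
  module

theorem acomm_mul_f (m n : ℤ) (k : Bool × ℤ) : O.acomm B μ m n * O.f k = O.f k * O.acomm B μ m n
    - (-2 * (k.2 : ℂ) + (2 + B k.1) * (m + n) + 2 * μ k.1) • O.f (shift (-(m + n)) k) := by
  rw [acomm, anticomm_mul (by norm_num) (O.Gm_mul_f B μ m k) (O.Gm_mul_f B μ n k)]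
  simp only [O.Gm_mul_e, shift_shift]
  rw [show -m + -n = -(m + n) by ring, show -n + -m = -(m + n) by ring]
  simp only [gam, shift]
  push_cast
  module

/-- The action of the anticommutator on single modes depends on `m + n` only, so the difference
commutes with all modes; by Schur's lemma it is a scalar. -/
theorem acomm_sub (m n : ℤ) : O.SuperCommutes 1 (O.acomm B μ m n - O.acomm B μ 0 (m + n)) where
  e k := by
    rw [sub_mul, O.acomm_mul_e, O.acomm_mul_e, mul_sub, zero_add]; push_cast; module
  ed k := by
    rw [sub_mul, O.acomm_mul_ed, O.acomm_mul_ed, mul_sub, zero_add]; push_cast; module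
  f k := by
    rw [sub_mul, O.acomm_mul_f, O.acomm_mul_f, mul_sub, zero_add]; push_cast; module
  fd k := by
    rw [sub_mul, O.acomm_mul_fd, O.acomm_mul_fd, mul_sub, zero_add]; push_cast; module

theorem exists_acomm (m n : ℤ) : ∃ a : ℂ, O.acomm B μ m n = O.acomm B μ 0 (m + n) + a • 1 := by
  have h := O.acomm_sub B μ m n
  obtain ⟨a, ha⟩ := h.apply_vac one_ne_zero
  refine ⟨a, ?_⟩
  rw [← sub_eq_iff_eq_add']
  exact O.ext_of_commute ha h.x fun i => by rw [h.y, one_smul]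

/-- The central term in the anticommutator of two modes of the supercurrent. -/
def lam (m n : ℤ) : ℂ := (O.exists_acomm B μ m n).choose

theorem acomm_eq (m n : ℤ) : O.acomm B μ m n = O.acomm B μ 0 (m + n) + O.lam B μ m n • 1 :=
  (O.exists_acomm B μ m n).choose_spec

/-- The modes of the stress tensor, up to a constant. -/
def Lm (n : ℤ) : Module.End ℂ V := (1 / 2 : ℂ) • O.acomm B μ 0 n

theorem comm_mul {l g t t' r : Module.End ℂ V} {ε α : ℂ} (hl : l * t = t * l + α • t')
    (hg : g * t = ε • (t * g) + r) : (l * g - g * l) * t = ε • (t * (l * g - g * l))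
      + ((l * r - r * l) - α • (g * t' - ε • (t' * g))) := by
  rw [sub_mul, mul_assoc, hg, mul_assoc, hl, mul_add, mul_add, mul_smul_comm, ← mul_assoc, hl,
    mul_smul_comm, ← mul_assoc, hg, add_mul, add_mul, smul_mul_assoc, smul_mul_assoc, mul_sub,
    mul_assoc, mul_assoc]
  module

theorem Lm_mul_ed (m : ℤ) (k : Bool × ℤ) : O.Lm B μ m * O.ed k = O.ed k * O.Lm B μ m
    + (-(k.2 : ℂ) + (B k.1 - 1) * m / 2 + μ k.1) • O.ed (shift m k) := by
  rw [Lm, smul_mul_assoc, O.acomm_mul_ed, mul_smul_comm, zero_add]; push_cast; module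

theorem Lm_mul_fd (m : ℤ) (k : Bool × ℤ) : O.Lm B μ m * O.fd k = O.fd k * O.Lm B μ m
    + (-(k.2 : ℂ) + B k.1 * m / 2 + μ k.1) • O.fd (shift m k) := by
  rw [Lm, smul_mul_assoc, O.acomm_mul_fd, mul_smul_comm, zero_add]; push_cast; module

theorem Lm_mul_e (m : ℤ) (k : Bool × ℤ) : O.Lm B μ m * O.e k = O.e k * O.Lm B μ m
    + ((k.2 : ℂ) - (1 + B k.1) * m / 2 - μ k.1) • O.e (shift (-m) k) := by
  rw [Lm, smul_mul_assoc, O.acomm_mul_e, mul_smul_comm, zero_add]; push_cast; module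

theorem Lm_mul_f (m : ℤ) (k : Bool × ℤ) : O.Lm B μ m * O.f k = O.f k * O.Lm B μ m
    + ((k.2 : ℂ) - (2 + B k.1) * m / 2 - μ k.1) • O.f (shift (-m) k) := by
  rw [Lm, smul_mul_assoc, O.acomm_mul_f, mul_smul_comm, zero_add]; push_cast; module

/-- The expected relation holds on single modes, so the defect anticommutes with the fermions and
commutes with the bosons. -/
theorem Lm_comm_Gm_sub (m n : ℤ) : O.SuperCommutes (-1)
    (O.Lm B μ m * O.Gm B μ n - O.Gm B μ n * O.Lm B μ m - ((m : ℂ) / 2 - n) • O.Gm B μ (m + n)) where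
  ed k := by
    have h : O.Gm B μ n * O.ed k = (1 : ℂ) • (O.ed k * O.Gm B μ n) + O.fd (shift n k) := by
      rw [one_smul, O.Gm_mul_ed]
    rw [sub_mul, comm_mul (O.Lm_mul_ed B μ m k) h, O.Lm_mul_fd, smul_mul_assoc, O.Gm_mul_ed,
      O.Gm_mul_ed, shift_shift, shift_shift, add_comm n m]
    simp only [shift, mul_sub, mul_smul_comm]
    push_cast
    module
  e k := by
    have h : O.Gm B μ n * O.e k = (1 : ℂ) • (O.e k * O.Gm B μ n)
        + (-gam B μ n (shift (-n) k)) • O.f (shift (-n) k) := by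
      rw [one_smul, O.Gm_mul_e]
    rw [sub_mul, comm_mul (O.Lm_mul_e B μ m k) h, mul_smul_comm, O.Lm_mul_f, smul_mul_assoc,
      smul_mul_assoc, O.Gm_mul_e, O.Gm_mul_e, shift_shift, shift_shift,
      show -n + -m = -(m + n) by ring, show -m + -n = -(m + n) by ring]
    simp only [gam, shift, mul_sub, mul_smul_comm]
    push_cast
    module
  fd k := by
    rw [sub_mul, comm_mul (O.Lm_mul_fd B μ m k) (O.Gm_mul_fd B μ n k), mul_smul_comm, O.Lm_mul_ed,
      smul_mul_assoc, smul_mul_assoc, O.Gm_mul_fd, O.Gm_mul_fd, shift_shift, shift_shift, add_comm n m]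
    simp only [gam, shift, mul_sub, mul_smul_comm]
    push_cast
    module
  f k := by
    rw [sub_mul, comm_mul (O.Lm_mul_f B μ m k) (O.Gm_mul_f B μ n k), O.Lm_mul_e,
      smul_mul_assoc, O.Gm_mul_f, O.Gm_mul_f, shift_shift, shift_shift,
      show -n + -m = -(m + n) by ring, show -m + -n = -(m + n) by ring]
    simp only [shift, mul_sub, mul_smul_comm]
    push_cast
    module

theorem Lm_mul_parity (m : ℤ) : O.Lm B μ m * O.parity = O.parity * O.Lm B μ m := by
  have h : ∀ a b, O.Gm B μ a * O.Gm B μ b * O.parity = O.parity * (O.Gm B μ a * O.Gm B μ b) :=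
    fun a b => by
    rw [mul_assoc, O.Gm_mul_parity, mul_smul_comm, ← mul_assoc, O.Gm_mul_parity, smul_mul_assoc,
      smul_smul, mul_assoc]
    norm_num
  rw [Lm, acomm, smul_mul_assoc, add_mul, h, h, mul_smul_comm, mul_add]

theorem vac_ne_zero : O.vac ≠ 0 := fun h => by
  have := O.coherent_vac 0
  rw [h, map_zero] at this
  exact zero_ne_one this

/-- No central term can arise here: the defect maps the vacuum to a multiple of itself and reverses
parity, so that multiple is zero. -/
theorem Lm_comm_Gm (m n : ℤ) : O.Lm B μ m * O.Gm B μ n - O.Gm B μ n * O.Lm B μ m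
    = ((m : ℂ) / 2 - n) • O.Gm B μ (m + n) := by
  have h := O.Lm_comm_Gm_sub B μ m n
  rw [← sub_eq_zero]
  set T := O.Lm B μ m * O.Gm B μ n - O.Gm B μ n * O.Lm B μ m - ((m : ℂ) / 2 - n) • O.Gm B μ (m + n)
    with hT
  obtain ⟨a, ha⟩ := h.apply_vac (by norm_num)
  have hp : T * O.parity = (-1 : ℂ) • (O.parity * T) := by
    have h1 : O.Lm B μ m * O.Gm B μ n * O.parity
        = (-1 : ℂ) • (O.parity * (O.Lm B μ m * O.Gm B μ n)) := by
      rw [mul_assoc, O.Gm_mul_parity, mul_smul_comm, ← mul_assoc, O.Lm_mul_parity, mul_assoc]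
    have h2 : O.Gm B μ n * O.Lm B μ m * O.parity
        = (-1 : ℂ) • (O.parity * (O.Gm B μ n * O.Lm B μ m)) := by
      rw [mul_assoc, O.Lm_mul_parity, ← mul_assoc, O.Gm_mul_parity, smul_mul_assoc, mul_assoc]
    rw [hT, sub_mul, sub_mul, h1, h2, smul_mul_assoc, O.Gm_mul_parity, mul_sub, mul_sub, mul_smul_comm]
    module
  have h0 : a = 0 := by
    have := LinearMap.congr_fun hp O.vac
    simp only [Module.End.mul_apply, O.parity_vac, LinearMap.smul_apply, ha, map_smul] at this
    have h2 : (2 * a) • O.vac = 0 := by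
      linear_combination (norm := module) this
    simpa using (smul_eq_zero.1 h2).resolve_right O.vac_ne_zero
  rw [h0, zero_smul] at ha
  exact O.eq_zero_of_commute ha h.x h.y

theorem smul_one_injective (O : Oscillators V) {a b : ℂ} (h : a • (1 : Module.End ℂ V) = b • 1) : a = b := by
  have h1 := LinearMap.congr_fun h O.vac
  simp only [LinearMap.smul_apply, Module.End.one_apply] at h1
  exact smul_left_injective ℂ O.vac_ne_zero h1

theorem lam_zero (n : ℤ) : O.lam B μ 0 n = 0 := by
  have h := O.acomm_eq B μ 0 n
  rw [zero_add, left_eq_add, ← zero_smul ℂ (1 : Module.End ℂ V)] at h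
  exact O.smul_one_injective h

theorem lam_comm (m n : ℤ) : O.lam B μ m n = O.lam B μ n m := by
  have h := O.acomm_eq B μ m n
  rw [acomm_comm, O.acomm_eq B μ n m, add_comm n m] at h
  exact (O.smul_one_injective (add_left_cancel h)).symm

/-- The commutator with `L_k` is a derivation of the anticommutator, and `[L_k, G_m]` is known. -/
theorem Lm_comm_acomm (k m n : ℤ) :
    O.Lm B μ k * O.acomm B μ m n - O.acomm B μ m n * O.Lm B μ k =
      ((k : ℂ) - m - n) • O.acomm B μ 0 (k + m + n)
        + (((k : ℂ) / 2 - m) * O.lam B μ (k + m) n + ((k : ℂ) / 2 - n) * O.lam B μ m (k + n)) • 1 := by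
  have key : O.Lm B μ k * O.acomm B μ m n - O.acomm B μ m n * O.Lm B μ k =
      ((k : ℂ) / 2 - m) • O.acomm B μ (k + m) n + ((k : ℂ) / 2 - n) • O.acomm B μ m (k + n) := by
    have h1 := O.Lm_comm_Gm B μ k m
    have h2 := O.Lm_comm_Gm B μ k n
    simp only [acomm, smul_add]
    rw [← smul_mul_assoc, ← mul_smul_comm, ← h1, ← mul_smul_comm, ← smul_mul_assoc, ← h2]
    noncomm_ring
  rw [key, O.acomm_eq B μ (k + m) n, O.acomm_eq B μ m (k + n), show m + (k + n) = k + m + n by ring]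
  module

/-- The operators `{G_m, G_n}` and `{G_0, G_{m+n}}` differ by a scalar, so their commutators with
`L_k` agree; comparing the scalar parts gives the cocycle identity. -/
theorem lam_jacobi (k m n : ℤ) :
    ((k : ℂ) / 2 - m) * O.lam B μ (k + m) n + ((k : ℂ) / 2 - n) * O.lam B μ m (k + n)
      = (k : ℂ) / 2 * O.lam B μ k (m + n) := by
  have h := O.Lm_comm_acomm B μ k m n
  have h' := O.Lm_comm_acomm B μ k 0 (m + n)
  have hc : O.Lm B μ k * O.acomm B μ m n - O.acomm B μ m n * O.Lm B μ k
      = O.Lm B μ k * O.acomm B μ 0 (m + n) - O.acomm B μ 0 (m + n) * O.Lm B μ k := by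
    rw [O.acomm_eq B μ m n, mul_add, add_mul, mul_smul_comm, smul_mul_assoc, mul_one, one_mul,
      add_sub_add_right_eq_sub]
  rw [h, h', add_zero, ← add_assoc, O.lam_zero] at hc
  apply O.smul_one_injective
  push_cast at hc
  linear_combination (norm := module) hc

theorem lam_eq_zero {m n : ℤ} (h : m + n ≠ 0) : O.lam B μ m n = 0 := by
  have := O.lam_jacobi B μ 0 m n
  rw [zero_add, zero_add, O.lam_zero] at this
  have h2 : ((m + n : ℤ) : ℂ) * O.lam B μ m n = 0 := by
    push_cast at this ⊢
    linear_combination -this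
  exact (mul_eq_zero.1 h2).resolve_left (by exact_mod_cast h)

theorem lam_nat (m : ℕ) : O.lam B μ m (-m) = (m : ℂ) ^ 2 * O.lam B μ 1 (-1) := by
  induction m with
  | zero => simp [O.lam_zero]
  | succ m ih =>
    -- With these indices the identity contains only the central terms of index `1`, `m` and `m +
    -- 1`, and solves to `(m + 1) λ_{m+1} = (m + 1)³ λ_1`.
    have h := O.lam_jacobi B μ (-(m + 1 : ℤ)) m 1
    rw [show -((m : ℤ) + 1) + m = -1 by ring, show -((m : ℤ) + 1) + 1 = -m by ring, ih,
      O.lam_comm B μ (-1) 1, O.lam_comm B μ (-((m : ℤ) + 1))] at h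
    have hne : ((m : ℂ) + 1) ≠ 0 := by exact_mod_cast Nat.succ_ne_zero m
    push_cast at h ⊢
    apply mul_left_cancel₀ hne
    linear_combination 2 * h

theorem lam_int (m : ℤ) : O.lam B μ m (-m) = (m : ℂ) ^ 2 * O.lam B μ 1 (-1) := by
  obtain ⟨n, rfl | rfl⟩ := m.eq_nat_or_neg
  · exact_mod_cast O.lam_nat B μ n
  · rw [neg_neg, O.lam_comm, O.lam_nat]
    push_cast
    ring

/-- Evaluated on the vacuum, where `G_1G_{-1}` and `2G_0²` are explicit scalars; the parameters `μ`
cancel. -/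
theorem lam_one : O.lam B μ 1 (-1) = -∑ j : Bool, (1 + 2 * B j) := by
  have h := LinearMap.congr_fun (O.acomm_eq B μ 1 (-1)) O.vac
  simp only [acomm, LinearMap.add_apply, Module.End.mul_apply, O.Gm_one_Gm_neg_one_vac,
    O.Gm_vac_pos B μ one_pos, map_zero, add_zero, LinearMap.smul_apply, Module.End.one_apply,
    show (1 : ℤ) + -1 = 0 from rfl, O.Gm_zero_Gm_zero_vac, ← add_smul] at h
  have := smul_left_injective ℂ O.vac_ne_zero h
  simp only [Fintype.sum_bool] at this ⊢
  linear_combination -this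

end Oscillators

end Ramond

end

noncomputable section

namespace Ramond


namespace Oscillators

variable {V : Type*} [AddCommGroup V] [Module ℂ V] (O : Oscillators V)

/-! ### The representation of the enveloping algebra -/

/-- The first structure constants that produce the central charge `c`. -/
def wt (c : ℂ) (j : Bool) : ℂ := if j then -c / 6 else -1

/-- The second structure constants that produce the value `δ` of `G_0²` on the vacuum. -/
def charge (δ : ℂ) (j : Bool) : ℂ := if j then -δ else 0

/-- The modes of the stress tensor. -/
def Lmode (c δ : ℂ) (n : ℤ) : Module.End ℂ V :=
  O.Lm (wt c) (charge δ) n + (if n = 0 then c / 24 else 0 : ℂ) • 1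

theorem lam_neg (c δ : ℂ) (m n : ℤ) (h : m + n = 0) :
    O.lam (wt c) (charge δ) m n = (m : ℂ) ^ 2 * (c / 3) := by
  obtain rfl : n = -m := by omega
  rw [O.lam_int, O.lam_one]
  simp only [Fintype.sum_bool, wt, if_true, if_false, Bool.false_eq_true]
  ring

theorem smul_one_comm (T : Module.End ℂ V) (a : ℂ) : T * (a • 1) = (a • 1) * T := by
  rw [mul_smul_comm, smul_mul_assoc, mul_one, one_mul]

/-- Since `L_n` is half of `{G_0, G_n}` up to a constant, the cubic central term comes from `lam`
and the linear one from the shift `c/24` in `L_0`. -/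
theorem Lmode_comm (c δ : ℂ) (m n : ℤ) :
    O.Lmode c δ m * O.Lmode c δ n - O.Lmode c δ n * O.Lmode c δ m
      = ((m : ℂ) - n) • O.Lmode c δ (m + n)
        + (if m + n = 0 then ((m : ℂ) ^ 3 - m) / 12 else 0) • (c • 1) := by
  have h := O.Lm_comm_acomm (wt c) (charge δ) m 0 n
  rw [add_zero, O.lam_zero, Int.cast_zero] at h
  have h1 : O.Lmode c δ m * O.Lmode c δ n - O.Lmode c δ n * O.Lmode c δ m
      = O.Lm (wt c) (charge δ) m * O.Lm (wt c) (charge δ) n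
        - O.Lm (wt c) (charge δ) n * O.Lm (wt c) (charge δ) m := by
    simp only [Lmode, mul_add, add_mul, mul_smul_comm, smul_mul_assoc, mul_one, one_mul]
    module
  rw [h1]
  nth_rewrite 2 [Lm]
  nth_rewrite 2 [Lm]
  rw [mul_smul_comm, smul_mul_assoc, ← smul_sub, h, Lmode, Lm]
  by_cases hmn : m + n = 0
  · rw [if_pos hmn, if_pos hmn, O.lam_neg c δ m n hmn]
    obtain rfl : n = -m := by omega
    push_cast
    module
  · rw [if_neg hmn, if_neg hmn, O.lam_eq_zero _ _ hmn]
    module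

/-- The representation with central charge `c` for which `G_0²` is `δ` on the vacuum. -/
def rep (c δ : ℂ) : U →ₐ[ℂ] Module.End ℂ V :=
  liftU (O.Lmode c δ) (O.Gm (wt c) (charge δ)) (c • 1) O.parity (O.Lmode_comm c δ)
    (fun m n => by
      rw [Lmode, add_mul, mul_add, ← smul_one_comm, add_sub_add_right_eq_sub, O.Lm_comm_Gm])
    (fun m n => by
      have h := O.acomm_eq (wt c) (charge δ) m n
      rw [acomm] at h
      -- The term `-1/4` in the central part of the relation is absorbed by the shift `c/24` of
      -- `L_0`.
      rw [h, Lmode, Lm]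
      by_cases hmn : m + n = 0
      · rw [if_pos hmn, if_pos hmn, O.lam_neg c δ m n hmn]
        module
      · rw [if_neg hmn, if_neg hmn, O.lam_eq_zero _ _ hmn]
        module)
    (fun m => smul_one_comm _ _) (fun m => smul_one_comm _ _)
    (fun m => by rw [Lmode, mul_add, add_mul, O.Lm_mul_parity, smul_one_comm])
    (smul_one_comm _ _)
    (fun m => by rw [O.Gm_mul_parity, neg_one_smul, add_neg_cancel])

theorem rep_L (c δ : ℂ) (m : ℤ) : O.rep c δ (L m) = O.Lmode c δ m := liftU_L m

theorem rep_G (c δ : ℂ) (m : ℤ) : O.rep c δ (G m) = O.Gm (wt c) (charge δ) m := liftU_G m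

theorem rep_C (c δ : ℂ) : O.rep c δ C = c • 1 := liftU_C

theorem rep_F (c δ : ℂ) : O.rep c δ F = O.parity := liftU_F

theorem Lmode_vac_pos (c δ : ℂ) {m : ℤ} (hm : 0 < m) : O.Lmode c δ m O.vac = 0 := by
  rw [Lmode, if_neg hm.ne', zero_smul, add_zero, Lm, acomm]
  simp [O.Gm_Gm_zero_vac _ _ hm, O.Gm_vac_pos _ _ hm]

theorem Lmode_vac_zero (c δ : ℂ) : O.Lmode c δ 0 O.vac = (δ + c / 24) • O.vac := by
  rw [Lmode, if_pos rfl, Lm, acomm]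
  simp only [LinearMap.add_apply, LinearMap.smul_apply, Module.End.mul_apply, Module.End.one_apply,
    O.Gm_zero_Gm_zero_vac, charge, Fintype.sum_bool, if_true, Bool.false_eq_true, if_false]
  module

theorem rep_vac_eq_zero (c δ : ℂ) {u : U} (hu : u ∈ Submodule.span U (hwRel c (δ + c / 24))) :
    O.rep c δ u O.vac = 0 := by
  induction hu using Submodule.span_induction with
  | zero => simp
  | add x y _ _ hx hy => rw [map_add, LinearMap.add_apply, hx, hy, add_zero]
  | smul a x _ hx => rw [smul_eq_mul, map_mul, Module.End.mul_apply, hx, map_zero]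
  | mem x hx =>
    rcases hx with ⟨m, hm, rfl | rfl⟩ | rfl | rfl | rfl
    · rw [rep_L, O.Lmode_vac_pos c δ hm]
    · rw [rep_G, O.Gm_vac_pos _ _ hm]
    · rw [map_sub, rep_L, AlgHom.commutes, LinearMap.sub_apply, O.Lmode_vac_zero,
        Module.algebraMap_end_apply, sub_self]
    · rw [map_sub, rep_C, AlgHom.commutes, LinearMap.sub_apply, Module.algebraMap_end_apply,
        LinearMap.smul_apply, Module.End.one_apply, sub_self]
    · rw [map_sub, rep_F, map_one, LinearMap.sub_apply, O.parity_vac, Module.End.one_apply, sub_self]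

/-! ### A Whittaker functional -/

/-- The coherent functional at the point where two coordinates of the first family are one. -/
def whit : V →ₗ[ℂ] ℂ := O.coherent fun i => if i = (false, -1) ∨ i = (false, 0) then 1 else 0

theorem whit_e (i : Bool × ℤ) (h : 0 ≤ i.2) (w : V) :
    O.whit (O.e i w) = if i = (false, 0) then O.whit w else 0 := by
  rw [e, if_pos h, whit, O.coherent_x]
  have : i ≠ (false, -1) := by rintro rfl; simp at h
  simp [this]

theorem whit_ed (i : Bool × ℤ) (h : i.2 < 0) (w : V) :
    O.whit (O.ed i w) = if i = (false, -1) then O.whit w else 0 := by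
  rw [ed, if_neg h.not_ge, whit, O.coherent_x]
  have : i ≠ (false, 0) := by rintro rfl; simp at h
  simp [this]

theorem whit_f (i : Bool × ℤ) (h : 1 ≤ i.2) (w : V) : O.whit (O.f i w) = 0 := by
  rw [f, if_pos h, whit, O.coherent_y]

theorem whit_fd (i : Bool × ℤ) (h : i.2 < 1) (w : V) : O.whit (O.fd i w) = 0 := by
  rw [fd, if_neg h.not_ge, whit, O.coherent_y]

/-- In the first product, either the fermion is created, or the boson has positive index and is
evaluated at zero. In the second, a fermion is created as soon as `i ≥ 1`. -/
theorem whit_term {B μ : Bool → ℂ} {n : ℤ} (hn : n ≤ 0) (i : Bool × ℤ) (w : V) :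
    O.whit (O.term B μ n i w) = if 1 ≤ i.2 then 0 else
      gam B μ n i * O.whit (O.ed (shift n i) (O.f i w)) := by
  have t1 : O.whit ((O.fd (shift n i) * O.e i) w) = 0 := by
    by_cases hi : i.2 + n < 1
    · rw [Module.End.mul_apply, O.whit_fd _ (by simpa [shift] using hi)]
    · rw [← O.e_mul_fd, Module.End.mul_apply, O.whit_e _ (by omega), if_neg]
      rintro rfl
      simp at hi
      omega
  simp only [term, LinearMap.add_apply, map_add, LinearMap.smul_apply, map_smul, t1, zero_add,
    smul_eq_mul]
  split_ifs with h
  · rw [O.ed_mul_f, Module.End.mul_apply, O.whit_f _ h, mul_zero]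
  · rfl

theorem whit_Gm_eq {B μ : Bool → ℂ} {n : ℤ} (w : V) :
    O.whit (O.Gm B μ n w) = ∑ᶠ i, O.whit (O.term B μ n i w) := by
  rw [Gm, sumEnd_apply, map_finsum O.whit (O.finite_term B μ n w)]

/-- The surviving terms have `i ≤ 0`, so the boson created has index at most `-2`, where the
evaluation point vanishes. -/
theorem whit_Gm {B μ : Bool → ℂ} {n : ℤ} (hn : n ≤ -2) (w : V) : O.whit (O.Gm B μ n w) = 0 := by
  rw [whit_Gm_eq]
  refine (finsum_congr fun i => ?_).trans finsum_zero
  rw [O.whit_term (by omega)]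
  split_ifs with h
  · rfl
  · rw [O.whit_ed _ (by simp only [shift]; omega), if_neg, mul_zero]
    simp only [shift, Prod.mk.injEq, not_and]
    omega

/-- Only the coordinate `(false, -1)` is seen, reached from `i = (false, 0)`, where `B false = -1`
makes the structure constant equal to `1`. -/
theorem whit_Gm_neg_one {B μ : Bool → ℂ} (hB : B false = -1) (hμ : μ false = 0) (w : V) :
    O.whit (O.Gm B μ (-1) w) = O.whit (O.f (false, 0) w) := by
  rw [whit_Gm_eq, finsum_eq_single _ (false, 0)]
  · rw [O.whit_term (by omega), if_neg (by simp), O.whit_ed _ (by simp [shift]),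
      if_pos (by simp [shift])]
    simp [gam, hB, hμ]
  · intro i hi
    rw [O.whit_term (by omega)]
    split_ifs with h
    · rfl
    · rw [O.whit_ed _ (by simp only [shift]; omega), if_neg, mul_zero]
      intro h'
      apply hi
      rw [shift_eq_iff] at h'
      simpa [shift] using h'

/-- At `i = 0` the boson is annihilated, not created, so evaluation gives no vanishing; there the
structure constant is `μ`, which is zero for the first family. -/
theorem whit_Gm_zero {B μ : Bool → ℂ} (hB : B false = -1) (hμ : μ false = 0) (w : V) :
    O.whit (O.Gm B μ 0 w) = O.whit (O.f (false, -1) w)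
      + μ true * O.whit (O.ed (true, 0) (O.f (true, 0) w)) := by
  rw [whit_Gm_eq, finsum_eq_sum_of_support_subset (s := {(false, -1), (true, 0)}),
    Finset.sum_pair (by simp), O.whit_term le_rfl, O.whit_term le_rfl, if_neg (by simp),
    if_neg (by simp), O.whit_ed _ (by simp [shift]), if_pos (by simp [shift])]
  · simp [gam, hB, hμ, shift]
  · intro i hi
    by_contra hc
    simp only [Finset.coe_insert, Finset.coe_singleton, Set.mem_insert_iff, Set.mem_singleton_iff,
      not_or] at hc
    apply hi
    change O.whit (O.term B μ 0 i w) = 0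
    rw [O.whit_term le_rfl]
    split_ifs with h
    · rfl
    · rw [shift_zero]
      rcases (show i.2 = 0 ∨ i.2 < 0 by omega) with h0 | h0
      · obtain ⟨j | j, m⟩ := i
        · simp only at h0
          simp [gam, h0, hμ]
        · simp only at h0
          simp [h0] at hc
      · rw [O.whit_ed _ h0, if_neg hc.1, mul_zero]

theorem f_Gm (B μ : Bool → ℂ) (n : ℤ) (k : Bool × ℤ) (w : V) :
    O.f k (O.Gm B μ n w) = O.e (shift (-n) k) w - O.Gm B μ n (O.f k w) := by
  have h := LinearMap.congr_fun (O.Gm_mul_f B μ n k) w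
  simp only [Module.End.mul_apply, LinearMap.add_apply, LinearMap.smul_apply] at h
  rw [h]
  module

theorem f_f_self (k : Bool × ℤ) (w : V) : O.f k (O.f k w) = 0 := by
  have := LinearMap.congr_fun (O.f_mul_f k k) w
  rw [LinearMap.neg_apply, eq_neg_iff_add_eq_zero, ← two_smul ℂ] at this
  simpa using this

/-- Here `L_n` is half of `{G_{-1}, G_{n+1}}`. Under the functional `G_{-1}` acts as the fermionic
mode `f (false, 0)`, whose contraction with the other factor is a boson evaluated at zero. -/
theorem whit_Lm {B μ : Bool → ℂ} (hB : B false = -1) (hμ : μ false = 0) {n : ℤ} (hn : n ≤ -2)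
    (w : V) : O.whit (O.Lm B μ n w) = 0 := by
  have h := O.acomm_eq B μ (-1) (n + 1)
  rw [O.lam_eq_zero _ _ (by omega), zero_smul, add_zero, show -1 + (n + 1) = n by ring] at h
  have key : ∀ w, O.whit (O.Gm B μ (n + 1) (O.f (false, 0) w)) = 0 := fun w => by
    rcases (show n + 1 ≤ -2 ∨ n + 1 = -1 by omega) with h | h
    · exact O.whit_Gm h _
    · rw [h, O.whit_Gm_neg_one hB hμ, O.f_f_self, map_zero]
  have key2 : O.whit (O.Gm B μ (n + 1) (O.Gm B μ (-1) w)) = 0 := by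
    rcases (show n + 1 ≤ -2 ∨ n + 1 = -1 by omega) with h | h
    · exact O.whit_Gm h _
    · rw [h, O.whit_Gm_neg_one hB hμ, O.f_Gm, map_sub, O.whit_e _ (by simp [shift]),
        if_neg (by simp [shift]), ← h, key, sub_zero]
  rw [Lm, ← h, acomm, LinearMap.smul_apply, map_smul, LinearMap.add_apply, map_add,
    Module.End.mul_apply, Module.End.mul_apply, O.whit_Gm_neg_one hB hμ, O.f_Gm, map_sub, key, key2,
    O.whit_e _ (by simp [shift]; omega), if_neg (by simp [shift]; omega), sub_zero, add_zero, smul_zero]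

/-- Each ordering of `G_{-1}`, `G_0` contributes one contraction equal to `e (false, 0)`, evaluated
at `1`. The remaining terms of the two orderings cancel because the fermionic modes anticommute, and
the factor `1/2` gives the claim. -/
theorem whit_Lm_neg_one {B μ : Bool → ℂ} (hB : B false = -1) (hμ : μ false = 0) (w : V) :
    O.whit (O.Lm B μ (-1) w) = O.whit w := by
  have h1 : O.whit (O.Gm B μ (-1) (O.Gm B μ 0 w)) = O.whit w
      - (O.whit (O.f (false, -1) (O.f (false, 0) w))
        + μ true * O.whit (O.ed (true, 0) (O.f (true, 0) (O.f (false, 0) w)))) := by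
    rw [O.whit_Gm_neg_one hB hμ, O.f_Gm, map_sub, O.whit_Gm_zero hB hμ, O.whit_e _ (by simp [shift]),
      if_pos (by simp [shift])]
  have h2 : O.whit (O.f (false, -1) (O.Gm B μ (-1) w))
      = O.whit w - O.whit (O.f (false, 0) (O.f (false, -1) w)) := by
    rw [O.f_Gm, map_sub, O.whit_Gm_neg_one hB hμ, O.whit_e _ (by simp [shift]),
      if_pos (by simp [shift])]
  have h3 : O.whit (O.ed (true, 0) (O.f (true, 0) (O.Gm B μ (-1) w)))
      = O.whit (O.ed (true, 0) (O.f (true, 0) (O.f (false, 0) w))) := by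
    have e1 : O.whit (O.ed (true, 0) (O.e (true, 1) w)) = 0 := by
      have := LinearMap.congr_fun (O.e_mul_ed (true, 1) (true, 0)) w
      rw [if_neg (by simp), add_zero, Module.End.mul_apply, Module.End.mul_apply] at this
      rw [← this, O.whit_e _ (by simp), if_neg (by simp)]
    have e2 : ∀ w, O.ed (true, 0) (O.Gm B μ (-1) w)
        = O.Gm B μ (-1) (O.ed (true, 0) w) - O.fd (true, -1) w := fun w => by
      have := LinearMap.congr_fun (O.Gm_mul_ed B μ (-1) (true, 0)) w
      simp only [Module.End.mul_apply, LinearMap.add_apply] at this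
      rw [this]
      simp [shift]
    have e3 : ∀ w, O.ed (true, 0) (O.f (false, 0) w) = O.f (false, 0) (O.ed (true, 0) w) :=
      LinearMap.congr_fun (O.ed_mul_f (true, 0) (false, 0))
    have e4 : O.f (true, 0) (O.f (false, 0) w) = -O.f (false, 0) (O.f (true, 0) w) :=
      LinearMap.congr_fun (O.f_mul_f (true, 0) (false, 0)) w
    rw [O.f_Gm, map_sub, e2, map_sub, map_sub, O.whit_Gm_neg_one hB hμ, O.whit_fd _ (by simp), e4,
      map_neg, map_neg, e3]
    simp only [shift, neg_neg, zero_add, e1]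
    ring
  have e5 : O.f (false, -1) (O.f (false, 0) w) = -O.f (false, 0) (O.f (false, -1) w) :=
    LinearMap.congr_fun (O.f_mul_f (false, -1) (false, 0)) w
  rw [Lm, acomm, LinearMap.smul_apply, map_smul, LinearMap.add_apply, map_add, Module.End.mul_apply,
    Module.End.mul_apply, h1, O.whit_Gm_zero hB hμ, h2, h3, e5, map_neg, smul_eq_mul]
  ring

theorem whit_vac : O.whit O.vac = 1 := O.coherent_vac _

theorem whit_Gm_zero_vac {B μ : Bool → ℂ} (hB : B false = -1) (hμ : μ false = 0) :
    O.whit (O.Gm B μ 0 O.vac) = 0 := by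
  rw [O.whit_Gm_zero hB hμ, O.f_vac (by simp), O.f_vac (by simp)]
  simp

theorem whit_Gm_neg_one_Gm_zero_vac {B μ : Bool → ℂ} (hB : B false = -1) (hμ : μ false = 0) :
    O.whit (O.Gm B μ (-1) (O.Gm B μ 0 O.vac)) = 1 := by
  rw [O.whit_Gm_neg_one hB hμ, O.f_Gm, O.f_vac (by simp), map_zero, sub_zero,
    O.whit_e _ (by simp [shift]), if_pos (by simp [shift]), whit_vac]

end Oscillators

/-! ### The functional on the Verma module. -/

/-- A functional on the Verma module which kills the lower modes and is invariant under
`L_{-1}`. -/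
theorem exists_functional (c Δ : ℂ) : ∃ φ : Verma c Δ →ₗ[ℂ] ℂ,
    (∀ w ∈ lowSpan (Verma c Δ), φ w = 0) ∧ (∀ w, φ (L (-1) • w) = φ w) ∧ φ (hw c Δ) = 1 ∧
      φ (G 0 • hw c Δ) = 0 ∧ φ (G (-1) • G 0 • hw c Δ) = 1 := by
  let O := Fock.oscillators
  let δ := Δ - c / 24
  have hΔ : δ + c / 24 = Δ := by ring
  let ψ : U →ₗ[ℂ] ℂ := O.whit ∘ₗ LinearMap.applyₗ O.vac ∘ₗ (O.rep c δ).toLinearMap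
  -- The vacuum satisfies the highest weight conditions, so the functional on `U` factors through
  -- the Verma module.
  have hψ : (Submodule.span U (hwRel c Δ)).restrictScalars ℂ ≤ LinearMap.ker ψ := fun u hu => by
    rw [Submodule.restrictScalars_mem, ← hΔ] at hu
    simp [ψ, O.rep_vac_eq_zero c δ hu]
  let φ : Verma c Δ →ₗ[ℂ] ℂ := Submodule.liftQ _ ψ hψ ∘ₗ
    (Submodule.Quotient.restrictScalarsEquiv ℂ (Submodule.span U (hwRel c Δ))).symm.toLinearMap
  have hφ : ∀ u v : U, φ (u • (Submodule.Quotient.mk v : Verma c Δ))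
      = O.whit (O.rep c δ u (O.rep c δ v O.vac)) := fun u v => by
    rw [← Submodule.Quotient.mk_smul, smul_eq_mul, ← Module.End.mul_apply, ← map_mul]
    rfl
  have hφ1 : ∀ v : U, φ (Submodule.Quotient.mk v : Verma c Δ) = O.whit (O.rep c δ v O.vac) :=
    fun v => rfl
  have hB : Oscillators.wt c false = -1 := rfl
  have hμ : Oscillators.charge δ false = 0 := rfl
  have hL : ∀ {m : ℤ}, m ≠ 0 → O.Lmode c δ m = O.Lm (Oscillators.wt c) (Oscillators.charge δ) m :=
    fun hm => by rw [Oscillators.Lmode, if_neg hm, zero_smul, add_zero]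
  refine ⟨φ, fun w hw => ?_, fun w => ?_, ?_, ?_, ?_⟩
  · induction hw using Submodule.span_induction with
    | zero => exact map_zero φ
    | add x y _ _ hx hy => rw [map_add, hx, hy, add_zero]
    | smul a x _ hx => rw [map_smul, hx, smul_zero]
    | mem x hx =>
      obtain ⟨m, hm, w', rfl | rfl⟩ := hx
      · obtain ⟨v, rfl⟩ := Submodule.Quotient.mk_surjective _ w'
        rw [hφ, O.rep_L, hL (by omega), O.whit_Lm hB hμ hm]
      · obtain ⟨v, rfl⟩ := Submodule.Quotient.mk_surjective _ w'
        rw [hφ, O.rep_G, O.whit_Gm hm]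
  · obtain ⟨v, rfl⟩ := Submodule.Quotient.mk_surjective _ w
    rw [hφ, O.rep_L, hL (by omega), O.whit_Lm_neg_one hB hμ, hφ1]
  · rw [hw, hφ1, map_one, Module.End.one_apply, O.whit_vac]
  · rw [hw, hφ, map_one, Module.End.one_apply, O.rep_G, O.whit_Gm_zero_vac hB hμ]
  · rw [← mul_smul, hw, hφ, map_one, Module.End.one_apply, map_mul, Module.End.mul_apply, O.rep_G,
      O.rep_G, O.whit_Gm_neg_one_Gm_zero_vac hB hμ]

end Ramond

end

noncomputable section

namespace Ramond


/-! ### Independence of the kernel vectors -/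

section independence

variable {V : Type*} [AddCommGroup V] [Module ℂ V] {A B H : Module.End ℂ V}

theorem apply_pow_of_invariant {φ : V →ₗ[ℂ] ℂ} (hA : ∀ y, φ (A y) = φ y) (n : ℕ) (y : V) :
    φ ((A ^ n) y) = φ y := by
  induction n with
  | zero => simp
  | succ n ih => rw [pow_succ_apply, ← pow_apply_self, hA, ih]

variable {φ : V →ₗ[ℂ] ℂ} {x : V} {δ : ℂ}

/-- Two functionals separate the leading vectors. `φ` sees only `a + b`; in `φ ∘ H ∘ B` the second
term dies by `B² = 0` and the first contributes `2 - 1 = 1`. -/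
theorem KernelRel.functional_even (h : KernelRel A B H) (hA : ∀ y, φ (A y) = φ y) (h1 : φ x = 1)
    (h2 : φ (B (H x)) = 1) (l : ℕ) (a b : ℂ) :
    φ (H (B (kerEven A B H l a b x))) = a ∧ φ (kerEven A B H l a b x) = a + b := by
  constructor
  · rw [kerEven, map_add, map_smul, map_smul, h.BA_pow, h.BA_pow, h.BB, map_zero, smul_zero, add_zero,
      map_smul, h.HA_pow_B]
    simp only [map_smul, map_sub, apply_pow_of_invariant hA, hA, h1, h2, smul_eq_mul]
    ring
  · simp only [kerEven, map_add, map_smul, apply_pow_of_invariant hA, h1, h2, smul_eq_mul, mul_one]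

/-- `φ ∘ B` isolates `a`, by `B² = 0`; then `φ ∘ H` determines `b`, which enters with factor `2 - 1
= 1`. -/
theorem KernelRel.functional_odd (h : KernelRel A B H) (hA : ∀ y, φ (A y) = φ y) (h1 : φ x = 1)
    (h2 : φ (B (H x)) = 1) (hx : H (H x) = δ • x) (l : ℕ) (a b : ℂ) :
    φ (B (kerOdd A B H l a b x)) = a ∧
      φ (H (kerOdd A B H l a b x)) = a * (δ + (l : ℂ) / 2) + b := by
  constructor
  · rw [kerOdd, map_add, map_smul, map_smul, h.BA_pow, h.BA_pow, h.BB, map_zero, smul_zero, add_zero,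
      map_smul, apply_pow_of_invariant hA, h2, smul_eq_mul, mul_one]
  · rw [kerOdd, map_add, map_smul, map_smul, h.HA_pow_B]
    have : φ (H ((A ^ l) (H x))) = δ + (l : ℂ) / 2 := by
      rcases l with _ | l
      · simp [hx, h1]
      · rw [h.HA_pow_succ, hx]
        simp only [map_add, map_smul, apply_pow_of_invariant hA, hA, h1, h2, smul_eq_mul]
        push_cast
        ring
    simp only [map_add, map_sub, map_smul, this, apply_pow_of_invariant hA, hA, h1, h2, smul_eq_mul]
    ring

theorem KernelRel.functional_closed (h : KernelRel A B H) (hA : ∀ y, φ (A y) = φ y) (h1 : φ x = 1)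
    (hx : H x = 0) (l : ℕ) (a b : ℂ) :
    φ (kerEven A B H l a b x) = a ∧ φ (H (kerOdd A B H l a b x)) = 2 * b := by
  constructor
  · simp only [kerEven, hx, map_zero, smul_zero, add_zero, map_smul, apply_pow_of_invariant hA, h1,
      smul_eq_mul, mul_one]
  · simp only [kerOdd, hx, map_zero, smul_zero, zero_add, map_smul, h.HA_pow_B, sub_zero,
      apply_pow_of_invariant hA, hA, h1, smul_eq_mul]
    ring

end independence

/-- The functional on the quotient of the Verma module by the lower modes. -/
theorem exists_lowFunctional (c Δ : ℂ) : ∃ φ : LowQuot (Verma c Δ) →ₗ[ℂ] ℂ,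
    (∀ y, φ (lowL _ y) = φ y) ∧ φ ((lowSpan _).mkQ (hw c Δ)) = 1 ∧
      φ (lowG₀ _ ((lowSpan _).mkQ (hw c Δ))) = 0 ∧
      φ (lowG _ (lowG₀ _ ((lowSpan _).mkQ (hw c Δ)))) = 1 := by
  obtain ⟨φ, hlow, hL, h1, h2, h3⟩ := exists_functional c Δ
  refine ⟨(lowSpan _).liftQ φ hlow, fun y => ?_, h1, h2, h3⟩
  obtain ⟨w, rfl⟩ := (lowSpan _).mkQ_surjective y
  exact hL w

theorem lowG₀_lowG₀ {M : Type*} [AddCommGroup M] [Module ℂ M] [Module U M] [IsScalarTower ℂ U M]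
    {c Δ ε : ℂ} {v : M} (hv : IsHW c Δ ε v) :
    lowG₀ M (lowG₀ M ((lowSpan M).mkQ v)) = (Δ - c / 24) • (lowSpan M).mkQ v := by
  rw [← mkQ_G_zero, ← mkQ_G_zero, hv.G_zero_G_zero, map_smul]

/-- For `m > 0` the (anti)commutators with `G_0` are multiples of the positive modes themselves,
without central term. -/
theorem IsHW.G_zero_smul {M : Type*} [AddCommGroup M] [Module ℂ M] [Module U M]
    [IsScalarTower ℂ U M] {c Δ ε : ℂ} {v : M} (hv : IsHW c Δ ε v) : IsHW c Δ (-ε) (G 0 • v) := by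
  refine ⟨fun m hm => ?_, fun m hm => ?_, ?_, ?_, ?_⟩
  · rw [L_G_smul, hv.annL m hm, hv.annG _ (by omega), smul_zero, smul_zero, add_zero]
  · rw [G_G_smul, hv.annG m hm, if_neg (by omega), add_zero, hv.annL _ (by omega)]
    simp
  · rw [L_G_smul, hv.weight, smul_comm (G 0) Δ, Int.cast_zero, zero_div, sub_zero, zero_smul,
      add_zero]
  · rw [← mul_smul, ← G_mul_C, mul_smul, hv.central, smul_comm]
  · rw [← mul_smul, F_mul_G, neg_smul, mul_smul, hv.parity, smul_comm, neg_smul]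

/-- The functional on the quotient of the `G`-closed Verma module by the lower modes. -/
theorem exists_lowFunctionalG (c : ℂ) : ∃ φ : LowQuot (VermaG c) →ₗ[ℂ] ℂ,
    (∀ y, φ (lowL _ y) = φ y) ∧ φ ((lowSpan _).mkQ (hwG c)) = 1 := by
  obtain ⟨φ, hL, h1, h2, h3⟩ := exists_lowFunctional c (c / 24)
  have hK := kernelRel (Verma c (c / 24))
  have hx := lowG₀_lowG₀ (isHW_hw c (c / 24))
  rw [sub_self, zero_smul] at hx
  -- The functional `φ` itself does not descend, being `1` on `G_{-1}G_0|c/24⟩`. Composed with `H ∘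
  -- B` it is still invariant under `L_{-1}`, since `B² = 0`, and it takes the value `2 - 1 = 1` on
  -- the generator.
  let χ : Verma c (c / 24) →ₗ[ℂ] ℂ := φ ∘ₗ lowG₀ _ ∘ₗ lowG _ ∘ₗ (lowSpan _).mkQ
  have hχlow : ∀ w ∈ lowSpan (Verma c (c / 24)), χ w = 0 := fun w hw => by
    simp only [χ, LinearMap.comp_apply, mkQ_eq_zero hw, map_zero]
  have hχL : ∀ w, χ (L (-1) • w) = χ w := fun w => by
    simp only [χ, LinearMap.comp_apply, mkQ_L_neg_one, hK.BA, hK.HA, hK.BB, smul_zero, add_zero, hL]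
  -- The kernel of the map onto the `G`-closed module is generated by `G_0|c/24⟩`. On its leading
  -- monomials `χ` vanishes by `H²x = 0`, by `B² = 0`, or by `φ(Hx) = 0`.
  have hχ0 : ∀ u : U, χ (u • G 0 • hw c (c / 24)) = 0 := fun u => by
    refine (Submodule.span_le (p := LinearMap.ker χ)).2 ?_
      (smul_mem_span_mono (isHW_hw c (c / 24)).G_zero_smul u)
    rintro _ ⟨X, rfl⟩
    rw [SetLike.mem_coe, LinearMap.mem_ker]
    rcases X.eq_lead_or_mem (G 0 • hw c (c / 24)) with hX | hX
    · rw [hX]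
      simp only [χ, LinearMap.comp_apply, mkQ_lead, mkQ_G_zero]
      rcases fin_two_cases X.r₁ with e | e <;> rcases fin_two_cases X.r₂ with e' | e' <;>
        simp only [e, e', Fin.val_zero, Fin.val_one, pow_zero, pow_one, Module.End.one_apply, hx,
          map_zero, hK.BA_pow, hK.BB]
      rw [hK.HA_pow_B, hx]
      simp only [map_smul, map_zero, apply_pow_of_invariant hL, hL, h2, smul_zero, sub_zero]
    · exact hχlow _ hX
  let ψ : U →ₗ[ℂ] ℂ := χ ∘ₗ (LinearMap.toSpanSingleton U _ (hw c (c / 24))).restrictScalars ℂ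
  let S := Submodule.span U (hwRel c (c / 24) ∪ {G 0})
  have hψ : S.restrictScalars ℂ ≤ LinearMap.ker ψ := fun u hu => by
    have hu' : u ∈ Submodule.span U (hwRel c (c / 24) ∪ {G 0}) := hu
    rw [Submodule.span_union] at hu'
    obtain ⟨s, hs, t, ht, rfl⟩ := Submodule.mem_sup.1 hu'
    obtain ⟨r, rfl⟩ := Submodule.mem_span_singleton.1 ht
    rw [← smul_hw_eq_zero_iff] at hs
    have : (s + r • G 0) • hw c (c / 24) = r • G 0 • hw c (c / 24) := by
      rw [add_smul, hs, zero_add, smul_assoc]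
    rw [LinearMap.mem_ker]
    change χ ((s + r • G 0) • hw c (c / 24)) = 0
    rw [this, hχ0]
  let χG : VermaG c →ₗ[ℂ] ℂ := Submodule.liftQ _ ψ hψ ∘ₗ
    (Submodule.Quotient.restrictScalarsEquiv ℂ S).symm.toLinearMap
  have hχG : ∀ u v : U, χG (u • (Submodule.Quotient.mk v : VermaG c)) = χ (u • v • hw c (c / 24)) :=
    fun u v => by
    rw [← Submodule.Quotient.mk_smul, smul_eq_mul, ← mul_smul]
    rfl
  have hlow : lowSpan (VermaG c) ≤ LinearMap.ker χG := by
    refine Submodule.span_le.2 ?_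
    rintro _ ⟨m, hm, w', rfl | rfl⟩ <;> obtain ⟨v, rfl⟩ := Submodule.Quotient.mk_surjective _ w' <;>
      rw [SetLike.mem_coe, LinearMap.mem_ker, hχG]
    exacts [hχlow _ (L_smul_mem_lowSpan hm _), hχlow _ (G_smul_mem_lowSpan hm _)]
  refine ⟨(lowSpan _).liftQ χG hlow, fun y => ?_, ?_⟩
  · obtain ⟨w, rfl⟩ := (lowSpan _).mkQ_surjective y
    obtain ⟨v, rfl⟩ := Submodule.Quotient.mk_surjective _ w
    change χG (L (-1) • (Submodule.Quotient.mk v : VermaG c)) = χG (Submodule.Quotient.mk v)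
    rw [hχG, hχL]
    rfl
  · change χ ((1 : U) • hw c (c / 24)) = 1
    simp only [χ, one_smul, LinearMap.comp_apply, hK.HB, map_sub, map_smul, hL, h1, h3, smul_eq_mul]
    norm_num

/-! ### Kernel coefficients -/

/-- Any normal form of the vector has the same image in the quotient, and the separating functionals
recover its two coefficients from that image. -/
theorem hasCoeffs_even {c Δ a b : ℂ} {l : ℕ} {Ψ : Verma c Δ}
    (hex : ∃ θ, IsNormalForm c Δ l 1 Ψ θ) (hΨ : (lowSpan _).mkQ Ψ =
      kerEven (lowL _) (lowG _) (lowG₀ _) l a b ((lowSpan _).mkQ (hw c Δ))) :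
    HasCoeffs c Δ l 1 Ψ a b := by
  refine ⟨hex, fun θ ⟨hs, hθ⟩ => ?_⟩
  obtain ⟨φ, hL, h1, -, h3⟩ := exists_lowFunctional c Δ
  rw [← hθ, mkQ_even hs] at hΨ
  obtain ⟨e1, e2⟩ := (kernelRel _).functional_even hL h1 h3 l a b
  obtain ⟨e3, e4⟩ := (kernelRel _).functional_even hL h1 h3 l (coeffA l 1 θ) (coeffB l 1 θ)
  rw [hΨ, e1] at e3
  rw [hΨ, e2, ← e3] at e4
  exact ⟨e3.symm, (add_left_cancel e4).symm⟩

theorem hasCoeffs_odd {c Δ a b : ℂ} {l : ℕ} {Ψ : Verma c Δ}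
    (hex : ∃ θ, IsNormalForm c Δ l (-1) Ψ θ) (hΨ : (lowSpan _).mkQ Ψ =
      kerOdd (lowL _) (lowG _) (lowG₀ _) l a b ((lowSpan _).mkQ (hw c Δ))) :
    HasCoeffs c Δ l (-1) Ψ a b := by
  refine ⟨hex, fun θ ⟨hs, hθ⟩ => ?_⟩
  obtain ⟨φ, hL, h1, -, h3⟩ := exists_lowFunctional c Δ
  have hx := lowG₀_lowG₀ (isHW_hw c Δ)
  rw [← hθ, mkQ_odd hs] at hΨ
  obtain ⟨e1, e2⟩ := (kernelRel _).functional_odd hL h1 h3 hx l a b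
  obtain ⟨e3, e4⟩ := (kernelRel _).functional_odd hL h1 h3 hx l (coeffA l (-1) θ) (coeffB l (-1) θ)
  rw [hΨ, e1] at e3
  rw [hΨ, e2, ← e3] at e4
  exact ⟨e3.symm, (add_left_cancel e4).symm⟩

theorem lowG₀_hwG (c : ℂ) : lowG₀ _ ((lowSpan _).mkQ (hwG c)) = 0 := by
  rw [← mkQ_G_zero, G_zero_hwG, map_zero]

theorem stdSetG_subset (l : ℕ) (p : ℤˣ) : stdSetG l p ⊆ stdSet l p := fun _ h => ⟨h.1, h.2.1⟩

theorem hasCoeffVG_even {c a b : ℂ} {l : ℕ} {Ψ : VermaG c}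
    (hex : ∃ θ, IsNormalFormVG c l 1 Ψ θ) (hΨ : (lowSpan _).mkQ Ψ =
      kerEven (lowL _) (lowG _) (lowG₀ _) l a b ((lowSpan _).mkQ (hwG c))) :
    HasCoeffVG c l 1 Ψ a := by
  refine ⟨hex, fun θ ⟨hs, hθ⟩ => ?_⟩
  obtain ⟨φ, hL, h1⟩ := exists_lowFunctionalG c
  rw [← hθ, mkQ_even (hs.trans (stdSetG_subset _ _))] at hΨ
  have e := fun a b => ((kernelRel _).functional_closed hL h1 (lowG₀_hwG c) l a b).1
  rw [coeffVG, if_pos rfl, ← e (coeffA l 1 θ) (coeffB l 1 θ), hΨ, e]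

theorem hasCoeffVG_odd {c a b : ℂ} {l : ℕ} {Ψ : VermaG c}
    (hex : ∃ θ, IsNormalFormVG c l (-1) Ψ θ) (hΨ : (lowSpan _).mkQ Ψ =
      kerOdd (lowL _) (lowG _) (lowG₀ _) l a b ((lowSpan _).mkQ (hwG c))) :
    HasCoeffVG c l (-1) Ψ b := by
  refine ⟨hex, fun θ ⟨hs, hθ⟩ => ?_⟩
  obtain ⟨φ, hL, h1⟩ := exists_lowFunctionalG c
  rw [← hθ, mkQ_odd (hs.trans (stdSetG_subset _ _))] at hΨ
  have e := fun a b => ((kernelRel _).functional_closed hL h1 (lowG₀_hwG c) l a b).2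
  have h2 := e (coeffA l (-1) θ) (coeffB l (-1) θ)
  rw [hΨ, e] at h2
  rw [coeffVG, if_neg (by decide), mul_left_cancel₀ two_ne_zero h2]

theorem coeffB_zero {l : ℕ} (p : ℤˣ) (θ : NormalOp) (h : l = 0) : coeffB l p θ = 0 := if_pos h

/-! ### Products of singular vector operators -/

theorem Mono.eq_lead_of_level_eq_zero {X : Mono} (h : X.level = 0) : X = lead 0 0 X.r₂ := by
  simp only [Mono.level, Nat.add_eq_zero_iff, List.sum_eq_zero_iff] at h
  obtain ⟨⟨⟨h1, h2⟩, h3⟩, h4⟩ := h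
  have e1 : X.ls = [] := List.eq_nil_iff_forall_not_mem.2 fun m hm => by
    have := X.ls_ge m hm
    have := h1 m hm
    omega
  have e2 : X.gs = [] := List.eq_nil_iff_forall_not_mem.2 fun m hm => by
    have := X.gs_ge m hm
    have := h2 m hm
    omega
  have e4 : X.r₁ = 0 := Fin.ext h4
  rw [← h3, ← e4]
  exact Mono.eq_lead e1 e2

/-- An operator of level zero is a multiple of `1` or of `G_0`, according to its parity. -/
theorem toU_of_level_zero {θ : NormalOp} {p : ℤˣ} (h : (θ.support : Set Mono) ⊆ stdSet 0 p) :
    ∃ k : ℂ, θ.toU = k • if p = 1 then 1 else G 0 := by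
  refine ⟨∑ X ∈ θ.support, θ X, ?_⟩
  rw [NormalOp.toU, Finsupp.sum, Finset.sum_smul]
  refine Finset.sum_congr rfl fun X hX => ?_
  obtain ⟨hl, rfl⟩ := h hX
  rw [Mono.eq_lead_of_level_eq_zero hl]
  rcases fin_two_cases X.r₂ with e | e <;> simp [e, Mono.toU, Mono.parity, lead]

section product

variable {M : Type} [AddCommGroup M] [Module ℂ M] [Module U M] [IsScalarTower ℂ U M] {v Ψ : M}
  {c Δ₁ Δ₂ : ℂ} {l₁ l₂ : ℕ} {p₁ p₂ : ℤˣ} {θ₁ : NormalOp}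

theorem IsSingular.isHW (h : IsSingular v c Δ₂ l₂ p₂ Ψ) (hΔ : Δ₂ + l₂ = Δ₁) :
    IsHW c Δ₁ ((p₂ : ℤ) : ℂ) Ψ :=
  ⟨h.annL, h.annG, by rw [h.weight, hΔ], h.central, h.parity⟩

theorem unit_cast_mul_self (p : ℤˣ) : ((p : ℤ) : ℂ) * ((p : ℤ) : ℂ) = 1 := by
  rcases Int.units_eq_one_or p with rfl | rfl <;> simp

/-- The annihilators of a vector of a Verma module annihilate its image under the map to another
highest weight vector. -/
theorem rescaleF_smul_toU_smul (hv : IsHW c Δ₁ ((p₂ : ℤ) : ℂ) Ψ) {u : U}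
    (hu : u • θ₁.toU • hw c Δ₁ = 0) : rescaleF ((p₂ : ℤ) : ℂ) u • θ₁.toU • Ψ = 0 := by
  have := rescaleF_smul_eq_zero (unit_cast_mul_self p₂) hv (u := u * θ₁.toU)
    (by rw [mul_smul, hu])
  rwa [map_mul, rescaleF_toU, mul_smul] at this

theorem isSingular_mul (hv : L 0 • v = Δ₂ • v) (hl : 0 < l₁ + l₂) (hΔ : Δ₂ + l₂ = Δ₁)
    (h₁ : IsSingularOp c Δ₁ l₁ p₁ θ₁) (h₂ : IsSingular v c Δ₂ l₂ p₂ Ψ) :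
    θ₁.toU • Ψ = 0 ∨ IsSingular v c Δ₂ (l₁ + l₂) (p₁ * p₂) (θ₁.toU • Ψ) := by
  refine or_iff_not_imp_left.2 fun hne => ?_
  -- Apart from non-proportionality, each condition to be proved is the vanishing of some `u` on the
  -- product; it is inherited from the same condition on `θ₁|Δ₁⟩`.
  have key := fun u => rescaleF_smul_toU_smul (u := u) (θ₁ := θ₁) (h₂.isHW hΔ)
  have h := h₁.2
  have hw : L 0 • θ₁.toU • Ψ = (Δ₂ + (l₁ + l₂ : ℕ)) • θ₁.toU • Ψ := by
    have := key (L 0 - algebraMap ℂ U (Δ₁ + l₁))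
      (by rw [sub_smul, U_algebraMap_smul, h.weight, sub_self])
    rw [map_sub, rescaleF_L, AlgHom.commutes, sub_smul, U_algebraMap_smul, sub_eq_zero] at this
    rw [this, ← hΔ]
    push_cast
    ring_nf
  refine ⟨hw, ?_, ?_, fun m hm => ?_, fun m hm => ?_, fun k hk => ?_⟩
  · have := key (F - algebraMap ℂ U ((p₁ : ℤ) : ℂ))
      (by rw [sub_smul, U_algebraMap_smul, h.parity, sub_self])
    rw [map_sub, rescaleF_F, AlgHom.commutes, sub_smul, U_algebraMap_smul, sub_eq_zero,
      smul_assoc] at this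
    -- The rescaled parity operator `p₂F` acts by `p₁`; multiplying by `p₂` once more gives `F =
    -- p₁p₂`.
    rw [← one_smul ℂ (F • _), ← unit_cast_mul_self p₂, mul_smul, this, smul_smul]
    push_cast
    rw [mul_comm]
  · have := key (C - algebraMap ℂ U c)
      (by rw [sub_smul, U_algebraMap_smul, h.central, sub_self])
    rwa [map_sub, rescaleF_C, AlgHom.commutes, sub_smul, U_algebraMap_smul, sub_eq_zero] at this
  · rw [← rescaleF_L, key _ (h.annL m hm)]
  · rw [← rescaleF_G, key _ (h.annG m hm)]
  · apply hne
    have e : L 0 • θ₁.toU • Ψ = Δ₂ • θ₁.toU • Ψ := by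
      rw [hk, smul_comm (L 0) k v, hv, smul_comm]
    rw [hw, add_smul, add_eq_left] at e
    exact (smul_eq_zero.1 e).resolve_left (by exact_mod_cast hl.ne')

end product

end Ramond

end

noncomputable section

namespace Ramond

/-! ### Products of singular vectors -/

section kernelOfProducts

variable {c Δ₁ Δ₂ : ℂ} {l₁ l₂ : ℕ} {p₁ p₂ : ℤˣ} {θ₁ θ₂ : NormalOp}

theorem exists_isNormalForm_mul (h₁ : (θ₁.support : Set Mono) ⊆ stdSet l₁ p₁)
    (h₂ : (θ₂.support : Set Mono) ⊆ stdSet l₂ p₂) :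
    ∃ θ, IsNormalForm c Δ₂ (l₁ + l₂) (p₁ * p₂) ((θ₁.toU * θ₂.toU) • hw c Δ₂) θ :=
  exists_normalForm_mul (isHW_hw c Δ₂) h₁ h₂

theorem exists_isNormalFormVG_mul (h₁ : (θ₁.support : Set Mono) ⊆ stdSet l₁ p₁)
    (h₂ : (θ₂.support : Set Mono) ⊆ stdSetG l₂ p₂) :
    ∃ θ, IsNormalFormVG c (l₁ + l₂) (p₁ * p₂) ((θ₁.toU * θ₂.toU) • hwG c) θ :=
  exists_normalForm_mul_of_G_zero (isHW_hwG c) (G_zero_hwG c) h₁ (h₂.trans (stdSetG_subset _ _))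

section general

variable {M : Type*} [AddCommGroup M] [Module ℂ M] [Module U M] [IsScalarTower ℂ U M] {v : M}

theorem mkQ_even_even (h₁ : (θ₁.support : Set Mono) ⊆ stdSet l₁ 1)
    (h₂ : (θ₂.support : Set Mono) ⊆ stdSet l₂ 1) :
    (lowSpan M).mkQ ((θ₁.toU * θ₂.toU) • v) = kerEven (lowL M) (lowG M) (lowG₀ M) (l₁ + l₂)
      (coeffA l₁ 1 θ₁ * coeffA l₂ 1 θ₂)
      (coeffA l₁ 1 θ₁ * coeffB l₂ 1 θ₂ + coeffA l₂ 1 θ₂ * coeffB l₁ 1 θ₁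
        + 2 * coeffB l₁ 1 θ₁ * coeffB l₂ 1 θ₂) ((lowSpan M).mkQ v) := by
  rw [mul_smul, mkQ_even h₁, mkQ_even h₂, (kernelRel M).even_even (coeffB_zero _ _) (coeffB_zero _ _)]

theorem mkQ_even_odd {ε : ℂ} (hv : IsHW c Δ₂ ε v) (h₁ : (θ₁.support : Set Mono) ⊆ stdSet l₁ 1)
    (h₂ : (θ₂.support : Set Mono) ⊆ stdSet l₂ (-1)) :
    (lowSpan M).mkQ ((θ₁.toU * θ₂.toU) • v) = kerOdd (lowL M) (lowG M) (lowG₀ M) (l₁ + l₂)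
      (coeffA l₁ 1 θ₁ * coeffA l₂ (-1) θ₂)
      (coeffA l₁ 1 θ₁ * coeffB l₂ (-1) θ₂ + coeffA l₂ (-1) θ₂ * coeffB l₁ 1 θ₁ * (Δ₂ - c / 24)
        + 2 * coeffB l₁ 1 θ₁ * coeffB l₂ (-1) θ₂) ((lowSpan M).mkQ v) := by
  rw [mul_smul, mkQ_even h₁, mkQ_odd h₂,
    (kernelRel M).even_odd (lowG₀_lowG₀ hv) (coeffB_zero _ _) (coeffB_zero _ _)]

theorem mkQ_odd_even {ε : ℂ} (hv : IsHW c Δ₂ ε v) (h₁ : (θ₁.support : Set Mono) ⊆ stdSet l₁ (-1))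
    (h₂ : (θ₂.support : Set Mono) ⊆ stdSet l₂ 1) :
    (lowSpan M).mkQ ((θ₁.toU * θ₂.toU) • v) = kerOdd (lowL M) (lowG M) (lowG₀ M) (l₁ + l₂)
      (coeffA l₁ (-1) θ₁ * coeffA l₂ 1 θ₂ + 2 * coeffA l₁ (-1) θ₁ * coeffB l₂ 1 θ₂)
      (1 / 2 * l₂ * coeffA l₁ (-1) θ₁ * coeffA l₂ 1 θ₂ + coeffA l₂ 1 θ₂ * coeffB l₁ (-1) θ₁
        - coeffA l₁ (-1) θ₁ * coeffB l₂ 1 θ₂ * (Δ₂ - c / 24)) ((lowSpan M).mkQ v) := by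
  rw [mul_smul, mkQ_odd h₁, mkQ_even h₂,
    (kernelRel M).odd_even (lowG₀_lowG₀ hv) (coeffB_zero _ _) (coeffB_zero _ _)]

theorem mkQ_odd_odd {ε : ℂ} (hv : IsHW c Δ₂ ε v) (h₁ : (θ₁.support : Set Mono) ⊆ stdSet l₁ (-1))
    (h₂ : (θ₂.support : Set Mono) ⊆ stdSet l₂ (-1)) :
    (lowSpan M).mkQ ((θ₁.toU * θ₂.toU) • v) = kerEven (lowL M) (lowG M) (lowG₀ M) (l₁ + l₂)
      (coeffA l₁ (-1) θ₁ * coeffA l₂ (-1) θ₂ * (Δ₂ - c / 24)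
        + 2 * coeffA l₁ (-1) θ₁ * coeffB l₂ (-1) θ₂)
      (coeffA l₂ (-1) θ₂ * coeffB l₁ (-1) θ₁ + 1 / 2 * l₂ * coeffA l₁ (-1) θ₁ * coeffA l₂ (-1) θ₂
        - coeffA l₁ (-1) θ₁ * coeffB l₂ (-1) θ₂) ((lowSpan M).mkQ v) := by
  rw [mul_smul, mkQ_odd h₁, mkQ_odd h₂,
    (kernelRel M).odd_odd (lowG₀_lowG₀ hv) (coeffB_zero _ _) (coeffB_zero _ _)]

end general

theorem HasCoeffs.hasCoeffGClosed {p : ℤˣ} {Ψ : Verma c Δ₂} {l : ℕ} {a b : ℂ}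
    (h : HasCoeffs c Δ₂ l p Ψ a b) : HasCoeffGClosed c Δ₂ l p Ψ a :=
  ⟨h.1, fun θ hθ => (h.2 θ hθ).1⟩

theorem hasCoeffs_mul (h₁ : IsSingularOp c Δ₁ l₁ p₁ θ₁) (h₂ : IsSingularOp c Δ₂ l₂ p₂ θ₂) :
    let Ψ := (θ₁.toU * θ₂.toU) • hw c Δ₂
    let a₁ := coeffA l₁ p₁ θ₁
    let b₁ := coeffB l₁ p₁ θ₁
    let a₂ := coeffA l₂ p₂ θ₂
    let b₂ := coeffB l₂ p₂ θ₂
    (p₁ = 1 → p₂ = 1 → HasCoeffs c Δ₂ (l₁ + l₂) 1 Ψ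
        (a₁ * a₂) (a₁ * b₂ + a₂ * b₁ + 2 * b₁ * b₂)) ∧
      (p₁ = 1 → p₂ = -1 → HasCoeffs c Δ₂ (l₁ + l₂) (-1) Ψ
        (a₁ * a₂) (a₁ * b₂ + a₂ * b₁ * (Δ₂ - c / 24) + 2 * b₁ * b₂)) ∧
      (p₁ = -1 → p₂ = 1 → HasCoeffs c Δ₂ (l₁ + l₂) (-1) Ψ
        (a₁ * a₂ + 2 * a₁ * b₂)
        (1 / 2 * l₂ * a₁ * a₂ + a₂ * b₁ - a₁ * b₂ * (Δ₂ - c / 24))) ∧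
      (p₁ = -1 → p₂ = -1 → HasCoeffs c Δ₂ (l₁ + l₂) 1 Ψ
        (a₁ * a₂ * (Δ₂ - c / 24) + 2 * a₁ * b₂)
        (a₂ * b₁ + 1 / 2 * l₂ * a₁ * a₂ - a₁ * b₂)) := by
  have hex := exists_isNormalForm_mul (c := c) (Δ₂ := Δ₂) h₁.1 h₂.1
  have hv := isHW_hw c Δ₂
  refine ⟨?_, ?_, ?_, ?_⟩ <;> rintro rfl rfl
  · exact hasCoeffs_even hex (mkQ_even_even h₁.1 h₂.1)
  · exact hasCoeffs_odd (by simpa using hex) (mkQ_even_odd hv h₁.1 h₂.1)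
  · exact hasCoeffs_odd (by simpa using hex) (mkQ_odd_even hv h₁.1 h₂.1)
  · exact hasCoeffs_even (by simpa using hex) (mkQ_odd_odd hv h₁.1 h₂.1)

/-- The formulas for full Verma modules at `δ = 0`. Since `G_0` kills the generator, only one
coefficient of the second factor and of the product remains visible. -/
theorem hasCoeffVG_mul (h₁ : IsSingularOp c Δ₁ l₁ p₁ θ₁) (h₂ : IsSingularOpVG c l₂ p₂ θ₂) :
    let Ψ := (θ₁.toU * θ₂.toU) • hwG c
    let a₁ := coeffA l₁ p₁ θ₁
    let b₁ := coeffB l₁ p₁ θ₁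
    let d₂ := coeffVG l₂ p₂ θ₂
    (p₁ = 1 → p₂ = 1 → HasCoeffVG c (l₁ + l₂) 1 Ψ (a₁ * d₂)) ∧
      (p₁ = 1 → p₂ = -1 → HasCoeffVG c (l₁ + l₂) (-1) Ψ (a₁ * d₂ + 2 * b₁ * d₂)) ∧
      (p₁ = -1 → p₂ = 1 → HasCoeffVG c (l₁ + l₂) (-1) Ψ (1 / 2 * l₂ * a₁ * d₂ + d₂ * b₁)) ∧
      (p₁ = -1 → p₂ = -1 → HasCoeffVG c (l₁ + l₂) 1 Ψ (2 * a₁ * d₂)) := by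
  have hex := exists_isNormalFormVG_mul (c := c) h₁.1 h₂.1
  have hs := h₂.1.trans (stdSetG_subset _ _)
  have hv := isHW_hwG c
  have d1 : coeffVG l₂ 1 θ₂ = coeffA l₂ 1 θ₂ := if_pos rfl
  have d2 : coeffVG l₂ (-1) θ₂ = coeffB l₂ (-1) θ₂ := if_neg (by decide)
  refine ⟨?_, ?_, ?_, ?_⟩ <;> rintro rfl rfl
  · rw [d1]
    exact hasCoeffVG_even hex (mkQ_even_even h₁.1 hs)
  · have := hasCoeffVG_odd (by simpa using hex) (mkQ_even_odd hv h₁.1 hs)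
    rwa [sub_self, mul_zero, add_zero, ← d2] at this
  · have := hasCoeffVG_odd (by simpa using hex) (mkQ_odd_even hv h₁.1 hs)
    rwa [sub_self, mul_zero, sub_zero, ← d1] at this
  · have := hasCoeffVG_even (by simpa using hex) (mkQ_odd_odd hv h₁.1 hs)
    rwa [sub_self, mul_zero, zero_add, ← d2] at this

/-- A singular vector of the `G`-closed Verma module has positive level. -/
theorem IsSingularOpVG.level_pos {p : ℤˣ} (h : IsSingularOpVG c l₂ p θ₂) : 0 < l₂ := by
  by_contra! h0
  obtain rfl : l₂ = 0 := by omega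
  obtain ⟨k, hk⟩ := toU_of_level_zero (h.1.trans (stdSetG_subset _ _))
  have hn := h.2.not_prop
  rw [hk] at hn
  split_ifs at hn with hp
  · exact hn k (by rw [smul_assoc, one_smul])
  · refine hn 0 ?_
    rw [smul_assoc, G_zero_hwG]
    exact (smul_zero k).trans (zero_smul ℂ (hwG c)).symm

theorem IsHW.smul_G_zero_mul_smul_G_zero {M : Type*} [AddCommGroup M] [Module ℂ M] [Module U M]
    [IsScalarTower ℂ U M] {c Δ ε : ℂ} {v : M} (hv : IsHW c Δ ε v) (h : Δ - c / 24 = 0) (k₁ k₂ : ℂ) :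
    (k₁ • G 0 * k₂ • G 0) • v = 0 := by
  rw [mul_smul, smul_assoc, smul_assoc, smul_comm (G 0) k₂, hv.G_zero_G_zero, h, zero_smul, smul_zero,
    smul_zero]

/-- A singular vector operator of level zero is a multiple of `G_0`. -/
theorem IsSingularOp.eq_smul_G_zero {p : ℤˣ} (h : IsSingularOp c Δ₂ 0 p θ₂) :
    ∃ k : ℂ, θ₂.toU = k • G 0 := by
  obtain ⟨k, hk⟩ := toU_of_level_zero h.1
  have hn := h.2.not_prop
  split_ifs at hk with hp
  · exact absurd (by rw [hk, smul_assoc, one_smul]) (hn k)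
  · exact ⟨k, hk⟩

theorem isSingular_mul_G_closed (hΔ : Δ₂ + l₁ + l₂ = c / 24)
    (h₁ : IsSingularOp c (c / 24 - l₁) l₁ p₁ θ₁) (h₀ : G 0 • θ₁.toU • hw c (c / 24 - l₁) = 0)
    (h₂ : IsSingularOp c Δ₂ l₂ p₂ θ₂) :
    (θ₁.toU * θ₂.toU) • hw c Δ₂ = 0 ∨
      (IsSingular (hw c Δ₂) c Δ₂ (l₁ + l₂) (p₁ * p₂) ((θ₁.toU * θ₂.toU) • hw c Δ₂) ∧
        G 0 • (θ₁.toU * θ₂.toU) • hw c Δ₂ = 0) := by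
  have hΔ' : Δ₂ + l₂ = c / 24 - l₁ := by linear_combination hΔ
  rcases Nat.eq_zero_or_pos (l₁ + l₂) with hl | hl
  -- At level zero both operators are multiples of `G_0` and `Δ₂ = c/24`, so the product is a
  -- multiple of `G_0² = 0`.
  · left
    obtain ⟨rfl, rfl⟩ : l₁ = 0 ∧ l₂ = 0 := by omega
    obtain ⟨k₁, e₁⟩ := h₁.eq_smul_G_zero
    obtain ⟨k₂, e₂⟩ := h₂.eq_smul_G_zero
    have e : Δ₂ - c / 24 = 0 := by
      rw [← hΔ]
      simp
    rw [e₁, e₂]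
    exact (isHW_hw c Δ₂).smul_G_zero_mul_smul_G_zero e k₁ k₂
  · rw [mul_smul]
    refine (isSingular_mul (isHW_hw c Δ₂).weight hl hΔ' h₁ h₂.2).imp_right fun h => ⟨h, ?_⟩
    rw [← rescaleF_G, rescaleF_smul_toU_smul (h₂.2.isHW hΔ') h₀]

end kernelOfProducts

end Ramond

end

theorem mainTheorem3 (c : ℂ) :
    -- two singular vector operators for full Verma modules
    (∀ (Δ₁ Δ₂ : ℂ) (l₁ l₂ : ℕ) (p₁ p₂ : ℤˣ) (θ₁ θ₂ : Ramond.NormalOp),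
      Δ₂ + l₂ = Δ₁ →
      Ramond.IsSingularOp c Δ₁ l₁ p₁ θ₁ →
      Ramond.IsSingularOp c Δ₂ l₂ p₂ θ₂ →
      ∀ (Ψ : Ramond.Verma c Δ₂) (a₁ b₁ a₂ b₂ : ℂ),
      Ψ = (θ₁.toU * θ₂.toU) • Ramond.hw c Δ₂ →
      a₁ = Ramond.coeffA l₁ p₁ θ₁ → b₁ = Ramond.coeffB l₁ p₁ θ₁ →
      a₂ = Ramond.coeffA l₂ p₂ θ₂ → b₂ = Ramond.coeffB l₂ p₂ θ₂ →
      (0 < l₁ + l₂ →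
        Ψ = 0 ∨ Ramond.IsSingular (Ramond.hw c Δ₂) c Δ₂ (l₁ + l₂) (p₁ * p₂) Ψ) ∧
      (p₁ = 1 → p₂ = 1 → Ramond.HasCoeffs c Δ₂ (l₁ + l₂) 1 Ψ
        (a₁ * a₂) (a₁ * b₂ + a₂ * b₁ + 2 * b₁ * b₂)) ∧
      (p₁ = 1 → p₂ = -1 → Ramond.HasCoeffs c Δ₂ (l₁ + l₂) (-1) Ψ
        (a₁ * a₂) (a₁ * b₂ + a₂ * b₁ * (Δ₂ - c / 24) + 2 * b₁ * b₂)) ∧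
      (p₁ = -1 → p₂ = 1 → Ramond.HasCoeffs c Δ₂ (l₁ + l₂) (-1) Ψ
        (a₁ * a₂ + 2 * a₁ * b₂)
        (1 / 2 * l₂ * a₁ * a₂ + a₂ * b₁ - a₁ * b₂ * (Δ₂ - c / 24))) ∧
      (p₁ = -1 → p₂ = -1 → Ramond.HasCoeffs c Δ₂ (l₁ + l₂) 1 Ψ
        (a₁ * a₂ * (Δ₂ - c / 24) + 2 * a₁ * b₂)
        (a₂ * b₁ + 1 / 2 * l₂ * a₁ * a₂ - a₁ * b₂))) ∧
    -- the second operator is one for the `G`-closed Verma module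
    (∀ (Δ₁ : ℂ) (l₁ l₂ : ℕ) (p₁ p₂ : ℤˣ) (θ₁ θ₂ : Ramond.NormalOp),
      Δ₁ = c / 24 + l₂ →
      Ramond.IsSingularOp c Δ₁ l₁ p₁ θ₁ →
      Ramond.IsSingularOpVG c l₂ p₂ θ₂ →
      ∀ (Ψ : Ramond.VermaG c) (a₁ b₁ d₂ : ℂ),
      Ψ = (θ₁.toU * θ₂.toU) • Ramond.hwG c →
      a₁ = Ramond.coeffA l₁ p₁ θ₁ → b₁ = Ramond.coeffB l₁ p₁ θ₁ →
      d₂ = Ramond.coeffVG l₂ p₂ θ₂ →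
      (Ψ = 0 ∨ Ramond.IsSingular (Ramond.hwG c) c (c / 24) (l₁ + l₂) (p₁ * p₂) Ψ) ∧
      (p₁ = 1 → p₂ = 1 → Ramond.HasCoeffVG c (l₁ + l₂) 1 Ψ (a₁ * d₂)) ∧
      (p₁ = 1 → p₂ = -1 → Ramond.HasCoeffVG c (l₁ + l₂) (-1) Ψ (a₁ * d₂ + 2 * b₁ * d₂)) ∧
      (p₁ = -1 → p₂ = 1 → Ramond.HasCoeffVG c (l₁ + l₂) (-1) Ψ
        (1 / 2 * l₂ * a₁ * d₂ + d₂ * b₁)) ∧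
      (p₁ = -1 → p₂ = -1 → Ramond.HasCoeffVG c (l₁ + l₂) 1 Ψ (2 * a₁ * d₂))) ∧
    -- the first operator is that of a `G`-closed singular vector
    (∀ (Δ₂ : ℂ) (l₁ l₂ : ℕ) (p₁ p₂ : ℤˣ) (θ₁ θ₂ : Ramond.NormalOp),
      Δ₂ + l₁ + l₂ = c / 24 →
      Ramond.IsSingularOp c (c / 24 - l₁) l₁ p₁ θ₁ →
      Ramond.G 0 • (θ₁.toU • Ramond.hw c (c / 24 - l₁)) = 0 →
      Ramond.IsSingularOp c Δ₂ l₂ p₂ θ₂ →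
      ∀ (Ψ : Ramond.Verma c Δ₂) (a₁ a₂ b₂ : ℂ),
      Ψ = (θ₁.toU * θ₂.toU) • Ramond.hw c Δ₂ →
      a₁ = Ramond.coeffA l₁ p₁ θ₁ →
      a₂ = Ramond.coeffA l₂ p₂ θ₂ → b₂ = Ramond.coeffB l₂ p₂ θ₂ →
      (Ψ = 0 ∨ (Ramond.IsSingular (Ramond.hw c Δ₂) c Δ₂ (l₁ + l₂) (p₁ * p₂) Ψ ∧
        Ramond.G 0 • Ψ = 0)) ∧
      (p₁ = 1 → p₂ = 1 → Ramond.HasCoeffGClosed c Δ₂ (l₁ + l₂) 1 Ψ (a₁ * a₂)) ∧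
      (p₁ = 1 → p₂ = -1 → Ramond.HasCoeffGClosed c Δ₂ (l₁ + l₂) (-1) Ψ (a₁ * a₂)) ∧
      (p₁ = -1 → p₂ = 1 → Ramond.HasCoeffGClosed c Δ₂ (l₁ + l₂) (-1) Ψ
        (a₁ * a₂ + 2 * a₁ * b₂)) ∧
      (p₁ = -1 → p₂ = -1 → Ramond.HasCoeffGClosed c Δ₂ (l₁ + l₂) 1 Ψ
        (-(a₁ * a₂ * (l₁ + l₂)) + 2 * a₁ * b₂))) := by
  refine ⟨?_, ?_, ?_⟩
  · rintro Δ₁ Δ₂ l₁ l₂ p₁ p₂ θ₁ θ₂ hΔ h₁ h₂ _ _ _ _ _ rfl rfl rfl rfl rfl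
    refine ⟨fun hl => ?_, Ramond.hasCoeffs_mul h₁ h₂⟩
    rw [mul_smul]
    exact Ramond.isSingular_mul (Ramond.isHW_hw c Δ₂).weight hl hΔ h₁ h₂.2
  · rintro Δ₁ l₁ l₂ p₁ p₂ θ₁ θ₂ hΔ h₁ h₂ _ _ _ _ rfl rfl rfl rfl
    refine ⟨?_, Ramond.hasCoeffVG_mul h₁ h₂⟩
    rw [mul_smul]
    exact Ramond.isSingular_mul (Ramond.isHW_hwG c).weight (Nat.add_pos_right _ h₂.level_pos)
      hΔ.symm h₁ h₂.2
  · rintro Δ₂ l₁ l₂ p₁ p₂ θ₁ θ₂ hΔ h₁ h₀ h₂ _ _ _ _ rfl rfl rfl rfl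
    obtain ⟨e1, e2, e3, e4⟩ := Ramond.hasCoeffs_mul h₁ h₂
    refine ⟨Ramond.isSingular_mul_G_closed hΔ h₁ h₀ h₂, fun i j => (e1 i j).hasCoeffGClosed,
      fun i j => (e2 i j).hasCoeffGClosed, fun i j => (e3 i j).hasCoeffGClosed, fun i j => ?_⟩
    have h := (e4 i j).hasCoeffGClosed
    -- The weight condition fixes `δ = -(l₁ + l₂)`, which is the only change from the general
    -- odd-odd formula.
    rwa [show Δ₂ - c / 24 = -(l₁ + l₂ : ℂ) by linear_combination hΔ, mul_neg] at h
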